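/- Let $(X,d,\mu)$ be a separable metric space with a Borel measure such that, writing $B(x,r)$ for open balls and $V(x,r)=\mu(B(x,r))$, one has $0<V(x,r)<\infty$ for all $x\in X$, $r>0$, and, for some constants $c$ and $n>0$, $V(x,\lambda r)\le c\,\lambda^n V(x,r)$ for all $x\in X$, $r>0$, $\lambda\ge 1$. For $1\le p<2$ put $\sigma_p=\frac1p-\frac12$. For $\tau>0$, $a>0$, $K\ge 0$, a bounded operator $A$ on the complex space $L^2(X)=L^2(X,\mu)$ satisfies $\mathrm{PVE}^a_{p,2}(\tau)$ with constant $K$ if $$\big\|P_{B(x,\tau)}\,V_\tau^{\sigma_p}\,A\,P_{B(y,\tau)}\big\|_{p\to2}\le K\Big(1+\frac{d(x,y)}{\tau}\Big)^{-n-a}\qquad\text{for all }x,y\in X,$$ where $P_B$ is multiplication by the characteristic function of $B$ and $V_\tau^{\sigma_p}$ is multiplication by the function $z\mapsto V(z,\tau)^{\sigma_p}$. Here, for an operator $T$ on $L^2(X)$, $\|T\|_{p\to q}$ is the least $C\in[0,\infty]$ with $\|Tf\|_q\le C\|f\|_p$ for all $f\in L^2(X)\cap L^p(X)$. For a self-adjoint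 operator $L$ with spectral resolution $E$, $F(L)=\int F\,dE$. Let $\|F\|_{H^s}=\|(1-d^2/dx^2)^{s/2}F\|_{L^2(\mathbb R)}$. Fix $1\le p<2$, $a>[n/2]+1$ (where $[\cdot]$ is the integer part) and $K\ge0$. (1) For every $s>n\left(\frac1p-\frac12\right)+\frac12$ there is a constant $C<\infty$, depending only on $X,n,p,a,K,s$, such that for every non-negative self-adjoint (possibly unbounded) operator $L$ on $L^2(X)$ the following two statements hold. (i) For every $\tau>0$ for which $e^{-\tau L}$ satisfies $\mathrm{PVE}^a_{p,2}(\tau)$ with constant $K$, and every continuous $F:\mathbb R\to\mathbb C$ with $\operatorname{supp}F\subset[-1,1]$ and $F\in H^s(\mathbb R)$, $$\|F(\tau L)\|_{p\to p}\le C\|F\|_{H^s}.$$ (ii) If $e^{-\tau L}$ satisfies $\mathrm{PVE}^a_{p,2}(\tau)$ with the same constant $K$ for every $\tau>0$, then for every such $F$ $$\sup_{\tau>0}\|F(\tau L)\|_{p\to p}\le C\|F\|_{H^s}.$$ (2) (Bochner–Riesz summability.) For every $\alpha>n\left(\frac1p-\frac12\right)$ there is a constant $C<\infty$, depending only on $X,n,p,a,K,\alpha$,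 such that for every non-negative self-adjoint operator $L$ on $L^2(X)$ for which $e^{-\tau L}$ satisfies $\mathrm{PVE}^a_{p,2}(\tau)$ with constant $K$ for every $\tau>0$, $$\sup_{R>0}\Big\|\Big(1-\frac LR\Big)_+^{\alpha}\Big\|_{p\to p}\le C.$$ -/

import Mathlib

open MeasureTheory Metric Set
open scoped ENNReal NNReal FourierTransform

noncomputable section

/-! ### Spaces of homogeneous type -/

/-- The Borel measure `μ` on the metric space `X` satisfies
`V(x, l r) ≤ c l ^ n V(x, r)` for all `x`, `r > 0` and `l ≥ 1`, where `V(x, r) = μ (B(x, r))`,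
and all the volumes `V(x, r)` are positive and finite. -/
structure IsHomogeneousType {X : Type*} [MetricSpace X] [MeasurableSpace X]
    (μ : Measure X) (n : ℝ) : Prop where
  volume_pos : ∀ (x : X) (r : ℝ), 0 < r → 0 < μ (ball x r)
  volume_lt_top : ∀ (x : X) (r : ℝ), 0 < r → μ (ball x r) < ∞
  doubling : ∃ c : ℝ≥0, ∀ (x : X) (r l : ℝ), 0 < r → 1 ≤ l →
    μ (ball x (l * r)) ≤ c * ENNReal.ofReal (l ^ n) * μ (ball x r)

/-! ### Operator norms between Lebesgue spaces and off-diagonal estimates -/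

/-- The norm `‖T‖_{p → q}` of an operator `T` given on (complex) `L²`: the least `C` such that
`‖T f‖_q ≤ C ‖f‖_p` for all `f ∈ L² ∩ L^p`, and `∞` if there is no finite such `C`.
(For `p < ∞` the space `L² ∩ L^p` is dense in `L^p`, so that this is the norm of the extension
of `T` to `L^p`.) -/
def lebesgueOpNorm {X : Type*} [MeasurableSpace X] {μ : Measure X} (p q : ℝ≥0∞)
    (T : Lp ℂ 2 μ → X → ℂ) : ℝ≥0∞ :=
  sInf {C : ℝ≥0∞ | ∀ f : Lp ℂ 2 μ, eLpNorm f p μ < ∞ → eLpNorm (T f) q μ ≤ C * eLpNorm f p μ}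

/-- The projection `P_{B(x, r)}` on `L²`, that is, multiplication by the characteristic function
of the ball. -/
def ballProj {X : Type*} [MetricSpace X] [MeasurableSpace X] [BorelSpace X] {μ : Measure X}
    (x : X) (r : ℝ) (f : Lp ℂ 2 μ) : Lp ℂ 2 μ :=
  ((Lp.memLp f).indicator (measurableSet_ball (x := x) (ε := r))).toLp

/-- The polynomial off-diagonal estimate `PVE^a_{p,2}(τ)` with constant `K`:
`‖P_{B(x,τ)} V_τ^{1/p-1/2} A P_{B(y,τ)}‖_{p → 2} ≤ K (1 + d(x,y)/τ)^{-n-a}` for all `x, y`,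
where `V_τ` is multiplication by the function `z ↦ V(z, τ)`. -/
def PVE {X : Type*} [MetricSpace X] [MeasurableSpace X] [BorelSpace X] {μ : Measure X}
    (n a p τ : ℝ) (K : ℝ≥0) (A : Lp ℂ 2 μ →L[ℂ] Lp ℂ 2 μ) : Prop :=
  ∀ x y : X,
    lebesgueOpNorm (ENNReal.ofReal p) 2 (fun f : Lp ℂ 2 μ =>
        (ball x τ).indicator
          (fun z => ((μ.real (ball z τ) ^ (1 / p - 1 / 2) : ℝ) : ℂ) * A (ballProj y τ f) z))
      ≤ K * ENNReal.ofReal ((1 + dist x y / τ) ^ (-n - a))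

/-! ### Spectral resolutions and functions of a self-adjoint operator -/

/-- A projection-valued Borel measure on `ℝ` (the values of `proj` on sets that are not Borel
play no role). -/
structure ProjectionMeasure (H : Type*) [NormedAddCommGroup H] [InnerProductSpace ℂ H]
    [CompleteSpace H] where
  proj : Set ℝ → H →L[ℂ] H
  isSelfAdjoint_proj : ∀ S, MeasurableSet S → IsSelfAdjoint (proj S)
  proj_inter : ∀ S T, MeasurableSet S → MeasurableSet T → proj (S ∩ T) = proj S * proj T
  proj_univ : proj univ = 1
  hasSum_proj : ∀ S : ℕ → Set ℝ, (∀ i, MeasurableSet (S i)) →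
    Pairwise (Function.onFun Disjoint S) →
    ∀ f : H, HasSum (fun i => proj (S i) f) (proj (⋃ i, S i) f)

namespace ProjectionMeasure

variable {H : Type*} [NormedAddCommGroup H] [InnerProductSpace ℂ H] [CompleteSpace H]

theorem proj_empty (E : ProjectionMeasure H) : E.proj ∅ = 0 := by
  ext f
  have h := E.hasSum_proj (fun _ => ∅) (fun _ => MeasurableSet.empty)
    (fun _ _ _ => disjoint_bot_left) f
  have h0 := h.summable.tendsto_atTop_zero
  simpa using tendsto_nhds_unique tendsto_const_nhds h0

theorem inner_proj (E : ProjectionMeasure H) {S : Set ℝ} (hS : MeasurableSet S) (f : H) :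
    ‖E.proj S f‖ ^ 2 = (inner ℂ f (E.proj S f)).re := by
  have h1 : E.proj S f = E.proj S (E.proj S f) := by
    conv_lhs => rw [← inter_self S, E.proj_inter S S hS hS]
    rfl
  have h2 := (ContinuousLinearMap.isSelfAdjoint_iff_isSymmetric.1 (E.isSelfAdjoint_proj S hS))
    f (E.proj S f)
  simp only [ContinuousLinearMap.coe_coe] at h2
  rw [← h1] at h2
  rw [← h2]
  exact (inner_self_eq_norm_sq (𝕜 := ℂ) _).symm

/-- The scalar spectral measure `S ↦ ⟨f, E(S) f⟩ = ‖E(S) f‖²` of the vector `f`. -/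
def diag (E : ProjectionMeasure H) (f : H) : Measure ℝ :=
  Measure.ofMeasurable (fun S _ => ENNReal.ofReal (‖E.proj S f‖ ^ 2))
    (by simp [E.proj_empty])
    (by
      intro S hS hd
      have h := ((E.hasSum_proj S hS hd f).mapL (innerSL ℂ f)).mapL Complex.reCLM
      simp only [innerSL_apply_apply, Complex.reCLM_apply] at h
      simp only [← E.inner_proj (hS _), ← E.inner_proj (MeasurableSet.iUnion hS)] at h
      rw [← h.tsum_eq, ENNReal.ofReal_tsum_of_nonneg (fun _ => by positivity) h.summable])

open Classical in
/-- The bounded operator `∫ F(l) dE(l)`: the unique bounded operator `T` with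
`⟨f, T f⟩ = ∫ F(l) d⟨f, E(l) f⟩` for all `f`. It exists for every Borel function `F` that is
bounded almost everywhere with respect to `E`. -/
def integral (E : ProjectionMeasure H) (F : ℝ → ℂ) : H →L[ℂ] H :=
  if h : ∃ T : H →L[ℂ] H, ∀ f : H,
      Integrable F (E.diag f) ∧ inner ℂ f (T f) = ∫ l, F l ∂(E.diag f)
  then h.choose else 0

/-- `E` is the spectral resolution of the (unbounded) operator `L`, that is, `L = ∫ l dE(l)`:
the domain of `L` consists of the `f` with `∫ l² d⟨f, E(l) f⟩ < ∞`, and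
`⟨f, L f⟩ = ∫ l d⟨f, E(l) f⟩` for these `f`. -/
structure IsResolutionOf (E : ProjectionMeasure H) (L : H →ₗ.[ℂ] H) : Prop where
  mem_domain : ∀ f : H, f ∈ L.domain ↔ ∫⁻ l, ENNReal.ofReal (l ^ 2) ∂(E.diag f) < ∞
  inner_apply : ∀ f : L.domain,
    inner ℂ (f : H) (L f) = ∫ l, (l : ℂ) ∂(E.diag (f : H))

end ProjectionMeasure

open Classical in
/-- The operator `F(L) = ∫ F(l) dE(l)`, where `E` is the spectral resolution of the self-adjoint
operator `L` (which exists and is unique on Borel sets, by the spectral theorem). -/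
def spectralFunction {H : Type*} [NormedAddCommGroup H] [InnerProductSpace ℂ H] [CompleteSpace H]
    (L : H →ₗ.[ℂ] H) (F : ℝ → ℂ) : H →L[ℂ] H :=
  if h : ∃ E : ProjectionMeasure H, E.IsResolutionOf L then h.choose.integral F else 0

/-- The semigroup operator `e^{-τ L}`. -/
def heatSemigroup {H : Type*} [NormedAddCommGroup H] [InnerProductSpace ℂ H] [CompleteSpace H]
    (L : H →ₗ.[ℂ] H) (τ : ℝ) : H →L[ℂ] H :=
  spectralFunction L (fun l => Complex.exp (-(τ * l)))

/-- The Bochner-Riesz mean `(1 - L / R)_+^α`. -/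
def bochnerRiesz {H : Type*} [NormedAddCommGroup H] [InnerProductSpace ℂ H] [CompleteSpace H]
    (L : H →ₗ.[ℂ] H) (α R : ℝ) : H →L[ℂ] H :=
  spectralFunction L (fun l => ((max (1 - l / R) 0 ^ α : ℝ) : ℂ))

/-! ### Sobolev norm -/

/-- The norm `‖F‖_{H^s} = ‖(1 - d²/dx²)^{s/2} F‖_2` of an integrable function `F`, computed on the
Fourier side. Mathlib's `𝓕 F ξ = ∫ e^{-2πi x ξ} F(x) dx` turns `1 - d²/dx²` into multiplication
by `1 + (2πξ)²` and is an isometry of `L²`. -/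
def sobolevNorm (s : ℝ) (F : ℝ → ℂ) : ℝ≥0∞ :=
  eLpNorm (fun ξ : ℝ => (((1 + (2 * Real.pi * ξ) ^ 2) ^ (s / 2) : ℝ) : ℂ) * 𝓕 F ξ) 2 volume

end

noncomputable section

/-! ### Bounded Borel functional calculus of a projection-valued measure -/

section

variable {H : Type*} [NormedAddCommGroup H] [InnerProductSpace ℂ H]

/-! Put A = e^{-τL}, so that 0 ≤ A ≤ 1. The off-diagonal estimate concerns A alone, so everything is
expressed through A. On the spectral window τL ≤ 1 the values of A lie in [e⁻¹, 1], where -log is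
smooth; a smooth compactly supported h equal to -log there recovers τL as h(A). Fourier inversion
then gives F(τL) = ∫ F̂(ξ) e^{2πiξ h(A)} ω(A)A dξ, where ω(A)A is the identity on the window. With θ
= n(1/p - 1/2), the heart of the matter is ‖e^{ith(A)} ω(A)A‖_{p→p} ≤ C(1 + |t|)^θ, which is
`exists_eLpNorm_group_le`.

Weighted L² theory. Cut X into cells of size τ; the hypothesis becomes polynomial decay of the
blocks of A. If M is multiplication by a weight that is constant on cells, at least 1 and Lipschitz
at scale τ, then the commutator [M^{k+1}, A] is controlled by M^k as long as k + 1 ≤ κ = ⌊n/2⌋ + 1 <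
a (`exists_norm_commutator_weightOp_le`). Duhamel's formula turns this into polynomial growth of
e^{isA} on weighted spaces. Integrating against Fourier transforms of smooth symbols, ω(A) preserves
the weighted spaces and h(A) has the same commutator property as A. Duhamel's formula for e^{ith(A)}
gives the factor (1 + D|t|/R)^κ for weights bounded below by R, which is bounded once R ≥ |t|: up to
time t mass travels a distance of order Rτ only.

From L² to L^p. Let R = 1 + |t| and cut f into pieces on cells of size Rτ. The factor A takes a
piece from L^p to weighted L² at the cost V(·, τ)^{-σ}, σ = 1/p - 1/2, which is at most a multiple
of R^{nσ} V(·, Rτ)^{-σ}; this is the whole loss. Since 2κ > n, Hölder's inequality against the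
weight (1 + d/(Rτ))^{2κ} returns to L^p at the cost V(·, Rτ)^σ, and the same weight makes the pieces
summable (`exists_eLpNorm_le_of_weighted`).

It remains to bound ∫ |F̂(ξ)| (1 + 2π|ξ|)^θ dξ. Cauchy–Schwarz does it by the H^s norm when s > θ +
1/2. For Bochner–Riesz means, (1 - x)_+^α = e · g(1 - x) · e^{-x} with g(y) = y_+^α e^{-y}: the
factor e^{-x} is A itself, and ĝ decays like |ξ|^{-α-1}, which suffices for α > θ. -/

theorem ext_of_inner {S T : H →L[ℂ] H} (h : ∀ f : H, inner ℂ f (S f) = inner ℂ f (T f)) :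
    S = T := by
  have : (S : H →ₗ[ℂ] H) = T := by
    rw [← ext_inner_map]
    intro x
    have := congrArg (starRingEnd ℂ) (h x)
    simpa [inner_conj_symm] using this
  ext x
  exact congrArg (fun R : H →ₗ[ℂ] H => R x) this

/-- Polarization expresses ⟨Ty, x⟩ as a quarter of four values of the quadratic form. For unit
vectors the parallelogram law makes the four squared norms add up to 8, hence the factor 2. It is
harmless, as the bound only serves limits and integrability. -/
theorem norm_le_of_inner_le {T : H →L[ℂ] H} {C : ℝ} (hC : 0 ≤ C)
    (h : ∀ f : H, ‖inner ℂ f (T f)‖ ≤ C * ‖f‖ ^ 2) : ‖T‖ ≤ 2 * C := by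
  have key : ∀ x y : H, ‖x‖ = 1 → ‖y‖ = 1 → ‖inner ℂ (T y) x‖ ≤ 2 * C := by
    intro x y hx hy
    have h' : ∀ f : H, ‖inner ℂ (T f) f‖ ≤ C * ‖f‖ ^ 2 := fun f => by
      rw [norm_inner_symm]; exact h f
    have e := inner_map_polarization (T : H →ₗ[ℂ] H) x y
    simp only [ContinuousLinearMap.coe_coe] at e
    rw [e, norm_div]
    have n1 := h' (x + y)
    have n2 := h' (x - y)
    have n3 := h' (x + Complex.I • y)
    have n4 := h' (x - Complex.I • y)
    have p1 := parallelogram_law_with_norm ℂ x y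
    have p2 := parallelogram_law_with_norm ℂ x (Complex.I • y)
    rw [norm_smul, Complex.norm_I, one_mul] at p2
    rw [hx, hy] at p1 p2
    have t : ‖inner ℂ (T (x + y)) (x + y) - inner ℂ (T (x - y)) (x - y) +
        Complex.I * inner ℂ (T (x + Complex.I • y)) (x + Complex.I • y) -
        Complex.I * inner ℂ (T (x - Complex.I • y)) (x - Complex.I • y)‖ ≤
        C * ‖x + y‖ ^ 2 + C * ‖x - y‖ ^ 2 + C * ‖x + Complex.I • y‖ ^ 2
          + C * ‖x - Complex.I • y‖ ^ 2 := by
      refine (norm_sub_le _ _).trans (add_le_add ?_ (by simpa using n4))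
      refine (norm_add_le _ _).trans (add_le_add ?_ (by simpa using n3))
      exact (norm_sub_le _ _).trans (add_le_add n1 n2)
    rw [Complex.norm_ofNat, div_le_iff₀ (by norm_num)]
    refine t.trans ?_
    nlinarith
  refine ContinuousLinearMap.opNorm_le_bound _ (by positivity) fun y => ?_
  by_cases hy : y = 0
  · simp [hy]
  by_cases hT : T y = 0
  · rw [hT, norm_zero]; positivity
  have hy' : (‖y‖ : ℂ) ≠ 0 := by simpa using hy
  have hT' : (‖T y‖ : ℂ) ≠ 0 := by simpa using hT
  have := key ((‖T y‖ : ℂ)⁻¹ • T y) ((‖y‖ : ℂ)⁻¹ • y) (by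
    rw [norm_smul, norm_inv, Complex.norm_real, norm_norm, inv_mul_cancel₀ (by simpa using hT)]) (by
    rw [norm_smul, norm_inv, Complex.norm_real, norm_norm, inv_mul_cancel₀ (by simpa using hy)])
  rw [map_smul, inner_smul_left, inner_smul_right, inner_self_eq_norm_sq_to_K] at this
  simp only [norm_mul, map_inv₀, norm_inv, RCLike.norm_conj, Complex.norm_real, norm_norm,
    Complex.coe_algebraMap, norm_pow] at this
  have hyp : 0 < ‖y‖ := by simpa using hy
  have hTp : 0 < ‖T y‖ := by simpa using hT
  have e : ‖y‖⁻¹ * (‖T y‖⁻¹ * ‖T y‖ ^ 2) = ‖T y‖ / ‖y‖ := by field_simp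
  rw [e, div_le_iff₀ hyp] at this
  exact this

end

namespace ProjectionMeasure

variable {H : Type*} [NormedAddCommGroup H] [InnerProductSpace ℂ H] [CompleteSpace H]

theorem diag_apply (E : ProjectionMeasure H) (f : H) {S : Set ℝ} (hS : MeasurableSet S) :
    E.diag f S = ENNReal.ofReal (‖E.proj S f‖ ^ 2) := by
  rw [diag, Measure.ofMeasurable_apply S hS]

theorem diag_univ (E : ProjectionMeasure H) (f : H) :
    E.diag f univ = ENNReal.ofReal (‖f‖ ^ 2) := by
  rw [E.diag_apply f MeasurableSet.univ, E.proj_univ]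
  rfl

instance (E : ProjectionMeasure H) (f : H) : IsFiniteMeasure (E.diag f) :=
  ⟨by rw [E.diag_univ]; exact ENNReal.ofReal_lt_top⟩

theorem diag_real_univ (E : ProjectionMeasure H) (f : H) : (E.diag f).real univ = ‖f‖ ^ 2 := by
  rw [Measure.real, E.diag_univ, ENNReal.toReal_ofReal (by positivity)]

theorem diag_real_apply (E : ProjectionMeasure H) (f : H) {S : Set ℝ} (hS : MeasurableSet S) :
    (E.diag f).real S = ‖E.proj S f‖ ^ 2 := by
  rw [Measure.real, E.diag_apply f hS, ENNReal.toReal_ofReal (by positivity)]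

theorem diag_proj (E : ProjectionMeasure H) (f : H) {S : Set ℝ} (hS : MeasurableSet S) :
    E.diag (E.proj S f) = (E.diag f).restrict S := by
  ext T hT
  rw [Measure.restrict_apply hT, E.diag_apply _ hT, E.diag_apply _ (hT.inter hS),
    E.proj_inter T S hT hS]
  rfl

/-- The bounded operator `T` represents `∫ F dE` in the weak sense. -/
def HasIntegral (E : ProjectionMeasure H) (F : ℝ → ℂ) (T : H →L[ℂ] H) : Prop :=
  ∀ f : H, Integrable F (E.diag f) ∧ inner ℂ f (T f) = ∫ l, F l ∂(E.diag f)

namespace HasIntegral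

variable {E : ProjectionMeasure H} {F G : ℝ → ℂ} {S T : H →L[ℂ] H}

theorem unique (hS : E.HasIntegral F S) (hT : E.HasIntegral F T) : S = T :=
  ext_of_inner fun f => (hS f).2.trans (hT f).2.symm

theorem integral_eq (h : E.HasIntegral F T) : E.integral F = T := by
  have hex : ∃ T : H →L[ℂ] H, ∀ f : H,
      Integrable F (E.diag f) ∧ inner ℂ f (T f) = ∫ l, F l ∂(E.diag f) := ⟨T, h⟩
  rw [ProjectionMeasure.integral, dif_pos hex]
  exact unique hex.choose_spec h

theorem congr_ae (h : E.HasIntegral F T) (hFG : ∀ f, F =ᵐ[E.diag f] G) : E.HasIntegral G T :=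
  fun f => ⟨(h f).1.congr (hFG f), (h f).2.trans (integral_congr_ae (hFG f))⟩

theorem indicator_one (E : ProjectionMeasure H) {A : Set ℝ} (hA : MeasurableSet A) :
    E.HasIntegral (A.indicator 1) (E.proj A) := by
  intro f
  refine ⟨(integrable_const (1 : ℂ)).indicator hA, ?_⟩
  have e : ∫ l, A.indicator (1 : ℝ → ℂ) l ∂(E.diag f) = ((E.diag f).real A : ℂ) := by
    rw [integral_indicator hA]
    simp
  rw [e, E.diag_real_apply f hA, E.inner_proj hA]
  refine (Complex.conj_eq_iff_re.1 ?_).symm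
  rw [inner_conj_symm]
  exact (ContinuousLinearMap.isSelfAdjoint_iff_isSymmetric.1 (E.isSelfAdjoint_proj A hA)) f f

theorem one (E : ProjectionMeasure H) : E.HasIntegral (fun _ => 1) 1 := by
  have := indicator_one E MeasurableSet.univ
  rwa [E.proj_univ, indicator_univ] at this

theorem add (hS : E.HasIntegral F S) (hT : E.HasIntegral G T) :
    E.HasIntegral (fun l => F l + G l) (S + T) := fun f => by
  refine ⟨(hS f).1.add (hT f).1, ?_⟩
  rw [_root_.add_apply, inner_add_right, (hS f).2, (hT f).2,
    integral_add (hS f).1 (hT f).1]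

theorem const_mul (c : ℂ) (hT : E.HasIntegral F T) :
    E.HasIntegral (fun l => c * F l) (c • T) := fun f => by
  refine ⟨(hT f).1.const_mul c, ?_⟩
  rw [_root_.smul_apply, inner_smul_right, (hT f).2, integral_const_mul]

theorem sub (hS : E.HasIntegral F S) (hT : E.HasIntegral G T) :
    E.HasIntegral (fun l => F l - G l) (S - T) := fun f => by
  refine ⟨(hS f).1.sub (hT f).1, ?_⟩
  rw [_root_.sub_apply, inner_sub_right, (hS f).2, (hT f).2,
    integral_sub (hS f).1 (hT f).1]

theorem conj (hT : E.HasIntegral F T) :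
    E.HasIntegral (fun l => starRingEnd ℂ (F l)) (ContinuousLinearMap.adjoint T) := fun f => by
  refine ⟨Complex.conjCLE.toContinuousLinearMap.integrable_comp (hT f).1, ?_⟩
  rw [ContinuousLinearMap.adjoint_inner_right, integral_conj, ← (hT f).2, inner_conj_symm]

theorem norm_le (hT : E.HasIntegral F T) {C : ℝ} (hC : 0 ≤ C) (hF : ∀ l, ‖F l‖ ≤ C) :
    ‖T‖ ≤ 2 * C := by
  refine norm_le_of_inner_le hC fun f => ?_
  rw [(hT f).2]
  refine (norm_integral_le_of_norm_le_const (Filter.Eventually.of_forall hF)).trans ?_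
  rw [E.diag_real_univ]

/-- Existence is stable under uniform limits. -/
theorem exists_of_approx (hF : Measurable F)
    (h : ∀ ε : ℝ, 0 < ε → ∃ G T, E.HasIntegral G T ∧ ∀ l, ‖F l - G l‖ ≤ ε) :
    ∃ T, E.HasIntegral F T := by
  have hpos : ∀ n : ℕ, (0 : ℝ) < 1 / (n + 1) := fun n => by positivity
  choose G T hT hG using fun n : ℕ => h (1 / (n + 1)) (hpos n)
  have hlim : Filter.Tendsto (fun n : ℕ => (1 : ℝ) / (n + 1)) Filter.atTop (nhds 0) :=
    tendsto_one_div_add_atTop_nhds_zero_nat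
  have hc : CauchySeq T := by
    refine cauchySeq_of_le_tendsto_0 (fun n : ℕ => 4 * ((1 : ℝ) / (n + 1))) (fun m k N hm hk => ?_)
      (by simpa using hlim.const_mul 4)
    rw [dist_eq_norm]
    have hle : ∀ j : ℕ, N ≤ j → (1 : ℝ) / (j + 1) ≤ 1 / (N + 1) := fun j hj => by
      have : (N : ℝ) ≤ j := by exact_mod_cast hj
      gcongr
    have := ((hT m).sub (hT k)).norm_le (C := 2 * (1 / ((N : ℝ) + 1))) (by positivity) (fun l => by
      have e : G m l - G k l = (F l - G k l) - (F l - G m l) := by ring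
      rw [e]
      refine (norm_sub_le _ _).trans ?_
      linarith [hG m l, hG k l, hle m hm, hle k hk])
    linarith
  obtain ⟨T', hT'⟩ := cauchySeq_tendsto_of_complete hc
  refine ⟨T', fun f => ?_⟩
  have hint : Integrable F (E.diag f) := by
    have h1 : Integrable (fun l => F l - G 0 l) (E.diag f) := by
      refine Integrable.of_bound (hF.aestronglyMeasurable.sub (hT 0 f).1.1) (1 / ((0 : ℕ) + 1))
        (Filter.Eventually.of_forall (hG 0))
    exact (h1.add (hT 0 f).1).congr (Filter.Eventually.of_forall fun l => by simp)
  refine ⟨hint, ?_⟩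
  have l1 : Filter.Tendsto (fun k => inner ℂ f (T k f)) Filter.atTop (nhds (inner ℂ f (T' f))) :=
    (tendsto_const_nhds).inner ((ContinuousLinearMap.apply ℂ H f).continuous.tendsto T' |>.comp hT')
  have l2 : Filter.Tendsto (fun k => inner ℂ f (T k f)) Filter.atTop
      (nhds (∫ l, F l ∂(E.diag f))) := by
    rw [tendsto_iff_norm_sub_tendsto_zero]
    refine squeeze_zero (fun _ => norm_nonneg _) (fun k => ?_)
      (by simpa only [zero_mul] using hlim.mul_const ((E.diag f).real univ))
    rw [(hT k f).2, ← integral_sub (hT k f).1 hint]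
    refine norm_integral_le_of_norm_le_const (Filter.Eventually.of_forall fun l => ?_)
    rw [norm_sub_rev]
    exact hG k l
  exact tendsto_nhds_unique l1 l2

end HasIntegral

end ProjectionMeasure

/-- A bounded Borel function is a uniform limit of simple functions. -/
theorem exists_simpleFunc_norm_sub_le {F : ℝ → ℂ} (hF : Measurable F) {C : ℝ}
    (hC : ∀ l, ‖F l‖ ≤ C) {ε : ℝ} (hε : 0 < ε) :
    ∃ s : SimpleFunc ℝ ℂ, ∀ l, ‖F l - s l‖ ≤ ε := by
  -- The range lies in a compact disc, so finitely many points of a dense sequence come ε-close to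
  -- all of it; rounding to the nearest of them is a simple function.
  obtain ⟨N, hN⟩ : ∃ N : ℕ, closedBall (0 : ℂ) C ⊆ ⋃ k ∈ Finset.range (N + 1),
      ball (TopologicalSpace.denseSeq ℂ k) ε := by
    have hcomp := isCompact_closedBall (0 : ℂ) C
    obtain ⟨t, ht⟩ := hcomp.elim_finite_subcover
      (fun k => ball (TopologicalSpace.denseSeq ℂ k) ε) (fun _ => isOpen_ball) (fun z _ => by
        obtain ⟨k, hk⟩ := (TopologicalSpace.denseRange_denseSeq ℂ).exists_dist_lt z hε
        exact mem_iUnion.2 ⟨k, hk⟩)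
    obtain ⟨N, hN⟩ := t.exists_nat_subset_range
    refine ⟨N, ht.trans ?_⟩
    refine biUnion_subset_biUnion_left fun k hk => ?_
    have := Finset.mem_range.1 (hN hk)
    exact Finset.mem_range.2 (by omega)
  refine ⟨(SimpleFunc.nearestPt (TopologicalSpace.denseSeq ℂ) N).comp F hF, fun l => ?_⟩
  have hl : F l ∈ closedBall (0 : ℂ) C := by simpa using hC l
  obtain ⟨k, hk, hkl⟩ := mem_iUnion₂.1 (hN hl)
  have hkN : k ≤ N := by have := Finset.mem_range.1 hk; omega
  have h1 := SimpleFunc.edist_nearestPt_le (TopologicalSpace.denseSeq ℂ) (F l) hkN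
  rw [edist_dist, edist_dist, ENNReal.ofReal_le_ofReal_iff dist_nonneg] at h1
  rw [SimpleFunc.coe_comp, Function.comp, ← dist_eq_norm, dist_comm]
  refine h1.trans ?_
  rw [dist_comm]
  exact (mem_ball.1 hkl).le

namespace ProjectionMeasure

variable {H : Type*} [NormedAddCommGroup H] [InnerProductSpace ℂ H] [CompleteSpace H]
variable {E : ProjectionMeasure H} {F G : ℝ → ℂ} {S T : H →L[ℂ] H}

theorem hasIntegral_simpleFunc (E : ProjectionMeasure H) (s : SimpleFunc ℝ ℂ) :
    ∃ T, E.HasIntegral s T := by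
  induction s using SimpleFunc.induction with
  | const c hs =>
    rename_i A
    refine ⟨c • E.proj A, ?_⟩
    convert (HasIntegral.indicator_one E hs).const_mul c using 1
    ext l
    by_cases hl : l ∈ A <;> simp [hl]
  | add _ h1 h2 =>
    obtain ⟨T1, h1⟩ := h1
    obtain ⟨T2, h2⟩ := h2
    exact ⟨T1 + T2, h1.add h2⟩

theorem exists_hasIntegral (E : ProjectionMeasure H) (hF : Measurable F) {C : ℝ}
    (hC : ∀ l, ‖F l‖ ≤ C) : ∃ T, E.HasIntegral F T := by
  refine HasIntegral.exists_of_approx hF fun ε hε => ?_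
  obtain ⟨s, hs⟩ := exists_simpleFunc_norm_sub_le hF hC hε
  obtain ⟨T, hT⟩ := E.hasIntegral_simpleFunc s
  exact ⟨s, T, hT, hs⟩

theorem hasIntegral_integral (E : ProjectionMeasure H) (hF : Measurable F) {C : ℝ}
    (hC : ∀ l, ‖F l‖ ≤ C) : E.HasIntegral F (E.integral F) := by
  obtain ⟨T, hT⟩ := E.exists_hasIntegral hF hC
  rwa [hT.integral_eq]

/-! ### Multiplicativity of the functional calculus. -/

namespace HasIntegral

/-- Projecting the vector restricts its spectral measure, by `diag_proj`. Quadratic forms see only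
the two-sided compression; the one-sided product has to wait for commutation. -/
theorem indicator_aux (hT : E.HasIntegral F T) {A : Set ℝ} (hA : MeasurableSet A) :
    E.HasIntegral (A.indicator F) (E.proj A * T * E.proj A) := by
  intro f
  refine ⟨(hT f).1.indicator hA, ?_⟩
  have h1 := (ContinuousLinearMap.isSelfAdjoint_iff_isSymmetric.1 (E.isSelfAdjoint_proj A hA))
    f (T (E.proj A f))
  simp only [ContinuousLinearMap.coe_coe] at h1
  rw [mul_apply_eq_comp, mul_apply_eq_comp, ← h1, (hT _).2,
    E.diag_proj f hA, integral_indicator hA]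

/-- Splitting the symbol over `A` and its complement, uniqueness gives T = PTP + P'TP' with
complementary projections P and P'. Such a block diagonal operator commutes with P. -/
theorem commute_proj (hT : E.HasIntegral F T) {A : Set ℝ} (hA : MeasurableSet A) :
    Commute T (E.proj A) := by
  have e : T = E.proj A * T * E.proj A + E.proj Aᶜ * T * E.proj Aᶜ := by
    refine hT.unique ?_
    have := (hT.indicator_aux hA).add (hT.indicator_aux hA.compl)
    simpa [Set.indicator_self_add_compl_apply] using this
  have h1 : E.proj A * E.proj A = E.proj A := by rw [← E.proj_inter A A hA hA, inter_self]
  have h2 : E.proj A * E.proj Aᶜ = 0 := by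
    rw [← E.proj_inter A _ hA hA.compl, inter_compl_self, E.proj_empty]
  have h3 : E.proj Aᶜ * E.proj A = 0 := by
    rw [← E.proj_inter _ A hA.compl hA, compl_inter_self, E.proj_empty]
  have l : T * E.proj A = E.proj A * T * E.proj A := by
    conv_lhs => rw [e]
    rw [add_mul, mul_assoc _ (E.proj A) (E.proj A), h1, mul_assoc _ (E.proj Aᶜ), h3, mul_zero,
      add_zero]
  have r : E.proj A * T = E.proj A * T * E.proj A := by
    conv_lhs => rw [e]
    rw [mul_add, ← mul_assoc, ← mul_assoc, h1, ← mul_assoc, ← mul_assoc, h2, zero_mul, zero_mul,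
      add_zero]
  exact l.trans r.symm

theorem mul_indicator (hT : E.HasIntegral F T) {A : Set ℝ} (hA : MeasurableSet A) :
    E.HasIntegral (A.indicator F) (T * E.proj A) := by
  have := hT.indicator_aux hA
  rwa [← (hT.commute_proj hA).eq, mul_assoc, ← E.proj_inter A A hA hA, inter_self] at this

theorem mul_simpleFunc (hT : E.HasIntegral F T) (s : SimpleFunc ℝ ℂ) :
    ∀ S, E.HasIntegral s S → E.HasIntegral (fun l => F l * s l) (T * S) := by
  induction s using SimpleFunc.induction with
  | const c hs =>
    rename_i A
    intro S hS
    have h1 : E.HasIntegral (SimpleFunc.piecewise A hs (SimpleFunc.const ℝ c)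
        (SimpleFunc.const ℝ 0)) (c • E.proj A) := by
      convert (indicator_one E hs).const_mul c using 1
      ext l
      by_cases hl : l ∈ A <;> simp [hl]
    rw [hS.unique h1, mul_smul_comm]
    convert (hT.mul_indicator hs).const_mul c using 1
    ext l
    by_cases hl : l ∈ A <;> simp [hl, mul_comm]
  | @add s1 s2 _ h1 h2 =>
    intro S hS
    obtain ⟨T1, k1⟩ := E.hasIntegral_simpleFunc s1
    obtain ⟨T2, k2⟩ := E.hasIntegral_simpleFunc s2
    have : E.HasIntegral (s1 + s2 : SimpleFunc ℝ ℂ) (T1 + T2) := k1.add k2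
    rw [hS.unique this, mul_add]
    convert (h1 T1 k1).add (h2 T2 k2) using 1
    ext l
    simp [mul_add]

/-- Linearity reduces simple `G` to projections. A bounded `G` is replaced by a uniformly close
simple function, and `norm_le` controls the error in both operators. -/
theorem mul (hT : E.HasIntegral F T) (hS : E.HasIntegral G S) (hG : Measurable G) {C C' : ℝ}
    (hC : ∀ l, ‖G l‖ ≤ C) (hF : Measurable F) (hC' : ∀ l, ‖F l‖ ≤ C') :
    E.HasIntegral (fun l => F l * G l) (T * S) := by
  have hC0 : 0 ≤ C := (norm_nonneg _).trans (hC 0)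
  have hC0' : 0 ≤ C' := (norm_nonneg _).trans (hC' 0)
  have hFG := E.hasIntegral_integral (hF.mul hG) (C := C' * C) (fun l => by
    simp only [Pi.mul_apply, norm_mul]
    exact mul_le_mul (hC' l) (hC l) (norm_nonneg _) hC0')
  suffices h : T * S = E.integral (F * G) by rw [h]; exact hFG
  rw [← sub_eq_zero, ← norm_le_zero_iff]
  refine le_of_forall_pos_le_add fun ε hε => ?_
  have hd : 0 < 2 * C' + ‖T‖ * 2 + 1 := by positivity
  obtain ⟨s, hs⟩ := exists_simpleFunc_norm_sub_le hG hC (ε := ε / (2 * C' + ‖T‖ * 2 + 1))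
    (by positivity)
  obtain ⟨S', hS'⟩ := E.hasIntegral_simpleFunc s
  have h1 := (hS.sub hS').norm_le (by positivity) hs
  have h2 := (hFG.sub (hT.mul_simpleFunc s S' hS')).norm_le
    (C := C' * (ε / (2 * C' + ‖T‖ * 2 + 1))) (by positivity) (fun l => by
      simp only [Pi.mul_apply]
      rw [← mul_sub, norm_mul]
      exact mul_le_mul (hC' l) (hs l) (norm_nonneg _) hC0')
  have e : T * S - E.integral (F * G) = T * (S - S') - (E.integral (F * G) - T * S') := by
    rw [mul_sub]; abel
  rw [e, zero_add]
  refine (norm_sub_le _ _).trans ?_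
  have h3 : ‖T * (S - S')‖ ≤ ‖T‖ * (2 * (ε / (2 * C' + ‖T‖ * 2 + 1))) :=
    (norm_mul_le _ _).trans (by gcongr)
  have e2 : ε = (ε / (2 * C' + ‖T‖ * 2 + 1)) * (2 * C' + ‖T‖ * 2 + 1) := by field_simp
  have hq : 0 < ε / (2 * C' + ‖T‖ * 2 + 1) := by positivity
  nlinarith

end HasIntegral

/-- If the symbols have no integral, both sides are the default value 0, so no boundedness is
required. -/
theorem integral_congr_ae (hFG : ∀ f, F =ᵐ[E.diag f] G) : E.integral F = E.integral G := by
  by_cases h : ∃ T, E.HasIntegral F T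
  · obtain ⟨T, hT⟩ := h
    rw [hT.integral_eq, (hT.congr_ae hFG).integral_eq]
  · have h' : ¬ ∃ T, E.HasIntegral G T := fun ⟨T, hT⟩ =>
      h ⟨T, hT.congr_ae fun f => (hFG f).symm⟩
    unfold HasIntegral at h h'
    rw [integral, integral, dif_neg h, dif_neg h']

theorem integral_mul (hF : Measurable F) (hG : Measurable G) {C C' : ℝ} (hC : ∀ l, ‖F l‖ ≤ C)
    (hC' : ∀ l, ‖G l‖ ≤ C') :
    E.integral (fun l => F l * G l) = E.integral F * E.integral G :=
  ((E.hasIntegral_integral hF hC).mul (E.hasIntegral_integral hG hC') hG hC' hF hC).integral_eq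

/-- The spectral resolution of a non-negative operator is carried by `[0, ∞)`. -/
theorem IsResolutionOf.ae_nonneg {L : H →ₗ.[ℂ] H} (hE : E.IsResolutionOf L)
    (hL : ∀ f : L.domain, 0 ≤ (inner ℂ (f : H) (L f)).re) (f : H) :
    ∀ᵐ l ∂(E.diag f), 0 ≤ l := by
  -- The interval is bounded so that the projected vector g lies in the domain of `L`. There ⟨g, Lg⟩
  -- ≥ 0 is the integral of a negative function, which leaves no mass.
  have key : ∀ N : ℕ, E.diag f (Ioo (-(N : ℝ)) 0) = 0 := by
    intro N
    have hm : MeasurableSet (Ioo (-(N : ℝ)) 0) := measurableSet_Ioo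
    set g := E.proj (Ioo (-(N : ℝ)) 0) f with hg
    have hdg : E.diag g = (E.diag f).restrict (Ioo (-(N : ℝ)) 0) := E.diag_proj f hm
    have hb : ∀ᵐ l ∂(E.diag g), l ∈ Ioo (-(N : ℝ)) 0 := by
      rw [hdg]; exact ae_restrict_mem hm
    have hgd : g ∈ L.domain := by
      rw [hE.mem_domain]
      refine lt_of_le_of_lt (lintegral_mono_ae (g := fun _ => ENNReal.ofReal ((N : ℝ) ^ 2)) ?_) ?_
      · filter_upwards [hb] with l hl
        refine ENNReal.ofReal_le_ofReal ?_
        nlinarith [hl.1, hl.2]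
      · rw [lintegral_const]
        exact ENNReal.mul_lt_top ENNReal.ofReal_lt_top (measure_lt_top _ _)
    have h1 := hL ⟨g, hgd⟩
    have e1 : ∫ l : ℝ, (l : ℂ) ∂(E.diag g) = ((∫ l : ℝ, l ∂(E.diag g) : ℝ) : ℂ) := integral_ofReal
    rw [hE.inner_apply ⟨g, hgd⟩, e1, Complex.ofReal_re] at h1
    have hint : Integrable (fun l : ℝ => -l) (E.diag g) := by
      refine Integrable.of_bound measurable_neg.aestronglyMeasurable (N : ℝ) ?_
      filter_upwards [hb] with l hl
      rw [norm_neg, Real.norm_eq_abs, abs_le]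
      exact ⟨hl.1.le, hl.2.le.trans (Nat.cast_nonneg N)⟩
    have hnn : 0 ≤ᵐ[E.diag g] (fun l : ℝ => -l) := by
      filter_upwards [hb] with l hl
      simpa using hl.2.le
    have h0 : ∫ l, -l ∂(E.diag g) = 0 := by
      refine le_antisymm ?_ (integral_nonneg_of_ae hnn)
      rw [MeasureTheory.integral_neg]
      exact neg_nonpos.2 h1
    rw [integral_eq_zero_iff_of_nonneg_ae hnn hint] at h0
    have hfalse : ∀ᵐ l ∂(E.diag g), False := by
      filter_upwards [hb, h0] with l hl hl0
      have : l = 0 := by simpa using hl0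
      exact absurd hl.2 (by simp [this])
    have hz : E.diag g = 0 := by simpa using hfalse
    rw [hdg, Measure.restrict_eq_zero] at hz
    exact hz
  have hu : {l : ℝ | ¬ 0 ≤ l} = ⋃ N : ℕ, Ioo (-(N : ℝ)) 0 := by
    ext l
    simp only [mem_ofPred_eq, not_le, mem_iUnion, mem_Ioo]
    refine ⟨fun hl => ?_, fun ⟨_, h⟩ => h.2⟩
    obtain ⟨N, hN⟩ := exists_nat_gt (-l)
    exact ⟨N, by linarith, hl⟩
  rw [ae_iff, hu, measure_iUnion_null_iff]
  exact key

end ProjectionMeasure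

/-! ### Unitary groups and commutators -/

namespace ProjectionMeasure

variable {H : Type*} [NormedAddCommGroup H] [InnerProductSpace ℂ H] [CompleteSpace H]

/-- The unitary group `e^{i t g(L)}` of the bounded self-adjoint operator `∫ g dE`. -/
def group (E : ProjectionMeasure H) (g : ℝ → ℝ) (t : ℝ) : H →L[ℂ] H :=
  E.integral fun l => Complex.exp (Complex.I * t * g l)

variable {E : ProjectionMeasure H} {g : ℝ → ℝ} {C : ℝ}

theorem norm_exp_I_mul (t x : ℝ) : ‖Complex.exp (Complex.I * t * x)‖ = 1 := by
  have : Complex.I * t * x = ((t * x : ℝ) : ℂ) * Complex.I := by push_cast; ring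
  rw [this, Complex.norm_exp_ofReal_mul_I]

theorem measurable_exp_I_mul (hg : Measurable g) (t : ℝ) :
    Measurable fun l => Complex.exp (Complex.I * t * g l) := by fun_prop

theorem hasIntegral_group (E : ProjectionMeasure H) (hg : Measurable g) (t : ℝ) :
    E.HasIntegral (fun l => Complex.exp (Complex.I * t * g l)) (E.group g t) :=
  E.hasIntegral_integral (measurable_exp_I_mul hg t) fun _ => (norm_exp_I_mul _ _).le

theorem group_zero (E : ProjectionMeasure H) (hg : Measurable g) : E.group g 0 = 1 := by
  refine (E.hasIntegral_group hg 0).unique ?_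
  simpa using HasIntegral.one E

theorem group_add (hg : Measurable g) (s t : ℝ) :
    E.group g (s + t) = E.group g s * E.group g t := by
  rw [group, group, group, ← integral_mul (measurable_exp_I_mul hg s) (measurable_exp_I_mul hg t)
    (fun _ => (norm_exp_I_mul _ _).le) (fun _ => (norm_exp_I_mul _ _).le)]
  congr 1
  ext l
  rw [← Complex.exp_add]
  congr 1
  push_cast
  ring

theorem adjoint_group (hg : Measurable g) (t : ℝ) :
    ContinuousLinearMap.adjoint (E.group g t) = E.group g (-t) := by
  refine (E.hasIntegral_group hg t).conj.unique ?_
  convert E.hasIntegral_group hg (-t) using 2 with l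
  rw [← Complex.exp_conj]
  simp

theorem group_neg_apply_group (hg : Measurable g) (t : ℝ) (u : H) :
    E.group g (-t) (E.group g t u) = u := by
  have := group_add (E := E) hg (-t) t
  rw [neg_add_cancel, E.group_zero hg] at this
  rw [← mul_apply_eq_comp, ← this]
  rfl

theorem norm_group_apply (hg : Measurable g) (t : ℝ) (u : H) : ‖E.group g t u‖ = ‖u‖ := by
  have h : inner ℂ (E.group g t u) (E.group g t u) = inner ℂ u u := by
    rw [← ContinuousLinearMap.adjoint_inner_right, adjoint_group hg, group_neg_apply_group hg]
  rw [inner_self_eq_norm_sq_to_K, inner_self_eq_norm_sq_to_K] at h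
  have h2 : ‖E.group g t u‖ ^ 2 = ‖u‖ ^ 2 := by exact_mod_cast h
  exact (pow_left_inj₀ (norm_nonneg _) (norm_nonneg _) two_ne_zero).1 h2

/-- For |s|C ≤ 1 the remainder e^{isx} - 1 - isx with |x| ≤ C is at most (|s|C)², uniformly in the
spectral variable, so the operator remainder is O(s²). -/
theorem hasDerivAt_group (hg : Measurable g) (hC : ∀ l, |g l| ≤ C) (u : H) (t : ℝ) :
    HasDerivAt (fun t => E.group g t u)
      (Complex.I • (E.integral (fun l => (g l : ℂ)) (E.group g t u))) t := by
  have hC0 : 0 ≤ C := (abs_nonneg _).trans (hC 0)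
  have hm : Measurable fun l => (g l : ℂ) := by fun_prop
  have hb : ∀ l, ‖(g l : ℂ)‖ ≤ C := fun l => by simpa using hC l
  rw [hasDerivAt_iff_isLittleO_nhds_zero]
  have hO : (fun s : ℝ => E.group g (t + s) u - E.group g t u -
      s • (Complex.I • (E.integral (fun l => (g l : ℂ)) (E.group g t u))))
      =O[nhds 0] fun s : ℝ => s ^ 2 := by
    refine Asymptotics.IsBigO.of_bound (2 * C ^ 2 * ‖u‖) ?_
    have hev : ∀ᶠ s : ℝ in nhds 0, |s| < 1 / (C + 1) := by
      have := Metric.ball_mem_nhds (0 : ℝ) (ε := 1 / (C + 1)) (by positivity)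
      filter_upwards [this] with s hs
      simpa using hs
    filter_upwards [hev] with s hs
    have hsC : |s| * C ≤ 1 := by
      have h1 : |s| * (C + 1) < 1 := by rwa [lt_div_iff₀ (by positivity)] at hs
      nlinarith [abs_nonneg s]
    have hI := (((E.hasIntegral_group hg (t + s)).sub (E.hasIntegral_group hg t)).sub
      ((((E.hasIntegral_integral hm hb).mul (E.hasIntegral_group hg t)
        (measurable_exp_I_mul hg t) (fun _ => (norm_exp_I_mul _ _).le) hm hb).const_mul
          Complex.I).const_mul (s : ℂ))).norm_le (C := (|s| * C) ^ 2) (by positivity) (fun l => by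
      have e : Complex.exp (Complex.I * ((t + s : ℝ) : ℂ) * g l) -
          Complex.exp (Complex.I * t * g l) -
          s * (Complex.I * (g l * Complex.exp (Complex.I * t * g l))) =
          Complex.exp (Complex.I * t * g l) * (Complex.exp (Complex.I * s * g l) - 1 -
            Complex.I * s * g l) := by
        have : Complex.I * ((t + s : ℝ) : ℂ) * g l
          = Complex.I * t * g l + Complex.I * s * g l := by push_cast; ring
        rw [this, Complex.exp_add]
        ring
      rw [e, norm_mul, norm_exp_I_mul, one_mul]
      have hn : ‖Complex.I * s * g l‖ = |s| * |g l| := by simp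
      have hle : |s| * |g l| ≤ |s| * C := mul_le_mul_of_nonneg_left (hC l) (abs_nonneg s)
      refine (Complex.norm_exp_sub_one_sub_id_le (by rw [hn]; exact hle.trans hsC)).trans ?_
      rw [hn]
      gcongr)
    have hu := (ContinuousLinearMap.le_opNorm _ u).trans
      (mul_le_mul_of_nonneg_right hI (norm_nonneg u))
    simp only [_root_.sub_apply, smul_apply, mul_apply_eq_comp] at hu
    rw [Complex.coe_smul] at hu
    refine hu.trans (le_of_eq ?_)
    rw [norm_pow, Real.norm_eq_abs]
    ring
  exact hO.trans_isLittleO (Asymptotics.isLittleO_pow_id one_lt_two)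

/-- A bounded generator makes the group Lipschitz in operator norm, so that it can be integrated as
an operator-valued function. -/
theorem continuous_group (hg : Measurable g) (hC : ∀ l, |g l| ≤ C) : Continuous (E.group g) := by
  have hC0 : 0 ≤ C := (abs_nonneg _).trans (hC 0)
  refine (LipschitzWith.of_dist_le_mul (K := (2 * C).toNNReal) fun s t => ?_).continuous
  rw [Real.coe_toNNReal _ (by positivity), dist_eq_norm, dist_eq_norm, Real.norm_eq_abs, mul_assoc]
  refine ((E.hasIntegral_group hg s).sub (E.hasIntegral_group hg t)).norm_le (by positivity)
    fun l => ?_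
  have e : Complex.exp (Complex.I * s * g l) - Complex.exp (Complex.I * t * g l) =
      Complex.exp (Complex.I * t * g l) * (Complex.exp (Complex.I * ((s - t) * g l : ℝ)) - 1) := by
    rw [mul_sub, mul_one, ← Complex.exp_add]
    congr 2
    push_cast
    ring
  rw [e, norm_mul, norm_exp_I_mul, one_mul]
  refine (Real.norm_exp_I_mul_ofReal_sub_one_le).trans ?_
  rw [Real.norm_eq_abs, abs_mul, mul_comm]
  exact mul_le_mul_of_nonneg_right (hC l) (abs_nonneg _)

theorem isSelfAdjoint_integral (hg : Measurable g) (hC : ∀ l, |g l| ≤ C) :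
    IsSelfAdjoint (E.integral fun l => (g l : ℂ)) := by
  have h := E.hasIntegral_integral (F := fun l => (g l : ℂ)) (by fun_prop)
    (fun l => by simpa using hC l)
  rw [ContinuousLinearMap.isSelfAdjoint_iff']
  exact h.conj.unique (by simpa using h)

/-- Duhamel's formula for the commutator of a bounded operator with a unitary group. -/
theorem norm_commutator_group_le (hg : Measurable g) (hC : ∀ l, |g l| ≤ C) (N : H →L[ℂ] H)
    (u : H) (t : ℝ) {D : ℝ}
    (hD : ∀ s, |s| ≤ |t| → ‖N (E.integral (fun l => (g l : ℂ)) (E.group g s u)) -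
      E.integral (fun l => (g l : ℂ)) (N (E.group g s u))‖ ≤ D) :
    ‖N (E.group g t u) - E.group g t (N u)‖ ≤ D * |t| := by
  set B := E.integral fun l => (g l : ℂ) with hB
  have hsym := ContinuousLinearMap.isSelfAdjoint_iff_isSymmetric.1
    (isSelfAdjoint_integral (E := E) hg hC)
  set w := N (E.group g t u) - E.group g t (N u) with hw
  -- Testing against w itself, moved back to time 0: s ↦ ⟨U_s v, N U_s u⟩ runs from ⟨w, U_t N u⟩ to
  -- ⟨w, N U_t u⟩, so its increment is ‖w‖². The mean value inequality then replaces the Duhamel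
  -- integral.
  set v := E.group g (-t) w with hv
  have hvw : E.group g t v = w := by
    have := group_neg_apply_group (E := E) hg (-t) w
    rwa [neg_neg] at this
  have hderiv : ∀ s : ℝ, HasDerivAt (fun s => inner ℂ (E.group g s v) (N (E.group g s u)))
      (Complex.I * inner ℂ (E.group g s v) (N (B (E.group g s u)) - B (N (E.group g s u)))) s := by
    intro s
    have h1 : HasDerivAt (fun s => N (E.group g s u)) (N (Complex.I • B (E.group g s u))) s :=
      (N.restrictScalars ℝ).hasFDerivAt.comp_hasDerivAt s (hasDerivAt_group (E := E) hg hC u s)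
    refine ((hasDerivAt_group (E := E) hg hC v s).inner ℂ h1).congr_deriv ?_
    have h2 := hsym (E.group g s v) (N (E.group g s u))
    simp only [ContinuousLinearMap.coe_coe] at h2
    rw [inner_smul_left, h2, map_smul, inner_smul_right, inner_sub_right, Complex.conj_I]
    ring
  have hmv := (convex_uIcc (0 : ℝ) t).norm_image_sub_le_of_norm_hasDerivWithin_le (C := ‖w‖ * D)
    (fun s _ => (hderiv s).hasDerivWithinAt) (fun s hs => by
      rw [norm_mul, Complex.norm_I, one_mul]
      refine (norm_inner_le_norm _ _).trans ?_
      rw [norm_group_apply hg, hv, norm_group_apply hg]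
      refine mul_le_mul_of_nonneg_left (hD s ?_) (norm_nonneg _)
      have := abs_sub_left_of_mem_uIcc hs
      simpa using this) left_mem_uIcc right_mem_uIcc
  have e0 : inner ℂ v (N u) = inner ℂ w (E.group g t (N u)) := by
    rw [hv, ← adjoint_group hg, ContinuousLinearMap.adjoint_inner_left]
  simp only [E.group_zero hg, sub_zero, one_apply_eq_self, Real.norm_eq_abs] at hmv
  rw [hvw, e0, ← inner_sub_right, ← hw, inner_self_eq_norm_sq_to_K, norm_pow] at hmv
  simp only [Complex.coe_algebraMap, Complex.norm_real, norm_norm] at hmv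
  rcases eq_or_lt_of_le (norm_nonneg w) with h0 | h0
  · rw [← h0]
    exact mul_nonneg ((norm_nonneg _).trans (hD 0 (by simp))) (abs_nonneg _)
  · refine le_of_mul_le_mul_left ?_ h0
    linarith

/-- Weighted estimate for a unitary group whose generator has controlled commutators with the
powers of the weight `M ≥ R`. -/
theorem norm_pow_group_le (hg : Measurable g) (hC : ∀ l, |g l| ≤ C) {M : H →L[ℂ] H} {κ : ℕ}
    {D R : ℝ} (hD0 : 0 ≤ D) (hR : 0 < R)
    (hD : ∀ k, k + 1 ≤ κ → ∀ u : H, ‖(M ^ (k + 1)) (E.integral (fun l => (g l : ℂ)) u) -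
      E.integral (fun l => (g l : ℂ)) ((M ^ (k + 1)) u)‖ ≤ D * ‖(M ^ k) u‖)
    (hM : ∀ (k : ℕ) (u : H), R * ‖(M ^ k) u‖ ≤ ‖(M ^ (k + 1)) u‖) (t : ℝ) :
    ∀ k, k ≤ κ → ∀ u : H, ‖(M ^ k) (E.group g t u)‖ ≤ (1 + D * |t| / R) ^ k * ‖(M ^ k) u‖ := by
  intro k
  induction k generalizing t with
  | zero =>
    intro _ u
    simp [norm_group_apply hg]
  | succ k ih =>
    intro hk u
    set x := D * |t| / R with hx
    have hx0 : 0 ≤ x := by positivity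
    have h1 := norm_commutator_group_le (E := E) hg hC (M ^ (k + 1)) u t
      (D := D * ((1 + x) ^ k * ‖(M ^ k) u‖)) (fun s hs => by
        refine (hD k hk _).trans ?_
        refine mul_le_mul_of_nonneg_left ((ih s (by omega) u).trans ?_) hD0
        have : D * |s| / R ≤ x := by rw [hx]; gcongr
        gcongr)
    have h2 : ‖(M ^ (k + 1)) (E.group g t u)‖ ≤
        ‖E.group g t ((M ^ (k + 1)) u)‖ + D * ((1 + x) ^ k * ‖(M ^ k) u‖) * |t| := by
      have := norm_add_le (E.group g t ((M ^ (k + 1)) u))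
        ((M ^ (k + 1)) (E.group g t u) - E.group g t ((M ^ (k + 1)) u))
      rw [add_sub_cancel] at this
      linarith
    rw [norm_group_apply hg] at h2
    refine h2.trans ?_
    -- The factor |t| from Duhamel's formula is paid for by the lower bound R of the weight, which
    -- turns the lost power M^k back into M^{k+1}.
    have h3 : D * ((1 + x) ^ k * ‖(M ^ k) u‖) * |t| = x * (1 + x) ^ k * (R * ‖(M ^ k) u‖) := by
      rw [hx]; field_simp
    have h4 : x * (1 + x) ^ k * (R * ‖(M ^ k) u‖) ≤
        x * (1 + x) ^ k * ‖(M ^ (k + 1)) u‖ := by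
      gcongr
      exact hM k u
    have h5 : (1 : ℝ) ≤ (1 + x) ^ k := one_le_pow₀ (by linarith)
    rw [h3]
    have h6 : (1 + x) ^ (k + 1) = (1 + x) ^ k + x * (1 + x) ^ k := by ring
    rw [h6]
    nlinarith [norm_nonneg ((M ^ (k + 1)) u)]

/-- Fourier representation of functions of a bounded self-adjoint operator. -/
theorem integral_comp_apply (hg : Measurable g) (hC : ∀ l, |g l| ≤ C) {F Fh : ℝ → ℂ}
    (hFh : Integrable Fh)
    (hF : ∀ l, F (g l) = ∫ ξ, Fh ξ * Complex.exp (Complex.I * (2 * Real.pi * ξ : ℝ) * g l))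
    (u : H) :
    Integrable (fun ξ => Fh ξ • E.group g (2 * Real.pi * ξ) u) ∧
    E.integral (fun l => F (g l)) u = ∫ ξ, Fh ξ • E.group g (2 * Real.pi * ξ) u := by
  have hcont : Continuous fun ξ : ℝ => E.group g (2 * Real.pi * ξ) :=
    (continuous_group hg hC).comp (by fun_prop)
  have hintT : Integrable fun ξ => Fh ξ • E.group g (2 * Real.pi * ξ) := by
    refine (hFh.norm.mul_const 2).mono'
      (hFh.1.smul hcont.aestronglyMeasurable) (Filter.Eventually.of_forall fun ξ => ?_)
    rw [norm_smul]
    refine mul_le_mul_of_nonneg_left ?_ (norm_nonneg _)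
    simpa using (E.hasIntegral_group hg (2 * Real.pi * ξ)).norm_le zero_le_one
      fun l => (norm_exp_I_mul _ _).le
  have hintu : ∀ u, Integrable fun ξ => Fh ξ • E.group g (2 * Real.pi * ξ) u := fun u =>
    (ContinuousLinearMap.apply ℂ H u).integrable_comp hintT
  refine ⟨hintu u, ?_⟩
  -- Both operators have the same quadratic form, by Fubini for `E.diag f` times Lebesgue measure.
  have key : E.HasIntegral (fun l => F (g l)) (∫ ξ, Fh ξ • E.group g (2 * Real.pi * ξ)) := by
    intro f
    have hprod : Integrable (fun q : ℝ × ℝ => Fh q.2 *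
        Complex.exp (Complex.I * (2 * Real.pi * q.2 : ℝ) * g q.1))
        ((E.diag f).prod volume) := by
      have h1 : Integrable (fun q : ℝ × ℝ => (1 : ℂ) * Fh q.2) ((E.diag f).prod volume) :=
        (integrable_const (1 : ℂ)).mul_prod hFh
      simp only [one_mul] at h1
      refine h1.mul_bdd (c := 1) ?_ (Filter.Eventually.of_forall fun q => (norm_exp_I_mul _ _).le)
      have : Measurable fun q : ℝ × ℝ =>
        Complex.exp (Complex.I * (2 * Real.pi * q.2 : ℝ) * g q.1) := by fun_prop
      exact this.aestronglyMeasurable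
    simp_rw [hF]
    refine ⟨hprod.integral_prod_left, ?_⟩
    rw [integral_integral_swap hprod, ContinuousLinearMap.integral_apply hintT]
    simp only [smul_apply]
    rw [← integral_inner (hintu f)]
    refine MeasureTheory.integral_congr_ae (Filter.Eventually.of_forall fun ξ => ?_)
    beta_reduce
    rw [inner_smul_right, ((E.hasIntegral_group hg _) f).2, integral_const_mul]
  rw [key.integral_eq, ContinuousLinearMap.integral_apply hintT]
  rfl

/-! ### Functions of an operator with controlled commutators. -/

section Weighted

variable {M : H →L[ℂ] H} {κ : ℕ} {D : ℝ} {F Fh : ℝ → ℂ}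

theorem norm_integral_comp_le (hg : Measurable g) (hC : ∀ l, |g l| ≤ C)
    (hFh : Integrable Fh)
    (hF : ∀ l, F (g l) = ∫ ξ, Fh ξ * Complex.exp (Complex.I * (2 * Real.pi * ξ : ℝ) * g l))
    (hFi : Integrable fun ξ => ‖Fh ξ‖ * (1 + D * (2 * Real.pi * |ξ|)) ^ κ)
    (N : H →L[ℂ] H) (u : H) {b : ℝ}
    (hN : ∀ t, ‖N (E.group g t u)‖ ≤ (1 + D * |t|) ^ κ * b) :
    ‖N (E.integral (fun l => F (g l)) u)‖ ≤
      (∫ ξ, ‖Fh ξ‖ * (1 + D * (2 * Real.pi * |ξ|)) ^ κ) * b := by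
  obtain ⟨hi, he⟩ := integral_comp_apply (E := E) hg hC hFh hF u
  rw [he, ← N.integral_comp_comm hi, ← MeasureTheory.integral_mul_const]
  refine norm_integral_le_of_norm_le (hFi.mul_const b)
    (Filter.Eventually.of_forall fun ξ => ?_)
  rw [map_smul, norm_smul, mul_assoc ‖Fh ξ‖]
  refine mul_le_mul_of_nonneg_left ((hN _).trans (le_of_eq ?_)) (norm_nonneg (Fh ξ))
  rw [abs_mul, abs_of_pos (by positivity : 0 < 2 * Real.pi)]

/-- Smooth functions of an operator with controlled commutators preserve weighted spaces. -/
theorem norm_pow_integral_comp_le (hg : Measurable g) (hC : ∀ l, |g l| ≤ C) (hD0 : 0 ≤ D)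
    (hD : ∀ k, k + 1 ≤ κ → ∀ u : H, ‖(M ^ (k + 1)) (E.integral (fun l => (g l : ℂ)) u) -
      E.integral (fun l => (g l : ℂ)) ((M ^ (k + 1)) u)‖ ≤ D * ‖(M ^ k) u‖)
    (hM : ∀ (k : ℕ) (u : H), ‖(M ^ k) u‖ ≤ ‖(M ^ (k + 1)) u‖)
    (hFh : Integrable Fh)
    (hF : ∀ l, F (g l) = ∫ ξ, Fh ξ * Complex.exp (Complex.I * (2 * Real.pi * ξ : ℝ) * g l))
    (hFi : Integrable fun ξ => ‖Fh ξ‖ * (1 + D * (2 * Real.pi * |ξ|)) ^ κ) (u : H) :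
    ‖(M ^ κ) (E.integral (fun l => F (g l)) u)‖ ≤
      (∫ ξ, ‖Fh ξ‖ * (1 + D * (2 * Real.pi * |ξ|)) ^ κ) * ‖(M ^ κ) u‖ := by
  refine norm_integral_comp_le hg hC hFh hF hFi (M ^ κ) u fun t => ?_
  have := norm_pow_group_le hg hC hD0 one_pos hD (by simpa using hM) t κ le_rfl u
  simpa using this

/-- Smooth functions of an operator with controlled commutators have controlled commutators. -/
theorem norm_commutator_integral_comp_le (hg : Measurable g) (hC : ∀ l, |g l| ≤ C) (hD0 : 0 ≤ D)
    (hD : ∀ k, k + 1 ≤ κ → ∀ u : H, ‖(M ^ (k + 1)) (E.integral (fun l => (g l : ℂ)) u) -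
      E.integral (fun l => (g l : ℂ)) ((M ^ (k + 1)) u)‖ ≤ D * ‖(M ^ k) u‖)
    (hM : ∀ (k : ℕ) (u : H), ‖(M ^ k) u‖ ≤ ‖(M ^ (k + 1)) u‖)
    (hFh : Integrable Fh)
    (hF : ∀ l, F (g l) = ∫ ξ, Fh ξ * Complex.exp (Complex.I * (2 * Real.pi * ξ : ℝ) * g l))
    (hFi : Integrable fun ξ => ‖Fh ξ‖ * (1 + D * (2 * Real.pi * |ξ|)) ^ κ)
    (k : ℕ) (hk : k + 1 ≤ κ) (u : H) :
    ‖(M ^ (k + 1)) (E.integral (fun l => F (g l)) u) -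
        E.integral (fun l => F (g l)) ((M ^ (k + 1)) u)‖ ≤
      (∫ ξ, ‖Fh ξ‖ * (1 + D * (2 * Real.pi * |ξ|)) ^ κ) * ‖(M ^ k) u‖ := by
  obtain ⟨hi, he⟩ := integral_comp_apply (E := E) hg hC hFh hF u
  obtain ⟨hi', he'⟩ := integral_comp_apply (E := E) hg hC hFh hF ((M ^ (k + 1)) u)
  rw [he, he', ← (M ^ (k + 1)).integral_comp_comm hi,
    ← integral_sub ((M ^ (k + 1)).integrable_comp hi) hi', ← MeasureTheory.integral_mul_const]
  refine MeasureTheory.norm_integral_le_of_norm_le (hFi.mul_const _) (Filter.Eventually.of_forall fun ξ => ?_)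
  rw [map_smul, ← smul_sub, norm_smul, mul_assoc ‖Fh ξ‖]
  refine mul_le_mul_of_nonneg_left ?_ (norm_nonneg (Fh ξ))
  have hR1 : ∀ (k : ℕ) (u : H), 1 * ‖(M ^ k) u‖ ≤ ‖(M ^ (k + 1)) u‖ := by simpa using hM
  have habs : |2 * Real.pi * ξ| = 2 * Real.pi * |ξ| := by
    rw [abs_mul, abs_of_pos (by positivity : 0 < 2 * Real.pi)]
  set x := D * (2 * Real.pi * |ξ|) with hx
  have hx0 : 0 ≤ x := by positivity
  have h1 := norm_commutator_group_le (E := E) hg hC (M ^ (k + 1)) u (2 * Real.pi * ξ)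
      (D := D * ((1 + x) ^ k * ‖(M ^ k) u‖)) (fun s hs => by
        refine (hD k hk _).trans ?_
        refine mul_le_mul_of_nonneg_left
          ((norm_pow_group_le hg hC hD0 one_pos hD hR1 s k (by omega) u).trans ?_) hD0
        have : D * |s| / 1 ≤ x := by rw [hx, div_one, ← habs]; gcongr
        gcongr)
  refine h1.trans ?_
  rw [habs]
  have h2 : D * ((1 + x) ^ k * ‖(M ^ k) u‖) * (2 * Real.pi * |ξ|) =
      x * (1 + x) ^ k * ‖(M ^ k) u‖ := by rw [hx]; ring
  rw [h2]
  refine mul_le_mul_of_nonneg_right ?_ (norm_nonneg _)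
  -- The exponent is raised to κ so that one constant serves all k + 1 ≤ κ, the form in which
  -- Duhamel's formula can be applied again.
  calc x * (1 + x) ^ k ≤ (1 + x) * (1 + x) ^ k := by gcongr; linarith
    _ = (1 + x) ^ (k + 1) := by ring
    _ ≤ (1 + x) ^ κ := pow_le_pow_right₀ (by linarith) hk

end Weighted

end ProjectionMeasure

/-! ### Partitions of doubling spaces into small cells -/

/-- A countable measurable partition of `X` into subsets of the balls of radius `r` about the
points of an `r / 2`-separated set. -/
structure BallPartition (X : Type*) [MetricSpace X] [MeasurableSpace X] (r : ℝ) where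
  centers : Set X
  countable : centers.Countable
  cell : centers → Set X
  measurableSet_cell : ∀ i, MeasurableSet (cell i)
  disjoint : Pairwise (Function.onFun Disjoint cell)
  iUnion_cell : ⋃ i, cell i = univ
  cell_subset : ∀ i, cell i ⊆ ball i r
  separated : ∀ i j : centers, i ≠ j → r / 2 < dist (i : X) j

theorem BallPartition.nonempty (X : Type*) [MetricSpace X] [TopologicalSpace.SeparableSpace X]
    [MeasurableSpace X] [BorelSpace X] {r : ℝ} (hr : 0 < r) : Nonempty (BallPartition X r) := by
  -- A maximal separated set is a net: a point at distance at least r from all of it could be added.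
  obtain ⟨s, hs⟩ : ∃ s, Maximal (fun s : Set X => s.Pairwise fun x y => r / 2 < dist x y) s := by
    refine zorn_subset {s : Set X | s.Pairwise fun x y => r / 2 < dist x y} fun t ht hc => ?_
    exact ⟨⋃₀ t, (pairwise_sUnion hc.directedOn).2 ht, fun u hu => subset_sUnion_of_mem hu⟩
  have hcov : ∀ x : X, ∃ i : s, x ∈ ball (i : X) r := by
    intro x
    by_contra! h
    have hx : ∀ y ∈ s, r ≤ dist x y := fun y hy => by simpa using h ⟨y, hy⟩
    have hins : (insert x s).Pairwise fun x y => r / 2 < dist x y := by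
      refine hs.prop.insert fun y hy _ => ?_
      have := hx y hy
      exact ⟨by linarith, by rw [dist_comm]; linarith⟩
    have hxs : x ∈ s := hs.le_of_ge hins (subset_insert x s) (mem_insert x s)
    have := hx x hxs
    rw [dist_self] at this
    linarith
  have hcount : s.Countable := by
    refine Set.PairwiseDisjoint.countable_of_isOpen (s := fun x => ball x (r / 4)) ?_
      (fun _ _ => isOpen_ball) (fun x _ => ⟨x, mem_ball_self (by positivity)⟩)
    intro x hx y hy hxy
    refine ball_disjoint_ball ?_
    have := hs.prop hx hy hxy
    linarith
  have : Countable s := hcount.to_subtype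
  obtain ⟨e, he⟩ := Countable.exists_injective_nat s
  -- Each point goes to the ball of least index that contains it, which makes the cells disjoint.
  refine ⟨⟨s, hcount, fun i => ball (i : X) r \ ⋃ j : s, ⋃ _ : e j < e i, ball (j : X) r, fun i => ?_,
    fun i j hij => ?_, ?_, fun i => sdiff_subset, fun i j hij => ?_⟩⟩
  · exact measurableSet_ball.diff
      (MeasurableSet.iUnion fun j => MeasurableSet.iUnion fun _ => measurableSet_ball)
  · rw [Function.onFun, Set.disjoint_left]
    rintro x ⟨hx1, hx2⟩ ⟨hx3, hx4⟩
    simp only [mem_iUnion, not_exists] at hx2 hx4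
    rcases lt_trichotomy (e i) (e j) with h | h | h
    · exact hx4 i h hx1
    · exact hij (he h)
    · exact hx2 j h hx3
  · refine eq_univ_of_forall fun x => ?_
    let t : Set ℕ := {k | ∃ i : s, e i = k ∧ x ∈ ball (i : X) r}
    have ht : t.Nonempty := by
      obtain ⟨i, hi⟩ := hcov x
      exact ⟨e i, i, rfl, hi⟩
    obtain ⟨i, hi, hxi⟩ := Nat.sInf_mem ht
    refine mem_iUnion.2 ⟨i, hxi, ?_⟩
    simp only [mem_iUnion, not_exists]
    intro j hj hxj
    have : sInf t ≤ e j := Nat.sInf_le ⟨j, rfl, hxj⟩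
    omega
  · exact hs.prop i.2 j.2 fun h => hij (Subtype.ext h)

instance {X : Type*} [MetricSpace X] [MeasurableSpace X] {r : ℝ} (P : BallPartition X r) :
    Countable P.centers := P.countable.to_subtype

/-! ### Sums and integrals of polynomial decay under doubling. -/

section Decay

variable {X : Type*} [MetricSpace X] [MeasurableSpace X] [BorelSpace X] {μ : Measure X} {n : ℝ}
  {c : ℝ≥0}

/-- A dyadic majorant that reduces sums and integrals of decay to counts and volumes of balls. Only
the term j = k + 1 with 2^k ≤ 1 + d < 2^{k+1} is used, and 2^m pays for rounding up. -/
theorem rpow_neg_le_tsum_indicator {d m : ℝ} (hd : 0 ≤ d) (hm : 0 ≤ m) :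
    ENNReal.ofReal ((1 + d) ^ (-m)) ≤ ∑' j : ℕ, if d < 2 ^ j then
      ENNReal.ofReal (2 ^ m * (2 ^ j : ℝ) ^ (-m)) else 0 := by
  obtain ⟨k, hk1, hk2⟩ := exists_nat_pow_near (x := 1 + d) (y := 2) (by linarith) (by norm_num)
  refine le_trans ?_ (ENNReal.le_tsum (k + 1))
  rw [if_pos (by linarith)]
  refine ENNReal.ofReal_le_ofReal ?_
  calc (1 + d) ^ (-m) ≤ (2 ^ k : ℝ) ^ (-m) :=
        Real.rpow_le_rpow_of_nonpos (by positivity) hk1 (by linarith)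
    _ = 2 ^ m * (2 ^ (k + 1) : ℝ) ^ (-m) := by
        rw [pow_succ, Real.mul_rpow (by positivity) (by positivity),
          Real.rpow_neg (by norm_num : (0 : ℝ) ≤ 2)]
        field_simp

theorem tsum_two_pow_rpow_neg_lt_top {ε : ℝ} (hε : 0 < ε) :
    ∑' j : ℕ, ENNReal.ofReal ((2 ^ j : ℝ) ^ (-ε)) < ∞ := by
  have e : ∀ j : ℕ, ENNReal.ofReal ((2 ^ j : ℝ) ^ (-ε)) = ENNReal.ofReal (2 ^ (-ε)) ^ j := by
    intro j
    rw [← ENNReal.ofReal_pow (by positivity), ← Real.rpow_natCast, ← Real.rpow_natCast,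
      ← Real.rpow_mul (by norm_num), ← Real.rpow_mul (by norm_num), mul_comm]
  simp_rw [e, ENNReal.tsum_geometric]
  refine ENNReal.inv_lt_top.2 (tsub_pos_of_lt ?_)
  rw [ENNReal.ofReal_lt_one]
  exact Real.rpow_lt_one_of_one_lt_of_neg (by norm_num) (by linarith)

/-- Volume growth 2^{jn} against decay 2^{-j(n+ε)} leaves a geometric series of ratio 2^{-ε}. -/
theorem exists_tsum_two_pow_le (n : ℝ) (A : ℝ≥0) {ε : ℝ} (hε : 0 < ε) : ∃ C : ℝ≥0,
    ∑' j : ℕ, ENNReal.ofReal (2 ^ (n + ε) * (2 ^ j : ℝ) ^ (-(n + ε))) *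
      (A * ENNReal.ofReal ((2 ^ j : ℝ) ^ n)) ≤ C := by
  have e : ∀ j : ℕ, ENNReal.ofReal (2 ^ (n + ε) * (2 ^ j : ℝ) ^ (-(n + ε))) *
      (A * ENNReal.ofReal ((2 ^ j : ℝ) ^ n)) =
      (ENNReal.ofReal (2 ^ (n + ε)) * A) * ENNReal.ofReal ((2 ^ j : ℝ) ^ (-ε)) := by
    intro j
    have : (2 ^ j : ℝ) ^ (-ε) = (2 ^ j : ℝ) ^ (-(n + ε)) * (2 ^ j : ℝ) ^ n := by
      rw [← Real.rpow_add (by positivity)]; congr 1; ring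
    rw [this, ENNReal.ofReal_mul (by positivity), ENNReal.ofReal_mul (by positivity)]
    ring
  simp_rw [e, ENNReal.tsum_mul_left]
  refine ⟨(ENNReal.ofReal (2 ^ (n + ε)) * A *
    ∑' j : ℕ, ENNReal.ofReal ((2 ^ j : ℝ) ^ (-ε))).toNNReal, ?_⟩
  rw [ENNReal.coe_toNNReal]
  exact ENNReal.mul_ne_top (ENNReal.mul_ne_top ENNReal.ofReal_ne_top ENNReal.coe_ne_top)
    (tsum_two_pow_rpow_neg_lt_top hε).ne

/-- Bounds the number of centers in a ball. -/
theorem BallPartition.tsum_dist_lt_le (hμ : IsHomogeneousType μ n)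
    (hc : ∀ (x : X) (r l : ℝ), 0 < r → 1 ≤ l →
      μ (ball x (l * r)) ≤ c * ENNReal.ofReal (l ^ n) * μ (ball x r))
    {r : ℝ} (hr : 0 < r) (P : BallPartition X r) (z : X) {t : ℝ} (ht : 1 ≤ t) (b : ℝ≥0∞) :
    (∑' i : P.centers, if dist z i / r < t then b else 0)
      ≤ b * (c * ENNReal.ofReal ((16 * t) ^ n)) := by
  rw [ENNReal.tsum_eq_iSup_sum]
  refine iSup_le fun S => ?_
  rw [← Finset.sum_filter, Finset.sum_const, nsmul_eq_mul, mul_comm]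
  refine mul_le_mul_right ?_ b
  set S' := S.filter fun i : P.centers => dist z i / r < t with hS'
  have hV0 : μ (ball z (2 * t * r)) ≠ 0 := (hμ.volume_pos z _ (by positivity)).ne'
  have hV1 : μ (ball z (2 * t * r)) ≠ ∞ := (hμ.volume_lt_top z _ (by positivity)).ne
  refine (ENNReal.mul_le_mul_iff_left hV0 hV1).1 ?_
  have hdist : ∀ i ∈ S', dist z (i : X) < t * r := fun i hi => by
    have := (Finset.mem_filter.1 hi).2
    rwa [div_lt_iff₀ hr] at this
  -- Packing: the balls of radius r/4 about the centers are disjoint and lie in B(z, 2tr), while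
  -- each of them, enlarged 16t times to radius 4tr, covers B(z, 2tr). Comparing volumes bounds
  -- their number by c(16t)^n.
  have hball : ∀ i ∈ S', μ (ball z (2 * t * r)) ≤
      c * ENNReal.ofReal ((16 * t) ^ n) * μ (ball (i : X) (r / 4)) := by
    intro i hi
    refine le_trans (measure_mono (ball_subset_ball' (y := (i : X)) (ε₂ := 16 * t * (r / 4)) ?_))
      (hc i (r / 4) (16 * t) (by positivity) (by linarith))
    have := hdist i hi
    nlinarith
  have hdisj : (S' : Set P.centers).PairwiseDisjoint fun i => ball (i : X) (r / 4) := by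
    intro i _ j _ hij
    refine ball_disjoint_ball ?_
    have := P.separated i j hij
    linarith
  calc (S'.card : ℝ≥0∞) * μ (ball z (2 * t * r))
      = ∑ i ∈ S', μ (ball z (2 * t * r)) := by rw [Finset.sum_const, nsmul_eq_mul]
    _ ≤ ∑ i ∈ S', c * ENNReal.ofReal ((16 * t) ^ n) * μ (ball (i : X) (r / 4)) :=
        Finset.sum_le_sum hball
    _ = c * ENNReal.ofReal ((16 * t) ^ n) * μ (⋃ i ∈ S', ball (i : X) (r / 4)) := by
        rw [← Finset.mul_sum, measure_biUnion_finset hdisj fun _ _ => measurableSet_ball]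
    _ ≤ _ := by
        gcongr
        refine iUnion₂_subset fun i hi => ball_subset_ball' ?_
        have := hdist i hi
        rw [dist_comm] at this
        nlinarith

/-- Uniform summability of polynomial decay over the centers of a partition. -/
theorem exists_tsum_centers_le (hμ : IsHomogeneousType μ n) (hn : 0 < n) {ε : ℝ} (hε : 0 < ε) :
    ∃ C : ℝ≥0, ∀ (r : ℝ), 0 < r → ∀ (P : BallPartition X r) (z : X),
      ∑' i : P.centers, ENNReal.ofReal ((1 + dist z i / r) ^ (-(n + ε))) ≤ C := by
  obtain ⟨c, hc⟩ := hμ.doubling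
  obtain ⟨C, hC⟩ := exists_tsum_two_pow_le n (c * (16 ^ n : ℝ).toNNReal) hε
  refine ⟨C, fun r hr P z => le_trans ?_ hC⟩
  calc ∑' i : P.centers, ENNReal.ofReal ((1 + dist z i / r) ^ (-(n + ε)))
      ≤ ∑' i : P.centers, ∑' j : ℕ, (if dist z i / r < 2 ^ j then
          ENNReal.ofReal (2 ^ (n + ε) * (2 ^ j : ℝ) ^ (-(n + ε))) else 0) :=
        ENNReal.tsum_le_tsum fun i => rpow_neg_le_tsum_indicator (by positivity) (by positivity)
    _ = ∑' j : ℕ, ∑' i : P.centers, (if dist z i / r < 2 ^ j then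
          ENNReal.ofReal (2 ^ (n + ε) * (2 ^ j : ℝ) ^ (-(n + ε))) else 0) := ENNReal.tsum_comm
    _ ≤ _ := by
        refine ENNReal.tsum_le_tsum fun j =>
          (P.tsum_dist_lt_le hμ hc hr z (one_le_pow₀ (by norm_num)) _).trans (le_of_eq ?_)
        have e : ENNReal.ofReal ((16 * 2 ^ j : ℝ) ^ n) =
            ((16 ^ n : ℝ).toNNReal : ℝ≥0∞) * ENNReal.ofReal ((2 ^ j : ℝ) ^ n) := by
          rw [Real.mul_rpow (by norm_num) (by positivity), ENNReal.ofReal_mul (by positivity)]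
          rfl
        rw [e, ENNReal.coe_mul, mul_assoc (c : ℝ≥0∞)]

/-- Integrability of polynomial decay. -/
theorem exists_lintegral_decay_le (hμ : IsHomogeneousType μ n) (hn : 0 < n) {ε : ℝ}
    (hε : 0 < ε) : ∃ C : ℝ≥0, ∀ (r : ℝ), 0 < r → ∀ w : X,
      ∫⁻ z, ENNReal.ofReal ((1 + dist z w / r) ^ (-(n + ε))) ∂μ ≤ C * μ (ball w r) := by
  obtain ⟨c, hc⟩ := hμ.doubling
  obtain ⟨C, hC⟩ := exists_tsum_two_pow_le n c hε
  refine ⟨C, fun r hr w => ?_⟩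
  calc ∫⁻ z, ENNReal.ofReal ((1 + dist z w / r) ^ (-(n + ε))) ∂μ
      ≤ ∫⁻ z, ∑' j : ℕ, (if dist z w / r < 2 ^ j then
          ENNReal.ofReal (2 ^ (n + ε) * (2 ^ j : ℝ) ^ (-(n + ε))) else 0) ∂μ :=
        lintegral_mono fun i => rpow_neg_le_tsum_indicator (by positivity) (by positivity)
    _ = ∑' j : ℕ, ∫⁻ z, (ball w (2 ^ j * r)).indicator (fun _ =>
          ENNReal.ofReal (2 ^ (n + ε) * (2 ^ j : ℝ) ^ (-(n + ε)))) z ∂μ := by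
        rw [← lintegral_tsum fun j => (measurable_const.indicator measurableSet_ball).aemeasurable]
        refine lintegral_congr fun z => tsum_congr fun j => ?_
        by_cases h : dist z w < 2 ^ j * r
        · rw [if_pos ((div_lt_iff₀ hr).2 h), indicator_of_mem (mem_ball.2 h)]
        · rw [if_neg (by rwa [div_lt_iff₀ hr]), indicator_of_notMem (by simpa using h)]
    _ = ∑' j : ℕ, ENNReal.ofReal (2 ^ (n + ε) * (2 ^ j : ℝ) ^ (-(n + ε))) *
          μ (ball w (2 ^ j * r)) := by
        refine tsum_congr fun j => ?_
        rw [lintegral_indicator measurableSet_ball, setLIntegral_const]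
    _ ≤ ∑' j : ℕ, ENNReal.ofReal (2 ^ (n + ε) * (2 ^ j : ℝ) ^ (-(n + ε))) *
          (c * ENNReal.ofReal ((2 ^ j : ℝ) ^ n)) * μ (ball w r) := by
        refine ENNReal.tsum_le_tsum fun j => ?_
        rw [mul_assoc]
        exact mul_le_mul_right (hc w r _ hr (one_le_pow₀ (by norm_num))) _
    _ ≤ C * μ (ball w r) := by
        rw [ENNReal.tsum_mul_right]
        exact mul_le_mul_left hC _

end Decay

/-! ### A weighted Schur test -/

theorem ENNReal.tsum_mul_le_weight_mul_Lp {ι : Type*} {p : ℝ} (hp : 1 ≤ p) (w f : ι → ℝ≥0∞) :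
    ∑' i, w i * f i ≤ (∑' i, w i) ^ (1 - p⁻¹) * (∑' i, w i * f i ^ p) ^ p⁻¹ := by
  have hp0 : 0 < p := by linarith
  have hp1 : 0 ≤ 1 - p⁻¹ := sub_nonneg.2 (inv_le_one_of_one_le₀ hp)
  rw [ENNReal.tsum_eq_iSup_sum]
  refine iSup_le fun S => (ENNReal.inner_le_weight_mul_Lp_of_nonneg S hp w f).trans ?_
  exact mul_le_mul' (ENNReal.rpow_le_rpow (ENNReal.sum_le_tsum S) hp1)
    (ENNReal.rpow_le_rpow (ENNReal.sum_le_tsum S) (inv_nonneg.2 hp0.le))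

/-- Write σ = 1/p - 1/2 and e_i = ∑ k_il b_l^p. Hölder with the row sums gives v_i ≤ W_i^σ C^{1-1/p}
e_i^{1/p}. After squaring, e_i^{2/p} = e_i^{2σ} · e_i: the first factor absorbs W_i^{2σ} through W_i
k_il ≤ D, the second is summed over i by the column sums. Asking for `hD` only where b_l ≠ 0 lets D
reflect the localisation of a function. -/
theorem ENNReal.tsum_sq_le_of_kernel {ι : Type*} {p : ℝ} (hp1 : 1 ≤ p) (hp2 : p ≤ 2)
    {k : ι → ι → ℝ≥0∞} {W b v : ι → ℝ≥0∞} {C D : ℝ≥0∞} (hrow : ∀ i, ∑' l, k i l ≤ C)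
    (hcol : ∀ l, ∑' i, k i l ≤ C) (hD : ∀ i l, b l ≠ 0 → W i * k i l ≤ D)
    (hv : ∀ i, v i ≤ W i ^ (1 / p - 1 / 2) * ∑' l, k i l * b l) :
    ∑' i, v i ^ 2 ≤ C ^ (3 - 2 / p) * D ^ (2 * (1 / p - 1 / 2)) * (∑' l, b l ^ p) ^ (2 / p) := by
  have hp0 : 0 < p := by linarith
  have hpinv : p⁻¹ ≤ 1 := inv_le_one_of_one_le₀ hp1
  have hσ : 0 ≤ 1 / p - 1 / 2 := sub_nonneg.2 (one_div_le_one_div_of_le hp0 hp2)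
  set σ := 1 / p - 1 / 2 with hσdef
  set B := ∑' l, b l ^ p with hB
  have h2p : 2 / p = 1 + 2 * σ := by rw [hσdef]; ring
  have hexp : (0 : ℝ) ≤ 2 - 2 / p := by
    have : 2 / p = 2 * p⁻¹ := by ring
    rw [this]; linarith
  have key : ∀ i, v i ^ 2 ≤ C ^ (2 - 2 / p) * (D * B) ^ (2 * σ) * ∑' l, k i l * b l ^ p := by
    intro i
    set e := ∑' l, k i l * b l ^ p with he
    have h1 : v i ≤ W i ^ σ * (C ^ (1 - p⁻¹) * e ^ p⁻¹) := by
      refine (hv i).trans (mul_le_mul_right ((ENNReal.tsum_mul_le_weight_mul_Lp hp1 _ _).trans ?_) _)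
      gcongr
      exact hrow i
    have h2 : W i * e ≤ D * B := by
      rw [he, hB, ← ENNReal.tsum_mul_left, ← ENNReal.tsum_mul_left]
      refine ENNReal.tsum_le_tsum fun l => ?_
      by_cases hb : b l = 0
      · simp [hb, ENNReal.zero_rpow_of_pos hp0]
      · rw [← mul_assoc]
        exact mul_le_mul_left (hD i l hb) _
    calc v i ^ 2 ≤ (W i ^ σ * (C ^ (1 - p⁻¹) * e ^ p⁻¹)) ^ 2 := by gcongr
      _ = C ^ (2 - 2 / p) * (W i * e) ^ (2 * σ) * e := by
        rw [mul_pow, mul_pow, ENNReal.mul_rpow_of_nonneg _ _ (by positivity)]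
        simp only [← ENNReal.rpow_natCast, ← ENNReal.rpow_mul]
        have e1 : e ^ (p⁻¹ * ((2 : ℕ) : ℝ)) = e ^ (2 * σ) * e := by
          conv_rhs => rw [← ENNReal.rpow_one e, ← ENNReal.rpow_mul, one_mul]
          rw [← ENNReal.rpow_add_of_nonneg _ _ (by positivity) zero_le_one]
          congr 1
          rw [hσdef]; push_cast; field_simp; ring
        have e2 : (1 - p⁻¹) * ((2 : ℕ) : ℝ) = 2 - 2 / p := by push_cast; field_simp
        have e3 : σ * ((2 : ℕ) : ℝ) = 2 * σ := by push_cast; ring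
        rw [e1, e2, e3]
        ring
      _ ≤ _ := by gcongr
  calc ∑' i, v i ^ 2 ≤ ∑' i, C ^ (2 - 2 / p) * (D * B) ^ (2 * σ) * ∑' l, k i l * b l ^ p :=
        ENNReal.tsum_le_tsum key
    _ = C ^ (2 - 2 / p) * (D * B) ^ (2 * σ) * ∑' l, (∑' i, k i l) * b l ^ p := by
        rw [ENNReal.tsum_mul_left, ENNReal.tsum_comm]
        simp_rw [ENNReal.tsum_mul_right]
    _ ≤ C ^ (2 - 2 / p) * (D * B) ^ (2 * σ) * (C * B) := by
        rw [hB, ← ENNReal.tsum_mul_left (a := C)]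
        gcongr
        exact hcol _
    _ = C ^ (3 - 2 / p) * D ^ (2 * σ) * B ^ (2 / p) := by
        have e1 : C ^ (3 - 2 / p) = C ^ (2 - 2 / p) * C := by
          conv_rhs => rw [← ENNReal.rpow_one C, ← ENNReal.rpow_mul, one_mul]
          rw [← ENNReal.rpow_add_of_nonneg _ _ hexp zero_le_one]
          congr 1; ring
        have e2 : B ^ (2 / p) = B ^ (2 * σ) * B := by
          conv_rhs => rw [← ENNReal.rpow_one B, ← ENNReal.rpow_mul, one_mul]
          rw [← ENNReal.rpow_add_of_nonneg _ _ (by positivity) zero_le_one]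
          congr 1; rw [h2p]; ring
        rw [e1, e2, ENNReal.mul_rpow_of_nonneg _ _ (by positivity)]
        ring

/-! ### Multiplication operators on `L²` -/

section MulOp

variable {X : Type*} [MeasurableSpace X] {μ : Measure X}

theorem memLp_mul_of_bounded {m : X → ℝ} (hm : Measurable m) {C : ℝ} (hC : ∀ x, |m x| ≤ C)
    (f : Lp ℂ 2 μ) : MemLp (fun x => (m x : ℂ) * f x) 2 μ := by
  refine (Lp.memLp f).of_le_mul (c := C) ?_ (Filter.Eventually.of_forall fun x => ?_)
  · exact (Complex.measurable_ofReal.comp hm).aestronglyMeasurable.mul (Lp.aestronglyMeasurable f)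
  · rw [norm_mul, Complex.norm_real]
    exact mul_le_mul_of_nonneg_right (hC x) (norm_nonneg _)

/-- Multiplication by a bounded real function on `L²`. -/
def mulOp (m : X → ℝ) (hm : Measurable m) {C : ℝ} (hC : ∀ x, |m x| ≤ C) :
    Lp ℂ 2 μ →L[ℂ] Lp ℂ 2 μ :=
  LinearMap.mkContinuous
    { toFun := fun f => (memLp_mul_of_bounded hm hC f).toLp
      map_add' := fun f g => by
        rw [← MemLp.toLp_add]
        refine MemLp.toLp_congr _ _ ?_
        filter_upwards [Lp.coeFn_add f g] with x hx
        rw [Pi.add_apply, ← mul_add, hx, Pi.add_apply]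
      map_smul' := fun c f => by
        rw [RingHom.id_apply, ← MemLp.toLp_const_smul]
        refine MemLp.toLp_congr _ _ ?_
        filter_upwards [Lp.coeFn_smul c f] with x hx
        simp only [hx, Pi.smul_apply, smul_eq_mul]
        ring }
    C (fun f => by
      refine Lp.norm_le_mul_norm_of_ae_le_mul ?_
      filter_upwards [(memLp_mul_of_bounded hm hC f).coeFn_toLp] with x hx
      simp only [LinearMap.coe_mk, AddHom.coe_mk]
      rw [hx, norm_mul, Complex.norm_real]
      exact mul_le_mul_of_nonneg_right (hC x) (norm_nonneg _))

variable {m : X → ℝ} {hm : Measurable m} {C : ℝ} {hC : ∀ x, |m x| ≤ C}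

theorem coeFn_mulOp (f : Lp ℂ 2 μ) : mulOp m hm hC f =ᵐ[μ] fun x => (m x : ℂ) * f x :=
  (memLp_mul_of_bounded hm hC f).coeFn_toLp

theorem coeFn_mulOp_pow (k : ℕ) (f : Lp ℂ 2 μ) :
    ((mulOp m hm hC) ^ k) f =ᵐ[μ] fun x => ((m x ^ k : ℝ) : ℂ) * f x := by
  induction k with
  | zero => simp
  | succ k ih =>
    rw [pow_succ', mul_apply_eq_comp]
    filter_upwards [coeFn_mulOp (hm := hm) (hC := hC) (((mulOp m hm hC) ^ k) f), ih] with x h1 h2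
    rw [h1, h2]
    push_cast
    ring

/-- Multiplication by the characteristic function of a measurable set. -/
def indOp (S : Set X) (hS : MeasurableSet S) : Lp ℂ 2 μ →L[ℂ] Lp ℂ 2 μ :=
  mulOp (S.indicator 1) (measurable_one.indicator hS) (C := 1) fun x => by
    by_cases hx : x ∈ S <;> simp [hx]

theorem coeFn_indOp {S : Set X} (hS : MeasurableSet S) (f : Lp ℂ 2 μ) :
    indOp S hS f =ᵐ[μ] S.indicator f := by
  filter_upwards [coeFn_mulOp (hm := measurable_one.indicator hS) (C := 1)
    (hC := fun x => by by_cases hx : x ∈ S <;> simp [hx]) f] with x hx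
  rw [indOp, hx]
  by_cases hxS : x ∈ S <;> simp [hxS]

theorem eLpNorm_indOp {S : Set X} (hS : MeasurableSet S) (f : Lp ℂ 2 μ) (q : ℝ≥0∞) :
    eLpNorm (indOp S hS f) q μ = eLpNorm f q (μ.restrict S) := by
  rw [eLpNorm_congr_ae (coeFn_indOp hS f), eLpNorm_indicator_eq_eLpNorm_restrict hS]

theorem enorm_indOp {S : Set X} (hS : MeasurableSet S) (f : Lp ℂ 2 μ) :
    ‖indOp S hS f‖ₑ = eLpNorm f 2 (μ.restrict S) := by
  rw [Lp.enorm_def, eLpNorm_indOp]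

theorem isSelfAdjoint_indOp {S : Set X} (hS : MeasurableSet S) :
    IsSelfAdjoint (indOp (μ := μ) S hS) := by
  rw [ContinuousLinearMap.isSelfAdjoint_iff_isSymmetric]
  intro f g
  simp only [ContinuousLinearMap.coe_coe]
  rw [L2.inner_def, L2.inner_def]
  refine MeasureTheory.integral_congr_ae ?_
  filter_upwards [coeFn_indOp hS f, coeFn_indOp hS g] with x h1 h2
  rw [h1, h2]
  by_cases hx : x ∈ S <;> simp [hx]

theorem eLpNorm_rpow_eq_lintegral {E : Type*} [NormedAddCommGroup E] {p : ℝ} (hp : 0 < p)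
    (f : X → E) (ν : Measure X) :
    eLpNorm f (ENNReal.ofReal p) ν ^ p = ∫⁻ x, ‖f x‖ₑ ^ p ∂ν := by
  rw [eLpNorm_eq_lintegral_rpow_enorm_toReal (by simpa using hp) ENNReal.ofReal_ne_top,
    ENNReal.toReal_ofReal hp.le, ← ENNReal.rpow_mul, one_div, inv_mul_cancel₀ hp.ne',
    ENNReal.rpow_one]

theorem eLpNorm_two_sq_eq_lintegral {E : Type*} [NormedAddCommGroup E]
    (f : X → E) (ν : Measure X) : eLpNorm f 2 ν ^ 2 = ∫⁻ x, ‖f x‖ₑ ^ 2 ∂ν := by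
  have := eLpNorm_rpow_eq_lintegral (p := 2) (by norm_num) f ν
  simpa using this

theorem tsum_eLpNorm_rpow_restrict {E : Type*} [NormedAddCommGroup E] {ι : Type*} [Countable ι]
    {Q : ι → Set X}
    (hQ : ∀ i, MeasurableSet (Q i)) (hd : Pairwise (Function.onFun Disjoint Q))
    (hu : ⋃ i, Q i = univ) {p : ℝ} (hp : 0 < p) (f : X → E) :
    ∑' i, eLpNorm f (ENNReal.ofReal p) (μ.restrict (Q i)) ^ p =
      eLpNorm f (ENNReal.ofReal p) μ ^ p := by
  simp_rw [eLpNorm_rpow_eq_lintegral hp]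
  rw [← lintegral_iUnion hQ hd, hu, Measure.restrict_univ]

theorem tsum_eLpNorm_sq_restrict {E : Type*} [NormedAddCommGroup E] {ι : Type*} [Countable ι]
    {Q : ι → Set X}
    (hQ : ∀ i, MeasurableSet (Q i)) (hd : Pairwise (Function.onFun Disjoint Q))
    (hu : ⋃ i, Q i = univ) (f : X → E) :
    ∑' i, eLpNorm f 2 (μ.restrict (Q i)) ^ 2 = eLpNorm f 2 μ ^ 2 := by
  simp_rw [eLpNorm_two_sq_eq_lintegral]
  rw [← lintegral_iUnion hQ hd, hu, Measure.restrict_univ]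

/-- The squared distance from a partial sum to `f` is the tail of the convergent series of squared
L² norms over the cells. -/
theorem hasSum_indOp {ι : Type*} [Countable ι] {Q : ι → Set X}
    (hQ : ∀ i, MeasurableSet (Q i)) (hd : Pairwise (Function.onFun Disjoint Q))
    (hu : ⋃ i, Q i = univ) (f : Lp ℂ 2 μ) : HasSum (fun i => indOp (Q i) (hQ i) f) f := by
  have hsum : ∑' i, ∫⁻ x in Q i, ‖f x‖ₑ ^ 2 ∂μ ≠ ∞ := by
    rw [← lintegral_iUnion hQ hd, hu, Measure.restrict_univ, ← eLpNorm_two_sq_eq_lintegral]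
    exact ENNReal.pow_ne_top (Lp.eLpNorm_ne_top f)
  have htail := ENNReal.tendsto_tsum_compl_atTop_zero hsum
  rw [HasSum, tendsto_iff_edist_tendsto_0]
  have hsq : ∀ F : Finset ι, edist (∑ i ∈ F, indOp (Q i) (hQ i) f) f ^ 2 =
      ∑' i : {i // i ∉ F}, ∫⁻ x in Q i, ‖f x‖ₑ ^ 2 ∂μ := by
    intro F
    have hae : ∀ᵐ x ∂μ, ∀ i, indOp (Q i) (hQ i) f x = (Q i).indicator f x :=
      ae_all_iff.2 fun i => coeFn_indOp (hQ i) f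
    have hd' : Pairwise (Function.onFun Disjoint fun i : {i // i ∉ F} => Q i) :=
      fun i j hij => hd fun h => hij (Subtype.ext h)
    rw [edist_comm, edist_eq_enorm_sub, Lp.enorm_def, eLpNorm_two_sq_eq_lintegral,
      ← lintegral_iUnion (s := fun i : {i // i ∉ F} => Q i) (fun i => hQ i) hd',
      ← lintegral_indicator (MeasurableSet.iUnion fun i : {i // i ∉ F} => hQ i)]
    refine lintegral_congr_ae ?_
    filter_upwards [hae, Lp.coeFn_sub f (∑ i ∈ F, indOp (Q i) (hQ i) f),
      Lp.coeFn_finsetSum F (fun i => indOp (Q i) (hQ i) f)] with x h1 h2 h3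
    rw [h2, Pi.sub_apply, h3, Finset.sum_apply]
    simp_rw [h1]
    obtain ⟨j, hj⟩ := mem_iUnion.1 (hu ▸ mem_univ x : x ∈ ⋃ i, Q i)
    have hne : ∀ i, i ≠ j → x ∉ Q i := fun i hij hx => Set.disjoint_left.1 (hd hij) hx hj
    by_cases hjF : j ∈ F
    · rw [Finset.sum_eq_single_of_mem j hjF fun i _ hij => indicator_of_notMem (hne i hij) _,
        indicator_of_mem hj, indicator_of_notMem]
      · simp
      · simp only [mem_iUnion, not_exists]
        exact fun i hx => hne i (fun h => i.2 (h ▸ hjF)) hx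
    · rw [Finset.sum_eq_zero fun i hi => indicator_of_notMem
        (hne i fun h => hjF (h ▸ hi)) _, sub_zero, indicator_of_mem]
      exact mem_iUnion.2 ⟨⟨j, hjF⟩, hj⟩
  simp_rw [← hsq] at htail
  have h0 := (ENNReal.continuous_rpow_const (y := (1 / 2 : ℝ))).tendsto 0 |>.comp htail
  rw [ENNReal.zero_rpow_of_pos (by norm_num)] at h0
  refine h0.congr fun F => ?_
  rw [Function.comp, ← ENNReal.rpow_natCast, ← ENNReal.rpow_mul]
  norm_num

theorem enorm_apply_le_tsum {G : Type*} [NormedAddCommGroup G] [NormedSpace ℂ G]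
    {ι : Type*} [Countable ι] {Q : ι → Set X}
    (hQ : ∀ i, MeasurableSet (Q i)) (hd : Pairwise (Function.onFun Disjoint Q))
    (hu : ⋃ i, Q i = univ) (T : Lp ℂ 2 μ →L[ℂ] G) (f : Lp ℂ 2 μ) :
    ‖T f‖ₑ ≤ ∑' i, ‖T (indOp (Q i) (hQ i) f)‖ₑ := by
  have h := (hasSum_indOp hQ hd hu f).mapL T
  refine le_of_tendsto (h.enorm) (Filter.Eventually.of_forall fun F => ?_)
  exact (enorm_sum_le _ _).trans (ENNReal.sum_le_tsum F)

end MulOp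

/-! ### Off-diagonal estimates on the cells of a partition -/

/-- The infimum is attained, as one sees on dividing by ‖f‖_p. When ‖f‖_p = 0 any admissible
constant will do, and finiteness of `B` provides one. -/
theorem eLpNorm_le_of_lebesgueOpNorm_le {X : Type*} [MeasurableSpace X] {μ : Measure X}
    {p q : ℝ≥0∞} {T : Lp ℂ 2 μ → X → ℂ} {B : ℝ≥0∞} (hB : B ≠ ∞) (hT : lebesgueOpNorm p q T ≤ B)
    {f : Lp ℂ 2 μ} (hf : eLpNorm f p μ < ∞) : eLpNorm (T f) q μ ≤ B * eLpNorm f p μ := by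
  refine le_trans ?_ (mul_le_mul_left hT _)
  rw [lebesgueOpNorm] at hT ⊢
  by_cases h0 : eLpNorm f p μ = 0
  · obtain ⟨C, hC, -⟩ := sInf_lt_iff.1 (hT.trans_lt hB.lt_top)
    have := hC f hf
    rw [h0, mul_zero] at this ⊢
    exact this
  · rw [← ENNReal.div_le_iff h0 hf.ne]
    refine le_sInf fun C hC => ?_
    rw [ENNReal.div_le_iff h0 hf.ne]
    exact hC f hf

theorem measure_cell_le {X : Type*} [MetricSpace X] [MeasurableSpace X] {μ : Measure X} {r : ℝ}
    (P : BallPartition X r) (i : P.centers) : μ (P.cell i) ≤ μ (ball (i : X) r) :=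
  measure_mono (P.cell_subset i)

section

variable {X : Type*} [MetricSpace X] [MeasurableSpace X] {μ : Measure X} {n : ℝ}

theorem eLpNorm_restrict_cell_lt_top (hμ : IsHomogeneousType μ n) {p r : ℝ} (hp2 : p < 2)
    (hr : 0 < r) (P : BallPartition X r) (i : P.centers) (f : Lp ℂ 2 μ) :
    eLpNorm f (ENNReal.ofReal p) (μ.restrict (P.cell i)) < ∞ := by
  have : IsFiniteMeasure (μ.restrict (P.cell i)) :=
    ⟨by
      rw [Measure.restrict_apply_univ]
      exact (measure_cell_le P i).trans_lt (hμ.volume_lt_top _ _ hr)⟩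
  refine (((Lp.memLp f).restrict (P.cell i)).mono_exponent ?_).2
  rw [← ENNReal.ofReal_ofNat 2]
  exact ENNReal.ofReal_le_ofReal hp2.le

theorem eLpNorm_restrict_cell_le {p r : ℝ} (hp1 : 1 ≤ p) (hp2 : p < 2) (P : BallPartition X r) (i : P.centers) (f : Lp ℂ 2 μ) :
    eLpNorm f (ENNReal.ofReal p) (μ.restrict (P.cell i)) ≤
      eLpNorm f 2 (μ.restrict (P.cell i)) * μ (ball (i : X) r) ^ (1 / p - 1 / 2) := by
  have hp0 : 0 < p := by linarith
  have hle : ENNReal.ofReal p ≤ 2 := by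
    rw [← ENNReal.ofReal_ofNat 2]
    exact ENNReal.ofReal_le_ofReal hp2.le
  refine (eLpNorm_le_eLpNorm_mul_rpow_measure_univ hle
    ((Lp.aestronglyMeasurable f).restrict)).trans ?_
  rw [ENNReal.toReal_ofReal hp0.le, Measure.restrict_apply_univ]
  refine mul_le_mul_right (ENNReal.rpow_le_rpow (measure_cell_le P i) ?_) _
  exact sub_nonneg.2 (one_div_le_one_div_of_le hp0 hp2.le)

end

section Blocks

variable {X : Type*} [MetricSpace X] [MeasurableSpace X] [BorelSpace X] {μ : Measure X} {n : ℝ}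
  {c : ℝ≥0}

theorem coeFn_ballProj (x : X) (r : ℝ) (g : Lp ℂ 2 μ) :
    ballProj x r g =ᵐ[μ] (ball x r).indicator g := by
  unfold ballProj
  exact MemLp.coeFn_toLp _

theorem ballProj_indOp {x : X} {r : ℝ} {S : Set X} (hS : MeasurableSet S) (hSx : S ⊆ ball x r)
    (f : Lp ℂ 2 μ) : ballProj (μ := μ) x r (indOp (μ := μ) S hS f) = indOp (μ := μ) S hS f := by
  refine Lp.ext ?_
  filter_upwards [coeFn_ballProj x r (indOp (μ := μ) S hS f), coeFn_indOp hS f] with z h1 h2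
  rw [h1]
  by_cases hz : z ∈ ball x r
  · rw [indicator_of_mem hz]
  · rw [indicator_of_notMem hz, h2, indicator_of_notMem fun h => hz (hSx h)]

/-- The `L^p → L²` block estimate contained in `PVE`. -/
theorem PVE.eLpNorm_block_le (hμ : IsHomogeneousType μ n)
    (hc : ∀ (x : X) (r l : ℝ), 0 < r → 1 ≤ l →
      μ (ball x (l * r)) ≤ c * ENNReal.ofReal (l ^ n) * μ (ball x r))
    {a p τ : ℝ} {K : ℝ≥0} {A : Lp ℂ 2 μ →L[ℂ] Lp ℂ 2 μ} (hp1 : 1 ≤ p) (hp2 : p < 2) (hτ : 0 < τ)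
    (hA : PVE n a p τ K A) (P : BallPartition X τ) (i l : P.centers) (f : Lp ℂ 2 μ) :
    eLpNorm (A (indOp (P.cell l) (P.measurableSet_cell l) f)) 2 (μ.restrict (P.cell i)) ≤
      (μ (ball (i : X) τ))⁻¹ ^ (1 / p - 1 / 2) *
        ((c * ENNReal.ofReal (2 ^ n)) ^ (1 / p - 1 / 2) * K *
          ENNReal.ofReal ((1 + dist (i : X) l / τ) ^ (-n - a))) *
        eLpNorm f (ENNReal.ofReal p) (μ.restrict (P.cell l)) := by
  have hp0 : 0 < p := by linarith
  set σ := 1 / p - 1 / 2 with hσdef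
  have hσ : 0 ≤ σ := sub_nonneg.2 (one_div_le_one_div_of_le hp0 hp2.le)
  set g := indOp (P.cell l) (P.measurableSet_cell l) f with hg
  have hgp : eLpNorm g (ENNReal.ofReal p) μ =
      eLpNorm f (ENNReal.ofReal p) (μ.restrict (P.cell l)) := eLpNorm_indOp _ f _
  have hfin : eLpNorm g (ENNReal.ofReal p) μ < ∞ := by
    rw [hgp]; exact eLpNorm_restrict_cell_lt_top hμ hp2 hτ P l f
  have h1 := eLpNorm_le_of_lebesgueOpNorm_le
    (ENNReal.mul_ne_top ENNReal.coe_ne_top ENNReal.ofReal_ne_top) (hA (i : X) (l : X)) hfin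
  simp only [hg, ballProj_indOp (P.measurableSet_cell l) (P.cell_subset l)] at h1
  rw [← hg, hgp, eLpNorm_indicator_eq_eLpNorm_restrict measurableSet_ball] at h1
  have hV0 : μ (ball (i : X) τ) ≠ 0 := (hμ.volume_pos _ _ hτ).ne'
  have hV1 : μ (ball (i : X) τ) ≠ ∞ := (hμ.volume_lt_top _ _ hτ).ne
  -- The cost of removing V(z, τ)^σ on the cell i: there B(i, τ) ⊆ B(z, 2τ), so that V(i, τ) ≤ c 2^n
  -- V(z, τ).
  set κ : ℝ≥0∞ := ((c * ENNReal.ofReal (2 ^ n)) * (μ (ball (i : X) τ))⁻¹) ^ σ with hκ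
  have hκtop : κ ≠ ∞ := by
    refine ENNReal.rpow_ne_top_of_nonneg hσ (ENNReal.mul_ne_top (ENNReal.mul_ne_top
      ENNReal.coe_ne_top ENNReal.ofReal_ne_top) (ENNReal.inv_ne_top.2 hV0))
  have h2 : eLpNorm (A g) 2 (μ.restrict (P.cell i)) ≤ κ.toNNReal •
      eLpNorm (fun z => ((μ.real (ball z τ) ^ σ : ℝ) : ℂ) * A g z) 2
        (μ.restrict (P.cell i)) := by
    refine eLpNorm_le_nnreal_smul_eLpNorm_of_ae_le_mul' ?_ 2
    filter_upwards [ae_restrict_mem (P.measurableSet_cell i)] with z hz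
    have hzb : dist z (i : X) < τ := P.cell_subset i hz
    have hVz : μ (ball (i : X) τ) ≤ c * ENNReal.ofReal (2 ^ n) * μ (ball z τ) := by
      refine le_trans (measure_mono (ball_subset_ball' ?_)) (hc z τ 2 hτ one_le_two)
      rw [dist_comm]
      linarith
    have he : ‖((μ.real (ball z τ) ^ σ : ℝ) : ℂ)‖ₑ = μ (ball z τ) ^ σ := by
      rw [← ofReal_norm, Complex.norm_real, Real.norm_of_nonneg (by positivity),
        ← ENNReal.ofReal_rpow_of_nonneg measureReal_nonneg hσ, Measure.real,
        ENNReal.ofReal_toReal (hμ.volume_lt_top _ _ hτ).ne]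
    rw [ENNReal.coe_toNNReal hκtop, enorm_mul, he, ← mul_assoc]
    refine le_mul_of_one_le_left zero_le ?_
    rw [hκ, ← ENNReal.mul_rpow_of_nonneg _ _ hσ]
    refine ENNReal.one_le_rpow ?_ (sub_pos.2 (one_div_lt_one_div_of_lt hp0 hp2))
    calc (1 : ℝ≥0∞) = μ (ball (i : X) τ) * (μ (ball (i : X) τ))⁻¹ :=
          (ENNReal.mul_inv_cancel hV0 hV1).symm
      _ ≤ c * ENNReal.ofReal (2 ^ n) * μ (ball z τ) * (μ (ball (i : X) τ))⁻¹ := by gcongr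
      _ = _ := by ring
  refine h2.trans ?_
  rw [ENNReal.smul_def, smul_eq_mul, ENNReal.coe_toNNReal hκtop]
  have h3 : eLpNorm (fun z => ((μ.real (ball z τ) ^ σ : ℝ) : ℂ) * A g z) 2
        (μ.restrict (P.cell i)) ≤ eLpNorm (fun z => ((μ.real (ball z τ) ^ σ : ℝ) : ℂ) * A g z) 2
        (μ.restrict (ball (i : X) τ)) :=
    eLpNorm_mono_measure _ (Measure.restrict_mono (P.cell_subset i) le_rfl)
  refine (mul_le_mul_right (h3.trans h1) κ).trans (le_of_eq ?_)
  rw [hκ, ENNReal.mul_rpow_of_nonneg _ _ hσ]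
  ring

/-- The `L² → L²` block estimate, which follows by self-adjointness. -/
theorem PVE.eLpNorm_block_le_two (hμ : IsHomogeneousType μ n)
    (hc : ∀ (x : X) (r l : ℝ), 0 < r → 1 ≤ l →
      μ (ball x (l * r)) ≤ c * ENNReal.ofReal (l ^ n) * μ (ball x r))
    {a p τ : ℝ} {K : ℝ≥0} {A : Lp ℂ 2 μ →L[ℂ] Lp ℂ 2 μ} (hAs : IsSelfAdjoint A) (hp1 : 1 ≤ p)
    (hp2 : p < 2) (hτ : 0 < τ)
    (hA : PVE n a p τ K A) (P : BallPartition X τ) (i l : P.centers) (f : Lp ℂ 2 μ) :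
    eLpNorm (A (indOp (P.cell l) (P.measurableSet_cell l) f)) 2 (μ.restrict (P.cell i)) ≤
        ((c * ENNReal.ofReal (2 ^ n)) ^ (1 / p - 1 / 2) * K *
          ENNReal.ofReal ((1 + dist (i : X) l / τ) ^ (-n - a))) *
        eLpNorm f 2 (μ.restrict (P.cell l)) := by
  have hp0 : 0 < p := by linarith
  set σ := 1 / p - 1 / 2 with hσdef
  have hσ : 0 ≤ σ := sub_nonneg.2 (one_div_le_one_div_of_le hp0 hp2.le)
  -- If V(l, τ) ≤ V(i, τ), Hölder on the cell l costs V(l, τ)^σ, which the factor V(i, τ)^{-σ} of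
  -- the `L^p → L²` bound absorbs. Otherwise the block is the adjoint of the one with i and l
  -- exchanged, to which this case applies.
  have hdir : ∀ (i l : P.centers), μ (ball (l : X) τ) ≤ μ (ball (i : X) τ) → ∀ f : Lp ℂ 2 μ,
      eLpNorm (A (indOp (P.cell l) (P.measurableSet_cell l) f)) 2 (μ.restrict (P.cell i)) ≤
        ((c * ENNReal.ofReal (2 ^ n)) ^ σ * K *
          ENNReal.ofReal ((1 + dist (i : X) l / τ) ^ (-n - a))) *
        eLpNorm f 2 (μ.restrict (P.cell l)) := by
    intro i l hV f
    have hV0 : μ (ball (i : X) τ) ≠ 0 := (hμ.volume_pos _ _ hτ).ne'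
    have hV1 : μ (ball (i : X) τ) ≠ ∞ := (hμ.volume_lt_top _ _ hτ).ne
    refine (hA.eLpNorm_block_le hμ hc hp1 hp2 hτ P i l f).trans ?_
    rw [← hσdef]
    refine (mul_le_mul_right (eLpNorm_restrict_cell_le hp1 hp2 P l f) _).trans ?_
    rw [← hσdef]
    set b := (c * ENNReal.ofReal (2 ^ n)) ^ σ * K *
          ENNReal.ofReal ((1 + dist (i : X) l / τ) ^ (-n - a))
    calc (μ (ball (i : X) τ))⁻¹ ^ σ * b *
          (eLpNorm f 2 (μ.restrict (P.cell l)) * μ (ball (l : X) τ) ^ σ)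
        = ((μ (ball (i : X) τ))⁻¹ * μ (ball (l : X) τ)) ^ σ *
          (b * eLpNorm f 2 (μ.restrict (P.cell l))) := by
          rw [ENNReal.mul_rpow_of_nonneg _ _ hσ]; ring
      _ ≤ 1 * (b * eLpNorm f 2 (μ.restrict (P.cell l))) := by
          gcongr
          refine ENNReal.rpow_le_one ?_ hσ
          calc (μ (ball (i : X) τ))⁻¹ * μ (ball (l : X) τ)
              ≤ (μ (ball (i : X) τ))⁻¹ * μ (ball (i : X) τ) := by gcongr
            _ = 1 := ENNReal.inv_mul_cancel hV0 hV1
      _ = _ := by rw [one_mul]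
  rcases le_total (μ (ball (l : X) τ)) (μ (ball (i : X) τ)) with hV | hV
  · exact hdir i l hV f
  · have hrev := hdir l i hV
    rw [dist_comm] at hrev
    set b := (c * ENNReal.ofReal (2 ^ n)) ^ σ * K *
          ENNReal.ofReal ((1 + dist (i : X) l / τ) ^ (-n - a)) with hb
    have hbtop : b ≠ ∞ := ENNReal.mul_ne_top (ENNReal.mul_ne_top
      (ENNReal.rpow_ne_top_of_nonneg hσ (ENNReal.mul_ne_top ENNReal.coe_ne_top
        ENNReal.ofReal_ne_top)) ENNReal.coe_ne_top) ENNReal.ofReal_ne_top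
    set Pi := indOp (μ := μ) (P.cell i) (P.measurableSet_cell i)
    set Pl := indOp (μ := μ) (P.cell l) (P.measurableSet_cell l)
    set h := Pi (A (Pl f)) with hh
    have hh' : eLpNorm (A (Pl f)) 2 (μ.restrict (P.cell i)) = ‖h‖ₑ := (enorm_indOp _ _).symm
    have hsPi := ContinuousLinearMap.isSelfAdjoint_iff_isSymmetric.1
      (isSelfAdjoint_indOp (μ := μ) (P.measurableSet_cell i))
    have hsPl := ContinuousLinearMap.isSelfAdjoint_iff_isSymmetric.1
      (isSelfAdjoint_indOp (μ := μ) (P.measurableSet_cell l))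
    have hsA := ContinuousLinearMap.isSelfAdjoint_iff_isSymmetric.1 hAs
    have hPl : ∀ u, Pl (Pl u) = Pl u := by
      intro u
      refine Lp.ext ?_
      filter_upwards [coeFn_indOp (P.measurableSet_cell l) (Pl u),
        coeFn_indOp (P.measurableSet_cell l) u] with x h1 h2
      rw [h1]
      by_cases hx : x ∈ P.cell l
      · rw [indicator_of_mem hx]
      · rw [indicator_of_notMem hx, h2, indicator_of_notMem hx]
    have hin : inner ℂ h h = inner ℂ (Pl (A (Pi h))) (Pl f) := by
      have e1 : inner ℂ (Pi (A (Pl f))) h = inner ℂ (A (Pl f)) (Pi h) := hsPi _ _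
      have e2 : inner ℂ (A (Pl f)) (Pi h) = inner ℂ (Pl f) (A (Pi h)) := hsA _ _
      have e3 : inner ℂ (Pl (A (Pi h))) (Pl f) = inner ℂ (A (Pi h)) (Pl (Pl f)) := hsPl _ _
      have e4 : inner ℂ (A (Pi h)) (Pl f) = starRingEnd ℂ (inner ℂ (Pl f) (A (Pi h))) :=
        (inner_conj_symm _ _).symm
      have e5 : starRingEnd ℂ (inner ℂ h h) = inner ℂ h h := inner_conj_symm _ _
      rw [e3, hPl, e4, ← e2, ← e1, ← hh, e5]
    have hnorm : ‖h‖ₑ * ‖h‖ₑ ≤ ‖Pl (A (Pi h))‖ₑ * ‖Pl f‖ₑ := by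
      have h1 : ‖h‖ * ‖h‖ ≤ ‖Pl (A (Pi h))‖ * ‖Pl f‖ := by
        have h2 := norm_inner_le_norm (𝕜 := ℂ) (Pl (A (Pi h))) (Pl f)
        rw [← hin, inner_self_eq_norm_sq_to_K, norm_pow] at h2
        simpa [sq] using h2
      simp only [← ofReal_norm]
      rw [← ENNReal.ofReal_mul (norm_nonneg _), ← ENNReal.ofReal_mul (norm_nonneg _)]
      exact ENNReal.ofReal_le_ofReal h1
    have hPlA : ‖Pl (A (Pi h))‖ₑ ≤ b * ‖h‖ₑ := by
      rw [enorm_indOp]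
      refine (hrev h).trans (mul_le_mul_right ?_ _)
      rw [Lp.enorm_def]
      exact eLpNorm_mono_measure _ Measure.restrict_le_self
    rw [hh']
    by_cases h0 : ‖h‖ₑ = 0
    · rw [h0]; exact zero_le
    · have htop : ‖h‖ₑ ≠ ∞ := enorm_ne_top
      refine (ENNReal.mul_le_mul_iff_left h0 htop).1 ?_
      refine hnorm.trans ((mul_le_mul_left hPlA _).trans (le_of_eq ?_))
      rw [show ‖Pl f‖ₑ = eLpNorm f 2 (μ.restrict (P.cell l)) from enorm_indOp _ _]
      ring

end Blocks

/-! ### Weights that are constant on the cells -/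

section CellWeight

variable {X : Type*} [MetricSpace X] [MeasurableSpace X] {μ : Measure X} {r : ℝ}

/-- The index of the cell that contains a given point. -/
def BallPartition.idx (P : BallPartition X r) (z : X) : P.centers :=
  (mem_iUnion.1 (P.iUnion_cell ▸ mem_univ z : z ∈ ⋃ i, P.cell i)).choose

theorem BallPartition.mem_cell_idx (P : BallPartition X r) (z : X) : z ∈ P.cell (P.idx z) :=
  (mem_iUnion.1 (P.iUnion_cell ▸ mem_univ z : z ∈ ⋃ i, P.cell i)).choose_spec

theorem BallPartition.idx_eq (P : BallPartition X r) {z : X} {i : P.centers}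
    (hz : z ∈ P.cell i) : P.idx z = i := by
  by_contra h
  exact Set.disjoint_left.1 (P.disjoint h) (P.mem_cell_idx z) hz

theorem BallPartition.measurable_comp_idx (P : BallPartition X r) (γ : P.centers → ℝ) :
    Measurable fun z => γ (P.idx z) := by
  intro S _
  have : (fun z => γ (P.idx z)) ⁻¹' S = ⋃ i ∈ γ ⁻¹' S, P.cell i := by
    ext z
    simp only [mem_preimage, mem_iUnion, exists_prop]
    exact ⟨fun h => ⟨_, h, P.mem_cell_idx z⟩, fun ⟨i, hi, hz⟩ => by rwa [P.idx_eq hz]⟩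
  rw [this]
  exact MeasurableSet.iUnion fun i => MeasurableSet.iUnion fun _ => P.measurableSet_cell i

/-- Multiplication by a function that takes the value `γ i` on the cell with index `i`. -/
def BallPartition.weightOp (P : BallPartition X r) (γ : P.centers → ℝ) {C : ℝ}
    (hC : ∀ i, |γ i| ≤ C) : Lp ℂ 2 μ →L[ℂ] Lp ℂ 2 μ :=
  mulOp (fun z => γ (P.idx z)) (P.measurable_comp_idx γ) (C := C) fun z => hC (P.idx z)

variable {P : BallPartition X r} {γ : P.centers → ℝ} {C : ℝ} {hC : ∀ i, |γ i| ≤ C}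

theorem coeFn_weightOp_pow (k : ℕ) (f : Lp ℂ 2 μ) :
    ((P.weightOp γ hC) ^ k) f =ᵐ[μ] fun z => ((γ (P.idx z) ^ k : ℝ) : ℂ) * f z :=
  coeFn_mulOp_pow k f

theorem coeFn_weightOp_pow_restrict (k : ℕ) (f : Lp ℂ 2 μ) (i : P.centers) :
    ((P.weightOp γ hC) ^ k) f =ᵐ[μ.restrict (P.cell i)] fun z => ((γ i ^ k : ℝ) : ℂ) * f z := by
  filter_upwards [ae_restrict_of_ae (coeFn_weightOp_pow (hC := hC) k f),
    ae_restrict_mem (P.measurableSet_cell i)] with z h1 h2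
  rw [h1, P.idx_eq h2]

theorem eLpNorm_weightOp_pow_restrict (k : ℕ) (f : Lp ℂ 2 μ) (i : P.centers) :
    eLpNorm (((P.weightOp γ hC) ^ k) f) 2 (μ.restrict (P.cell i)) =
      ENNReal.ofReal (|γ i| ^ k) * eLpNorm f 2 (μ.restrict (P.cell i)) := by
  rw [eLpNorm_congr_ae (coeFn_weightOp_pow_restrict k f i)]
  have := eLpNorm_const_smul ((γ i ^ k : ℝ) : ℂ) f 2 (μ.restrict (P.cell i))
  rw [← ofReal_norm, Complex.norm_real, Real.norm_eq_abs, abs_pow] at this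
  exact this

/-- The reason for weights constant on cells: they act as a scalar on each piece, so that the blocks
of [M^k, A] are those of A times γ_i^k - γ_l^k. -/
theorem weightOp_pow_indOp (k : ℕ) (f : Lp ℂ 2 μ) (l : P.centers) :
    ((P.weightOp γ hC) ^ k) (indOp (P.cell l) (P.measurableSet_cell l) f) =
      ((γ l ^ k : ℝ) : ℂ) • indOp (P.cell l) (P.measurableSet_cell l) f := by
  refine Lp.ext ?_
  filter_upwards [coeFn_weightOp_pow (hC := hC) k (indOp (P.cell l) (P.measurableSet_cell l) f),
    Lp.coeFn_smul ((γ l ^ k : ℝ) : ℂ) (indOp (P.cell l) (P.measurableSet_cell l) f),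
    coeFn_indOp (P.measurableSet_cell l) f] with z h1 h2 h3
  rw [h1, h2, Pi.smul_apply, smul_eq_mul, h3]
  by_cases hz : z ∈ P.cell l
  · rw [P.idx_eq hz]
  · rw [indicator_of_notMem hz, mul_zero, mul_zero]

theorem norm_weightOp_pow_le_succ {R : ℝ} (hR0 : 0 ≤ R) (hR : ∀ i, R ≤ γ i) (k : ℕ)
    (f : Lp ℂ 2 μ) :
    R * ‖((P.weightOp γ hC) ^ k) f‖ ≤ ‖((P.weightOp γ hC) ^ (k + 1)) f‖ := by
  have h : ‖(R : ℂ) • ((P.weightOp γ hC) ^ k) f‖ ≤ ‖((P.weightOp γ hC) ^ (k + 1)) f‖ := by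
    refine Lp.norm_le_norm_of_ae_le ?_
    filter_upwards [coeFn_weightOp_pow (hC := hC) k f, coeFn_weightOp_pow (hC := hC) (k + 1) f,
      Lp.coeFn_smul (R : ℂ) (((P.weightOp γ hC) ^ k) f)] with z h1 h2 h3
    have h0 := hR (P.idx z)
    have h0' := hR0.trans h0
    rw [h3, Pi.smul_apply, h1, h2, norm_smul, norm_mul, norm_mul, Complex.norm_real,
      Complex.norm_real, Complex.norm_real, Real.norm_of_nonneg hR0,
      Real.norm_of_nonneg (pow_nonneg h0' _), Real.norm_of_nonneg (pow_nonneg h0' _), ← mul_assoc,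
      pow_succ, mul_comm R]
    gcongr
  rwa [norm_smul, Complex.norm_real, Real.norm_of_nonneg hR0] at h

theorem enorm_block_sq (P : BallPartition X r) (f : Lp ℂ 2 μ) :
    ∑' i, eLpNorm f 2 (μ.restrict (P.cell i)) ^ 2 = ‖f‖ₑ ^ 2 := by
  rw [tsum_eLpNorm_sq_restrict P.measurableSet_cell P.disjoint P.iUnion_cell, Lp.enorm_def]

theorem eLpNorm_restrict_apply_le_tsum (P : BallPartition X r)
    (T : Lp ℂ 2 μ →L[ℂ] Lp ℂ 2 μ) (f : Lp ℂ 2 μ) (i : P.centers) :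
    eLpNorm (T f) 2 (μ.restrict (P.cell i)) ≤
      ∑' l, eLpNorm (T (indOp (P.cell l) (P.measurableSet_cell l) f)) 2
        (μ.restrict (P.cell i)) := by
  simp_rw [← enorm_indOp (P.measurableSet_cell i)]
  exact enorm_apply_le_tsum P.measurableSet_cell P.disjoint P.iUnion_cell
    (indOp (P.cell i) (P.measurableSet_cell i) ∘L T) f

end CellWeight

/-! ### Commutators with cell weights and weighted `L^p → L²` bounds -/

section Weighted

variable {X : Type*} [MetricSpace X] [MeasurableSpace X] [BorelSpace X] {μ : Measure X} {n : ℝ}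

/-- Row and column sums of polynomially decaying kernels. -/
theorem exists_kernel_sums_le (hμ : IsHomogeneousType μ n) (hn : 0 < n) {ε : ℝ} (hε : 0 < ε)
    (b : ℝ≥0) : ∃ C : ℝ≥0, ∀ τ : ℝ, 0 < τ → ∀ P : BallPartition X τ,
      (∀ i : P.centers, ∑' l : P.centers,
        b * ENNReal.ofReal ((1 + dist (i : X) l / τ) ^ (-(n + ε))) ≤ C) ∧
      (∀ l : P.centers, ∑' i : P.centers,
        b * ENNReal.ofReal ((1 + dist (i : X) l / τ) ^ (-(n + ε))) ≤ C) := by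
  obtain ⟨C, hC⟩ := exists_tsum_centers_le hμ hn hε
  refine ⟨b * C, fun τ hτ P => ⟨fun i => ?_, fun l => ?_⟩⟩
  · rw [ENNReal.tsum_mul_left, ENNReal.coe_mul]
    exact mul_le_mul_right (hC τ hτ P i) _
  · rw [ENNReal.tsum_mul_left, ENNReal.coe_mul]
    simp_rw [dist_comm _ (l : X)]
    exact mul_le_mul_right (hC τ hτ P l) _

/-- As y ≥ 1, one has x ≤ y(1 + d), so the bound (k + 1)|x - y| max(x, y)^k keeps only the power
y^k. The price (1 + d)^κ is left to the decay of a kernel. -/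
theorem abs_pow_succ_sub_pow_succ_le {x y d : ℝ} {k κ : ℕ} (hk : k + 1 ≤ κ) (hx : 1 ≤ x)
    (hy : 1 ≤ y) (hd : |x - y| ≤ d) :
    |x ^ (k + 1) - y ^ (k + 1)| ≤ κ * (1 + d) ^ κ * y ^ k := by
  have hd0 : 0 ≤ d := (abs_nonneg _).trans hd
  have hxy : x ≤ y * (1 + d) := by nlinarith [(abs_le.1 hd).2]
  have h1 := abs_pow_sub_pow_le x y (k + 1)
  rw [abs_of_nonneg (by linarith : 0 ≤ x), abs_of_nonneg (by linarith : 0 ≤ y)] at h1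
  have hmax : max x y ≤ y * (1 + d) := max_le hxy (by nlinarith)
  have hkκ : ((k + 1 : ℕ) : ℝ) ≤ κ := by exact_mod_cast hk
  calc |x ^ (k + 1) - y ^ (k + 1)| ≤ |x - y| * ((k + 1 : ℕ) : ℝ) * max x y ^ (k + 1 - 1) := h1
    _ ≤ (1 + d) * κ * (y * (1 + d)) ^ k := by
        rw [Nat.add_sub_cancel]
        have : 0 ≤ max x y := le_max_of_le_left (by linarith)
        gcongr
        linarith
    _ = κ * (1 + d) ^ (k + 1) * y ^ k := by rw [mul_pow]; ring
    _ ≤ κ * (1 + d) ^ κ * y ^ k := by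
        have : (1 + d) ^ (k + 1) ≤ (1 + d) ^ κ := pow_le_pow_right₀ (by linarith) hk
        gcongr

theorem ofReal_pow_mul_rpow_neg {d a : ℝ} (hd : 0 ≤ d) (κ : ℕ) :
    ENNReal.ofReal ((1 + d) ^ κ) * ENNReal.ofReal ((1 + d) ^ (-n - a)) =
      ENNReal.ofReal ((1 + d) ^ (-(n + (a - κ)))) := by
  rw [← ENNReal.ofReal_mul (by positivity), ← Real.rpow_natCast, ← Real.rpow_add (by positivity)]
  congr 2
  ring

/-- The commutators of `A` with powers of a cell weight lose one power of the weight. -/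
theorem exists_norm_commutator_weightOp_le (hμ : IsHomogeneousType μ n) (hn : 0 < n)
    {p a : ℝ} {κ : ℕ} (hp1 : 1 ≤ p) (hp2 : p < 2) (hκ : κ < a) (K : ℝ≥0) :
    ∃ D : ℝ≥0, ∀ (τ : ℝ), 0 < τ → ∀ A : Lp ℂ 2 μ →L[ℂ] Lp ℂ 2 μ, IsSelfAdjoint A →
      PVE n a p τ K A → ∀ (P : BallPartition X τ) (γ : P.centers → ℝ) (C : ℝ)
        (hC : ∀ i, |γ i| ≤ C), (∀ i, 1 ≤ γ i) →
        (∀ i l : P.centers, |γ i - γ l| ≤ dist (i : X) l / τ) →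
        ∀ k, k + 1 ≤ κ → ∀ u, ‖(P.weightOp γ hC ^ (k + 1)) (A u) -
          A ((P.weightOp γ hC ^ (k + 1)) u)‖ ≤ D * ‖(P.weightOp γ hC ^ k) u‖ := by
  obtain ⟨c, hc⟩ := hμ.doubling
  have hp0 : 0 < p := by linarith
  have hσ : 0 ≤ 1 / p - 1 / 2 := sub_nonneg.2 (one_div_le_one_div_of_le hp0 hp2.le)
  set b : ℝ≥0∞ := (c * ENNReal.ofReal (2 ^ n)) ^ (1 / p - 1 / 2) * K with hb
  have hbtop : b ≠ ∞ := ENNReal.mul_ne_top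
      (ENNReal.rpow_ne_top_of_nonneg hσ (ENNReal.mul_ne_top ENNReal.coe_ne_top
        ENNReal.ofReal_ne_top)) ENNReal.coe_ne_top
  -- After the factor (1 + d)^κ from the weights the blocks still decay with exponent n + (a - κ),
  -- which is summable because κ < a.
  obtain ⟨C0, hC0⟩ := exists_kernel_sums_le hμ hn (sub_pos.2 hκ) (κ * b.toNNReal)
  refine ⟨C0, fun τ hτ A hAs hA P γ C hC hγ1 hγ k hk u => ?_⟩
  set M := P.weightOp (μ := μ) γ hC with hM
  obtain ⟨hrow, hcol⟩ := hC0 τ hτ P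
  have hblock : ∀ i : P.centers, eLpNorm ((M ^ (k + 1)) (A u) - A ((M ^ (k + 1)) u) : Lp ℂ 2 μ) 2
      (μ.restrict (P.cell i)) ≤ ∑' l : P.centers, ((κ * b.toNNReal : ℝ≥0) *
        ENNReal.ofReal ((1 + dist (i : X) l / τ) ^ (-(n + (a - κ))))) *
          eLpNorm ((M ^ k) u) 2 (μ.restrict (P.cell l)) := by
    intro i
    -- On the cell i the commutator coincides with T, and T sends a piece in the cell l to a scalar
    -- multiple of its image under A.
    set T : Lp ℂ 2 μ →L[ℂ] Lp ℂ 2 μ := ((γ i ^ (k + 1) : ℝ) : ℂ) • A - A * M ^ (k + 1) with hT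
    have e1 : eLpNorm ((M ^ (k + 1)) (A u) - A ((M ^ (k + 1)) u) : Lp ℂ 2 μ) 2
        (μ.restrict (P.cell i)) = eLpNorm (T u) 2 (μ.restrict (P.cell i)) := by
      refine eLpNorm_congr_ae ?_
      have e : T u = ((γ i ^ (k + 1) : ℝ) : ℂ) • A u - A ((M ^ (k + 1)) u) := rfl
      rw [e]
      filter_upwards [ae_restrict_of_ae (Lp.coeFn_sub ((M ^ (k + 1)) (A u)) (A ((M ^ (k + 1)) u))),
        ae_restrict_of_ae (Lp.coeFn_sub (((γ i ^ (k + 1) : ℝ) : ℂ) • A u) (A ((M ^ (k + 1)) u))),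
        ae_restrict_of_ae (Lp.coeFn_smul ((γ i ^ (k + 1) : ℝ) : ℂ) (A u)),
        coeFn_weightOp_pow_restrict (hC := hC) (k + 1) (A u) i] with z h1 h2 h3 h4
      rw [h1, h2, Pi.sub_apply, Pi.sub_apply, h3, Pi.smul_apply, ← hM] at *
      rw [h4, smul_eq_mul]
    rw [e1]
    refine (eLpNorm_restrict_apply_le_tsum P T u i).trans (ENNReal.tsum_le_tsum fun l => ?_)
    have e2 : T (indOp (P.cell l) (P.measurableSet_cell l) u) =
        ((γ i ^ (k + 1) - γ l ^ (k + 1) : ℝ) : ℂ) •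
          A (indOp (P.cell l) (P.measurableSet_cell l) u) := by
      have e : T (indOp (P.cell l) (P.measurableSet_cell l) u) =
        ((γ i ^ (k + 1) : ℝ) : ℂ) • A (indOp (P.cell l) (P.measurableSet_cell l) u) -
          A ((M ^ (k + 1)) (indOp (P.cell l) (P.measurableSet_cell l) u)) := rfl
      rw [e, hM, weightOp_pow_indOp, map_smul, ← sub_smul, Complex.ofReal_sub]
    have e3 : eLpNorm (T (indOp (P.cell l) (P.measurableSet_cell l) u)) 2
        (μ.restrict (P.cell i)) = ENNReal.ofReal |γ i ^ (k + 1) - γ l ^ (k + 1)| *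
        eLpNorm (A (indOp (P.cell l) (P.measurableSet_cell l) u)) 2 (μ.restrict (P.cell i)) := by
      rw [e2, eLpNorm_congr_ae (ae_restrict_of_ae (Lp.coeFn_smul _ _)), eLpNorm_const_smul,
        ← ofReal_norm, Complex.norm_real, Real.norm_eq_abs]
    rw [e3, hM, eLpNorm_weightOp_pow_restrict, abs_of_nonneg (zero_le_one.trans (hγ1 l)),
      ← ofReal_pow_mul_rpow_neg (by positivity)]
    set d := dist (i : X) l / τ with hd
    have hd0 : 0 ≤ d := by positivity
    have h4 := hA.eLpNorm_block_le_two hμ hc hAs hp1 hp2 hτ P i l u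
    rw [← hd, ← hb] at h4
    have h5 := ENNReal.ofReal_le_ofReal
      (abs_pow_succ_sub_pow_succ_le hk (hγ1 i) (hγ1 l) (hγ i l))
    rw [ENNReal.ofReal_mul (by positivity), ENNReal.ofReal_mul (by positivity),
      ENNReal.ofReal_natCast, ← hd] at h5
    refine (mul_le_mul' h5 h4).trans (le_of_eq ?_)
    rw [ENNReal.coe_mul, ENNReal.coe_toNNReal hbtop, ENNReal.coe_natCast]
    ring
  -- The plain L² Schur test: for p = 2 the exponent of D vanishes, and ∞^0 = 1.
  have hsum := ENNReal.tsum_sq_le_of_kernel (p := 2) one_le_two le_rfl (W := fun _ => 1)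
    (D := ∞) hrow hcol (fun _ _ _ => le_top) (fun i =>
      (hblock i).trans_eq (by rw [ENNReal.one_rpow, one_mul]))
  rw [enorm_block_sq] at hsum
  have hexp1 : (3 : ℝ) - 2 / 2 = 2 := by norm_num
  have hexp2 : (2 : ℝ) * (1 / 2 - 1 / 2) = 0 := by norm_num
  have hexp3 : (2 : ℝ) / 2 = 1 := by norm_num
  rw [hexp1, hexp2, hexp3, ENNReal.rpow_zero, mul_one, ENNReal.rpow_one] at hsum
  simp only [ENNReal.rpow_two] at hsum
  rw [enorm_block_sq, ← mul_pow, ENNReal.pow_le_pow_left_iff two_ne_zero] at hsum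
  rw [← ofReal_norm, ← ofReal_norm, ← ENNReal.ofReal_coe_nnreal,
    ← ENNReal.ofReal_mul (by positivity)] at hsum
  exact (ENNReal.ofReal_le_ofReal_iff (by positivity)).1 hsum

/-- The weighted `L^p → L²` estimate for `A`. -/
theorem exists_enorm_weightOp_pow_le (hμ : IsHomogeneousType μ n) (hn : 0 < n)
    {p a : ℝ} {κ : ℕ} (hp1 : 1 ≤ p) (hp2 : p < 2) (hκ : κ < a) (K : ℝ≥0) :
    ∃ D : ℝ≥0, ∀ (τ : ℝ), 0 < τ → ∀ A : Lp ℂ 2 μ →L[ℂ] Lp ℂ 2 μ,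
      PVE n a p τ K A → ∀ (P : BallPartition X τ) (γ : P.centers → ℝ) (C : ℝ)
        (hC : ∀ i, |γ i| ≤ C), (∀ i, 1 ≤ γ i) →
        (∀ i l : P.centers, |γ i - γ l| ≤ dist (i : X) l / τ) →
        ∀ (f : Lp ℂ 2 μ) (Γ : ℝ) (v : ℝ≥0∞), (∀ l : P.centers,
          eLpNorm f (ENNReal.ofReal p) (μ.restrict (P.cell l)) ≠ 0 →
            γ l ≤ Γ ∧ (μ (ball (l : X) τ))⁻¹ ≤ v) →
        ‖(P.weightOp γ hC ^ κ) (A f)‖ₑ ≤ D * ENNReal.ofReal (Γ ^ κ) * v ^ (1 / p - 1 / 2) *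
          eLpNorm f (ENNReal.ofReal p) μ := by
  obtain ⟨c, hc⟩ := hμ.doubling
  have hp0 : 0 < p := by linarith
  have hσ : 0 ≤ 1 / p - 1 / 2 := sub_nonneg.2 (one_div_le_one_div_of_le hp0 hp2.le)
  set σ := 1 / p - 1 / 2 with hσdef
  set b : ℝ≥0∞ := (c * ENNReal.ofReal (2 ^ n)) ^ σ * K with hb
  have hbtop : b ≠ ∞ := ENNReal.mul_ne_top
      (ENNReal.rpow_ne_top_of_nonneg hσ (ENNReal.mul_ne_top ENNReal.coe_ne_top
        ENNReal.ofReal_ne_top)) ENNReal.coe_ne_top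
  obtain ⟨C0, hC0⟩ := exists_kernel_sums_le hμ hn (sub_pos.2 hκ) b.toNNReal
  have hexp : (0 : ℝ) ≤ (3 - 2 / p) / 2 := by
    have : 2 / p ≤ 2 := by rw [div_le_iff₀ hp0]; linarith
    linarith
  set D : ℝ≥0∞ := (C0 : ℝ≥0∞) ^ ((3 - 2 / p) / 2) * (c * b) ^ σ with hD
  have hDtop : D ≠ ∞ := ENNReal.mul_ne_top
    (ENNReal.rpow_ne_top_of_nonneg hexp ENNReal.coe_ne_top)
    (ENNReal.rpow_ne_top_of_nonneg hσ (ENNReal.mul_ne_top ENNReal.coe_ne_top hbtop))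
  refine ⟨D.toNNReal, fun τ hτ A hA P γ C hC hγ1 hγ f Γ v hf => ?_⟩
  rw [ENNReal.coe_toNNReal hDtop]
  set M := P.weightOp (μ := μ) γ hC with hM
  obtain ⟨hrow, hcol⟩ := hC0 τ hτ P
  rw [ENNReal.coe_toNNReal hbtop] at hrow hcol
  have hblock : ∀ i : P.centers, eLpNorm ((M ^ κ) (A f)) 2 (μ.restrict (P.cell i)) ≤
      (μ (ball (i : X) τ))⁻¹ ^ σ * ∑' l : P.centers,
        (b * ENNReal.ofReal ((1 + dist (i : X) l / τ) ^ (-(n + (a - κ))))) *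
          (ENNReal.ofReal (Γ ^ κ) * eLpNorm f (ENNReal.ofReal p) (μ.restrict (P.cell l))) := by
    intro i
    rw [hM, eLpNorm_weightOp_pow_restrict, abs_of_nonneg (zero_le_one.trans (hγ1 i))]
    refine (mul_le_mul_right (eLpNorm_restrict_apply_le_tsum P A f i) _).trans ?_
    rw [← ENNReal.tsum_mul_left, ← ENNReal.tsum_mul_left]
    refine ENNReal.tsum_le_tsum fun l => ?_
    have h4 := hA.eLpNorm_block_le hμ hc hp1 hp2 hτ P i l f
    rw [← hσdef, ← hb] at h4
    by_cases h0 : eLpNorm f (ENNReal.ofReal p) (μ.restrict (P.cell l)) = 0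
    · rw [h0, mul_zero, nonpos_iff_eq_zero] at h4
      rw [h4, mul_zero]
      exact zero_le
    · obtain ⟨hl, -⟩ := hf l h0
      rw [← ofReal_pow_mul_rpow_neg (by positivity)]
      set d := dist (i : X) l / τ with hd
      have hd0 : 0 ≤ d := by positivity
      have h5 : γ i ^ κ ≤ (1 + d) ^ κ * Γ ^ κ := by
        rw [← mul_pow]
        refine pow_le_pow_left₀ (zero_le_one.trans (hγ1 i)) ?_ κ
        nlinarith [(abs_le.1 (hγ i l)).2, hγ1 l]
      have h6 := ENNReal.ofReal_le_ofReal h5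
      rw [ENNReal.ofReal_mul (by positivity)] at h6
      refine (mul_le_mul' h6 h4).trans (le_of_eq ?_)
      ring
  -- Doubling replaces V(i, τ)⁻¹ by V(l, τ)⁻¹ ≤ v at the cost c(1 + d)^n, which the decay of the
  -- kernel absorbs.
  have hsum := ENNReal.tsum_sq_le_of_kernel (p := p) hp1 hp2.le
    (W := fun i : P.centers => (μ (ball (i : X) τ))⁻¹) (D := c * b * v) hrow hcol (fun i l hil => by
      obtain ⟨-, hl⟩ := hf l (right_ne_zero_of_mul hil)
      set d := dist (i : X) l / τ with hd
      have hd0 : 0 ≤ d := by positivity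
      have hV0 : ∀ i : P.centers, μ (ball (i : X) τ) ≠ 0 := fun i => (hμ.volume_pos _ _ hτ).ne'
      have hV1 : ∀ i : P.centers, μ (ball (i : X) τ) ≠ ∞ := fun i => (hμ.volume_lt_top _ _ hτ).ne
      have h1 : μ (ball (l : X) τ) ≤ c * ENNReal.ofReal ((1 + d) ^ n) * μ (ball (i : X) τ) := by
        refine le_trans (measure_mono (ball_subset_ball' ?_)) (hc i τ (1 + d) hτ (by linarith))
        rw [hd, add_mul, div_mul_cancel₀ _ hτ.ne', one_mul, dist_comm]
      have h2 : (μ (ball (i : X) τ))⁻¹ ≤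
          c * ENNReal.ofReal ((1 + d) ^ n) * (μ (ball (l : X) τ))⁻¹ := by
        refine (ENNReal.mul_le_mul_iff_left (hV0 i) (hV1 i)).1 ?_
        rw [ENNReal.inv_mul_cancel (hV0 i) (hV1 i)]
        refine (ENNReal.mul_le_mul_iff_left (hV0 l) (hV1 l)).1 ?_
        rw [one_mul]
        refine h1.trans (le_of_eq ?_)
        calc c * ENNReal.ofReal ((1 + d) ^ n) * μ (ball (i : X) τ)
            = c * ENNReal.ofReal ((1 + d) ^ n) * μ (ball (i : X) τ) *
              ((μ (ball (l : X) τ))⁻¹ * μ (ball (l : X) τ)) := by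
              rw [ENNReal.inv_mul_cancel (hV0 l) (hV1 l), mul_one]
          _ = _ := by ring
      have h3 : ENNReal.ofReal ((1 + d) ^ n) *
          ENNReal.ofReal ((1 + d) ^ (-(n + (a - κ)))) ≤ 1 := by
        rw [← ENNReal.ofReal_mul (by positivity), ← Real.rpow_add (by positivity),
          ENNReal.ofReal_le_one]
        exact Real.rpow_le_one_of_one_le_of_nonpos (by linarith) (by linarith)
      calc (μ (ball (i : X) τ))⁻¹ * (b * ENNReal.ofReal ((1 + d) ^ (-(n + (a - κ)))))
          ≤ (c * ENNReal.ofReal ((1 + d) ^ n) * v) *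
            (b * ENNReal.ofReal ((1 + d) ^ (-(n + (a - κ))))) := by
            refine mul_le_mul_left (h2.trans ?_) _
            gcongr
        _ = c * b * v * (ENNReal.ofReal ((1 + d) ^ n) *
            ENNReal.ofReal ((1 + d) ^ (-(n + (a - κ))))) := by ring
        _ ≤ c * b * v * 1 := by gcongr
        _ = c * b * v := mul_one _) hblock
  rw [enorm_block_sq] at hsum
  have e1 : ∑' l : P.centers, (ENNReal.ofReal (Γ ^ κ) *
      eLpNorm f (ENNReal.ofReal p) (μ.restrict (P.cell l))) ^ p =
      (ENNReal.ofReal (Γ ^ κ) * eLpNorm f (ENNReal.ofReal p) μ) ^ p := by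
    simp_rw [ENNReal.mul_rpow_of_nonneg _ _ hp0.le]
    rw [ENNReal.tsum_mul_left,
      tsum_eLpNorm_rpow_restrict P.measurableSet_cell P.disjoint P.iUnion_cell hp0]
  rw [e1, ← ENNReal.rpow_mul, mul_div_cancel₀ _ hp0.ne', ← hσdef] at hsum
  have e2 : (C0 : ℝ≥0∞) ^ (3 - 2 / p) * (c * b * v) ^ (2 * σ) *
      (ENNReal.ofReal (Γ ^ κ) * eLpNorm f (ENNReal.ofReal p) μ) ^ (2 : ℝ) =
      (D * ENNReal.ofReal (Γ ^ κ) * v ^ σ * eLpNorm f (ENNReal.ofReal p) μ) ^ 2 := by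
    have h1 : (C0 : ℝ≥0∞) ^ (3 - 2 / p) = ((C0 : ℝ≥0∞) ^ ((3 - 2 / p) / 2)) ^ 2 := by
      rw [← ENNReal.rpow_natCast, ← ENNReal.rpow_mul]; congr 1; push_cast; ring
    have h2 : (c * b * v) ^ (2 * σ) = ((c * b * v) ^ σ) ^ 2 := by
      rw [← ENNReal.rpow_natCast, ← ENNReal.rpow_mul]; congr 1; push_cast; ring
    rw [h1, h2, ENNReal.rpow_two, hD, ENNReal.mul_rpow_of_nonneg _ v hσ]
    ring
  rw [e2, ENNReal.pow_le_pow_left_iff two_ne_zero] at hsum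
  exact hsum

end Weighted

/-! ### From weighted `L²` estimates to `L^p` estimates -/

section LpSets

variable {X : Type*} [MeasurableSpace X] {μ : Measure X}

/-- Fatou along an almost everywhere convergent subsequence. Together with convexity this lets L^p
bounds pass through sums and Bochner integrals that converge in L². -/
theorem isClosed_setOf_eLpNorm_le (q C : ℝ≥0∞) :
    IsClosed {g : Lp ℂ 2 μ | eLpNorm g q μ ≤ C} := by
  refine IsSeqClosed.isClosed fun g g' hg hlim => ?_
  obtain ⟨ns, -, hns⟩ := (tendstoInMeasure_of_tendsto_Lp hlim).exists_seq_tendsto_ae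
  refine (Lp.eLpNorm_lim_le_liminf_eLpNorm (fun k => Lp.aestronglyMeasurable (g (ns k))) g'
    hns).trans ?_
  exact Filter.liminf_le_of_le (by isBoundedDefault) fun b hb => by
    obtain ⟨k, hk⟩ := hb.exists
    exact hk.trans (hg (ns k))

theorem convex_setOf_eLpNorm_le {q : ℝ≥0∞} (hq : 1 ≤ q) (C : ℝ≥0∞) :
    Convex ℝ {g : Lp ℂ 2 μ | eLpNorm g q μ ≤ C} := by
  intro g hg g' hg' s t hs ht hst
  have e : (s • g + t • g' : Lp ℂ 2 μ) =ᵐ[μ] (s • (g : X → ℂ) + t • (g' : X → ℂ)) := by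
    filter_upwards [Lp.coeFn_add (s • g) (t • g'), Lp.coeFn_smul s g, Lp.coeFn_smul t g'] with
      x h1 h2 h3
    rw [h1, Pi.add_apply, h2, h3]
    rfl
  rw [mem_ofPred_eq, eLpNorm_congr_ae e]
  refine (eLpNorm_add_le ((Lp.aestronglyMeasurable g).const_smul s)
    ((Lp.aestronglyMeasurable g').const_smul t) hq).trans ?_
  rw [eLpNorm_const_smul, eLpNorm_const_smul]
  have h1 : ‖s‖ₑ = ENNReal.ofReal s := Real.enorm_of_nonneg hs
  have h2 : ‖t‖ₑ = ENNReal.ofReal t := Real.enorm_of_nonneg ht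
  rw [h1, h2]
  calc ENNReal.ofReal s * eLpNorm g q μ + ENNReal.ofReal t * eLpNorm g' q μ
      ≤ ENNReal.ofReal s * C + ENNReal.ofReal t * C := by
        gcongr
        · exact hg
        · exact hg'
    _ = C := by rw [← add_mul, ← ENNReal.ofReal_add hs ht, hst, ENNReal.ofReal_one, one_mul]

/-- Hölder for Φ^{p-1} h^p = (Φh²)^{p/2} (Φ⁻¹)^{1-p/2}; the powers of V cancel. The surplus Φ^{p-1}
is what `sum_rpow_le_weight` spends on summing the pieces. -/
theorem lintegral_weight_mul_rpow_le {p : ℝ} (hp1 : 1 ≤ p) (hp2 : p < 2) {Φ h : X → ℝ≥0∞}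
    (hΦ : Measurable Φ) (hh : AEMeasurable h μ) (hΦ0 : ∀ z, Φ z ≠ 0) (hΦ1 : ∀ z, Φ z ≠ ∞)
    {a b V : ℝ≥0∞} (hV0 : V ≠ 0) (hV1 : V ≠ ∞)
    (h2 : ∫⁻ z, Φ z * h z ^ 2 ∂μ ≤ (a * V⁻¹ ^ (1 / p - 1 / 2)) ^ 2)
    (hk : ∫⁻ z, (Φ z)⁻¹ ∂μ ≤ b * V) :
    ∫⁻ z, Φ z ^ (p - 1) * h z ^ p ∂μ ≤ (a * b ^ (1 / p - 1 / 2)) ^ p := by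
  have hp0 : 0 < p := by linarith
  set σ := 1 / p - 1 / 2 with hσdef
  have hσ : 0 ≤ σ := sub_nonneg.2 (one_div_le_one_div_of_le hp0 hp2.le)
  have hσp : σ * p = 1 - p / 2 := by rw [hσdef]; field_simp
  have e : ∀ z, Φ z ^ (p - 1) * h z ^ p = (Φ z * h z ^ 2) ^ (p / 2) * ((Φ z)⁻¹) ^ (1 - p / 2) := by
    intro z
    rw [ENNReal.mul_rpow_of_nonneg _ _ (by linarith), ENNReal.inv_rpow, ← ENNReal.rpow_neg,
      ← ENNReal.rpow_natCast, ← ENNReal.rpow_mul, mul_right_comm,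
      ← ENNReal.rpow_add _ _ (hΦ0 z) (hΦ1 z)]
    congr 2
    · ring
    · push_cast; ring
  simp_rw [e]
  refine (ENNReal.lintegral_mul_norm_pow_le (hΦ.aemeasurable.mul (hh.pow_const 2))
    hΦ.inv.aemeasurable (by linarith) (by linarith) (by ring)).trans ?_
  calc (∫⁻ z, Φ z * h z ^ 2 ∂μ) ^ (p / 2) * (∫⁻ z, (Φ z)⁻¹ ∂μ) ^ (1 - p / 2)
      ≤ ((a * V⁻¹ ^ σ) ^ 2) ^ (p / 2) * (b * V) ^ (1 - p / 2) := by
        gcongr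
        linarith
    _ = (a * V⁻¹ ^ σ) ^ p * ((b * V) ^ σ) ^ p := by
        rw [← ENNReal.rpow_natCast, ← ENNReal.rpow_mul, ← ENNReal.rpow_mul, hσp]
        congr 2
        push_cast; ring
    _ = (a * b ^ σ) ^ p := by
        rw [← ENNReal.mul_rpow_of_nonneg _ _ hp0.le, ENNReal.mul_rpow_of_nonneg b V hσ]
        congr 1
        calc a * V⁻¹ ^ σ * (b ^ σ * V ^ σ) = a * b ^ σ * (V⁻¹ ^ σ * V ^ σ) := by ring
          _ = a * b ^ σ := by
            rw [← ENNReal.mul_rpow_of_nonneg _ _ hσ, ENNReal.inv_mul_cancel hV0 hV1,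
              ENNReal.one_rpow, mul_one]

/-- Hölder for h = Φ⁻¹ · Φh with Φ⁻¹ as the weight. -/
theorem sum_rpow_le_weight {ι : Type*} (S : Finset ι) {p : ℝ} (hp1 : 1 ≤ p) {Φ h : ι → ℝ≥0∞}
    (hΦ0 : ∀ i, Φ i ≠ 0) (hΦ1 : ∀ i, Φ i ≠ ∞) {C : ℝ≥0∞} (hC : ∑ i ∈ S, (Φ i)⁻¹ ≤ C) :
    (∑ i ∈ S, h i) ^ p ≤ C ^ (p - 1) * ∑ i ∈ S, Φ i ^ (p - 1) * h i ^ p := by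
  have hp0 : 0 < p := by linarith
  have h1 := ENNReal.inner_le_weight_mul_Lp_of_nonneg S hp1 (fun i => (Φ i)⁻¹)
    (fun i => Φ i * h i)
  have e1 : ∀ i, (Φ i)⁻¹ * (Φ i * h i) = h i := fun i => by
    rw [← mul_assoc, ENNReal.inv_mul_cancel (hΦ0 i) (hΦ1 i), one_mul]
  have e2 : ∀ i, (Φ i)⁻¹ * (Φ i * h i) ^ p = Φ i ^ (p - 1) * h i ^ p := fun i => by
    rw [ENNReal.mul_rpow_of_nonneg _ _ hp0.le, ← mul_assoc, ← ENNReal.rpow_neg_one,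
      ← ENNReal.rpow_add _ _ (hΦ0 i) (hΦ1 i), neg_add_eq_sub]
  simp_rw [e1, e2] at h1
  calc (∑ i ∈ S, h i) ^ p ≤ ((∑ i ∈ S, (Φ i)⁻¹) ^ (1 - p⁻¹) *
        (∑ i ∈ S, Φ i ^ (p - 1) * h i ^ p) ^ p⁻¹) ^ p := by gcongr
    _ = (∑ i ∈ S, (Φ i)⁻¹) ^ (p - 1) * ∑ i ∈ S, Φ i ^ (p - 1) * h i ^ p := by
        rw [ENNReal.mul_rpow_of_nonneg _ _ hp0.le, ← ENNReal.rpow_mul, ← ENNReal.rpow_mul,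
          inv_mul_cancel₀ hp0.ne', ENNReal.rpow_one, sub_mul, inv_mul_cancel₀ hp0.ne', one_mul]
    _ ≤ _ := by gcongr

end LpSets

section WeightedToLp

variable {X : Type*} [MetricSpace X] [MeasurableSpace X] [BorelSpace X] {μ : Measure X} {n : ℝ}

/-- Weighted `L²` bounds for the pieces of a function, localised at one scale, give `L^p`
bounds. -/
theorem exists_eLpNorm_le_of_weighted (hμ : IsHomogeneousType μ n) (hn : 0 < n)
    {p m : ℝ} (hp1 : 1 ≤ p) (hp2 : p < 2) (hm : n < m) :
    ∃ C : ℝ≥0, ∀ ρ : ℝ, 0 < ρ → ∀ (P : BallPartition X ρ) (T : Lp ℂ 2 μ →L[ℂ] Lp ℂ 2 μ)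
      (M : ℝ≥0∞) (f : Lp ℂ 2 μ),
      (∀ i : P.centers, ∫⁻ z, ENNReal.ofReal ((1 + dist z i / ρ) ^ m) *
        ‖T (indOp (P.cell i) (P.measurableSet_cell i) f) z‖ₑ ^ 2 ∂μ ≤
        (M * eLpNorm f (ENNReal.ofReal p) (μ.restrict (P.cell i)) *
          (μ (ball (i : X) ρ))⁻¹ ^ (1 / p - 1 / 2)) ^ 2) →
      eLpNorm (T f) (ENNReal.ofReal p) μ ≤ C * M * eLpNorm f (ENNReal.ofReal p) μ := by
  obtain ⟨C0, hC0⟩ := exists_tsum_centers_le hμ hn (sub_pos.2 hm)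
  obtain ⟨C1, hC1⟩ := exists_lintegral_decay_le hμ hn (sub_pos.2 hm)
  have hp0 : 0 < p := by linarith
  set σ := 1 / p - 1 / 2 with hσdef
  have hσ : 0 ≤ σ := sub_nonneg.2 (one_div_le_one_div_of_le hp0 hp2.le)
  have hp' : 0 ≤ (p - 1) / p := div_nonneg (by linarith) hp0.le
  set D : ℝ≥0∞ := (C0 : ℝ≥0∞) ^ ((p - 1) / p) * (C1 : ℝ≥0∞) ^ σ with hD
  have hDtop : D ≠ ∞ := ENNReal.mul_ne_top (ENNReal.rpow_ne_top_of_nonneg hp' ENNReal.coe_ne_top)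
    (ENNReal.rpow_ne_top_of_nonneg hσ ENNReal.coe_ne_top)
  refine ⟨D.toNNReal, fun ρ hρ P T M f hT => ?_⟩
  rw [ENNReal.coe_toNNReal hDtop]
  have hnm : n + (m - n) = m := by ring
  rw [hnm] at hC0 hC1
  have hbase : ∀ (z : X) (i : X), 0 < 1 + dist z i / ρ := fun z i => by positivity
  set Φ : P.centers → X → ℝ≥0∞ := fun i z => ENNReal.ofReal ((1 + dist z i / ρ) ^ m) with hΦ
  have hΦinv : ∀ i z, (Φ i z)⁻¹ = ENNReal.ofReal ((1 + dist z i / ρ) ^ (-m)) := fun i z => by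
    rw [hΦ, Real.rpow_neg (hbase z i).le, ENNReal.ofReal_inv_of_pos (Real.rpow_pos_of_pos
      (hbase z i) m)]
  have hΦ0 : ∀ i z, Φ i z ≠ 0 := fun i z => by
    simpa [hΦ] using Real.rpow_pos_of_pos (hbase z i) m
  have hΦ1 : ∀ i z, Φ i z ≠ ∞ := fun i z => ENNReal.ofReal_ne_top
  have hΦm : ∀ i, Measurable (Φ i) := fun i => by
    refine ENNReal.measurable_ofReal.comp ?_
    have : Continuous fun z : X => (1 + dist z i / ρ) ^ m :=
      Continuous.rpow_const (by fun_prop) fun z => Or.inl (hbase z i).ne'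
    exact this.measurable
  set g : P.centers → Lp ℂ 2 μ := fun i => T (indOp (P.cell i) (P.measurableSet_cell i) f) with hg
  have hloc : ∀ i, ∫⁻ z, Φ i z ^ (p - 1) * ‖g i z‖ₑ ^ p ∂μ ≤
      (M * eLpNorm f (ENNReal.ofReal p) (μ.restrict (P.cell i)) * (C1 : ℝ≥0∞) ^ σ) ^ p := fun i =>
    lintegral_weight_mul_rpow_le hp1 hp2 (hΦm i) (Lp.aestronglyMeasurable (g i)).enorm (hΦ0 i)
      (hΦ1 i) (hμ.volume_pos i ρ hρ).ne' (hμ.volume_lt_top i ρ hρ).ne (hT i) (by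
        simp_rw [hΦinv]
        exact hC1 ρ hρ i)
  -- The bound is uniform over finite sums of pieces, and closedness of L^p balls in L² carries it
  -- to `T f`.
  have hfin : ∀ S : Finset P.centers, eLpNorm (∑ i ∈ S, g i : Lp ℂ 2 μ) (ENNReal.ofReal p) μ ≤
      D * M * eLpNorm f (ENNReal.ofReal p) μ := by
    intro S
    rw [← ENNReal.rpow_le_rpow_iff hp0, eLpNorm_rpow_eq_lintegral hp0]
    calc ∫⁻ z, ‖(∑ i ∈ S, g i : Lp ℂ 2 μ) z‖ₑ ^ p ∂μ
        ≤ ∫⁻ z, (C0 : ℝ≥0∞) ^ (p - 1) * ∑ i ∈ S, Φ i z ^ (p - 1) * ‖g i z‖ₑ ^ p ∂μ := by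
          refine lintegral_mono_ae ?_
          filter_upwards [Lp.coeFn_finsetSum S g] with z hz
          rw [hz, Finset.sum_apply]
          refine le_trans (ENNReal.rpow_le_rpow (enorm_sum_le _ _) hp0.le) ?_
          refine sum_rpow_le_weight S hp1 (fun i => hΦ0 i z) (fun i => hΦ1 i z) ?_
          refine (ENNReal.sum_le_tsum S).trans ?_
          simp_rw [hΦinv]
          exact hC0 ρ hρ P z
      _ = (C0 : ℝ≥0∞) ^ (p - 1) * ∑ i ∈ S, ∫⁻ z, Φ i z ^ (p - 1) * ‖g i z‖ₑ ^ p ∂μ := by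
          have hmeas : ∀ i ∈ S, AEMeasurable (fun z => Φ i z ^ (p - 1) * ‖g i z‖ₑ ^ p) μ :=
            fun i _ => ((hΦm i).aemeasurable.pow_const _).mul
              ((Lp.aestronglyMeasurable (g i)).enorm.pow_const _)
          rw [lintegral_const_mul'' _ (Finset.aemeasurable_fun_sum S hmeas),
            lintegral_finsetSum' S hmeas]
      _ ≤ (C0 : ℝ≥0∞) ^ (p - 1) * ∑' i, (M * eLpNorm f (ENNReal.ofReal p)
            (μ.restrict (P.cell i)) * (C1 : ℝ≥0∞) ^ σ) ^ p := by
          gcongr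
          exact (Finset.sum_le_sum fun i _ => hloc i).trans (ENNReal.sum_le_tsum S)
      _ = (D * M * eLpNorm f (ENNReal.ofReal p) μ) ^ p := by
          have e : ∀ i : P.centers, (M * eLpNorm f (ENNReal.ofReal p) (μ.restrict (P.cell i)) *
              (C1 : ℝ≥0∞) ^ σ) ^ p = (M * (C1 : ℝ≥0∞) ^ σ) ^ p *
                eLpNorm f (ENNReal.ofReal p) (μ.restrict (P.cell i)) ^ p := fun i => by
            rw [← ENNReal.mul_rpow_of_nonneg _ _ hp0.le]
            congr 1
            ring
          simp_rw [e]
          rw [ENNReal.tsum_mul_left,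
            tsum_eLpNorm_rpow_restrict P.measurableSet_cell P.disjoint P.iUnion_cell hp0,
            ← ENNReal.mul_rpow_of_nonneg _ _ hp0.le]
          have e2 : (C0 : ℝ≥0∞) ^ (p - 1) = ((C0 : ℝ≥0∞) ^ ((p - 1) / p)) ^ p := by
            rw [← ENNReal.rpow_mul, div_mul_cancel₀ _ hp0.ne']
          rw [e2, ← ENNReal.mul_rpow_of_nonneg _ _ hp0.le, hD]
          congr 1
          ring
  have hsum := (hasSum_indOp P.measurableSet_cell P.disjoint P.iUnion_cell f).mapL T
  exact (isClosed_setOf_eLpNorm_le (μ := μ) (ENNReal.ofReal p) _).mem_of_tendsto hsum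
    (Filter.Eventually.of_forall hfin)

/-- The truncated distance weights. -/
def distWeight {τ : ℝ} (P : BallPartition X τ) (R : ℝ) (w : X) (N : ℕ) (i : P.centers) : ℝ :=
  R + min (dist (i : X) w / τ) N

end WeightedToLp

/-! ### Truncated distance weights and removal of the truncation. -/

section DistWeight

variable {X : Type*} [MetricSpace X] [MeasurableSpace X] {μ : Measure X}
  {τ R : ℝ} {P : BallPartition X τ} {w : X} {N : ℕ}

theorem le_distWeight (hτ : 0 < τ) (i : P.centers) : R ≤ distWeight P R w N i := by
  rw [distWeight]
  have : 0 ≤ min (dist (i : X) w / τ) (N : ℝ) := by positivity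
  linarith

theorem distWeight_le (i : P.centers) : distWeight P R w N i ≤ R + dist (i : X) w / τ := by
  rw [distWeight]
  gcongr
  exact min_le_left _ _

theorem abs_distWeight_le (hR : 0 ≤ R) (hτ : 0 < τ) (i : P.centers) :
    |distWeight P R w N i| ≤ R + N := by
  rw [abs_of_nonneg (hR.trans (le_distWeight hτ i)), distWeight]
  gcongr
  exact min_le_right _ _

theorem abs_distWeight_sub_le (hτ : 0 < τ) (i l : P.centers) :
    |distWeight P R w N i - distWeight P R w N l| ≤ dist (i : X) l / τ := by
  have e : distWeight P R w N i - distWeight P R w N l =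
      min (dist (i : X) w / τ) N - min (dist (l : X) w / τ) N := by
    rw [distWeight, distWeight]; ring
  rw [e]
  refine (abs_min_sub_min_le_max _ _ _ _).trans (max_le ?_ ?_)
  · rw [← sub_div, abs_div, abs_of_pos hτ]
    gcongr
    exact abs_dist_sub_le _ _ _
  · rw [sub_self, abs_zero]; positivity

/-- Removes the truncation of the distance weights. -/
theorem lintegral_dist_rpow_le [BorelSpace X] (hτ : 0 < τ) (hR : 1 ≤ R) {κ : ℕ} {u : Lp ℂ 2 μ}
    {b : ℝ≥0∞} (hu : ∀ N : ℕ,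
      ‖(P.weightOp (distWeight P R w N) (abs_distWeight_le (zero_le_one.trans hR) hτ) ^ κ) u‖ₑ
        ≤ ENNReal.ofReal (R ^ κ) * b) :
    ∫⁻ z, ENNReal.ofReal ((1 + dist z w / (R * τ)) ^ (2 * κ : ℝ)) * ‖u z‖ₑ ^ 2 ∂μ ≤
      (2 ^ κ * b) ^ 2 := by
  have hR0 : 0 < R := by linarith
  set φ : ℕ → X → ℝ≥0∞ := fun N z =>
    ENNReal.ofReal ((1 + min (dist z w / τ) N / R) ^ κ) ^ 2 * ‖u z‖ₑ ^ 2 with hφ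
  -- At each point the truncation is inactive for large N, so Fatou's lemma yields the untruncated
  -- integral.
  have hlim : ∀ z, ENNReal.ofReal ((1 + dist z w / (R * τ)) ^ (2 * κ : ℝ)) * ‖u z‖ₑ ^ 2 =
      Filter.liminf (fun N => φ N z) Filter.atTop := by
    intro z
    refine (Filter.Tendsto.liminf_eq (tendsto_const_nhds.congr' ?_)).symm
    obtain ⟨N0, hN0⟩ := exists_nat_ge (dist z w / τ)
    filter_upwards [Filter.eventually_ge_atTop N0] with N hN
    have hN' : dist z w / τ ≤ N := hN0.trans (by exact_mod_cast hN)
    have e1 : dist z w / τ / R = dist z w / (R * τ) := by rw [div_div, mul_comm]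
    have e2 : (2 * κ : ℝ) = ((κ * 2 : ℕ) : ℝ) := by push_cast; ring
    simp only [hφ]
    rw [min_eq_left hN', e1, ← ENNReal.ofReal_pow (by positivity), ← pow_mul, e2,
      Real.rpow_natCast]
  have hbound : ∀ N, ∫⁻ z, φ N z ∂μ ≤ (2 ^ κ * b) ^ 2 := by
    intro N
    set γ := distWeight P R w N with hγ
    set v := (P.weightOp γ (abs_distWeight_le (zero_le_one.trans hR) hτ) ^ κ) u with hv
    have h1 : ∫⁻ z, φ N z ∂μ ≤ ∫⁻ z, ENNReal.ofReal ((2 / R) ^ κ) ^ 2 * ‖v z‖ₑ ^ 2 ∂μ := by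
      refine lintegral_mono_ae ?_
      filter_upwards [coeFn_weightOp_pow
        (hC := abs_distWeight_le (zero_le_one.trans hR) hτ) κ u] with z hz
      simp only [hφ]
      rw [hv, hz, ← mul_pow, ← mul_pow]
      refine pow_le_pow_left₀ zero_le ?_ 2
      have hγ0 : R ≤ γ (P.idx z) := le_distWeight hτ _
      rw [enorm_mul, ← mul_assoc]
      refine mul_le_mul_left ?_ _
      rw [← ofReal_norm, Complex.norm_real,
        Real.norm_of_nonneg (pow_nonneg (hR0.le.trans hγ0) κ), ← ENNReal.ofReal_mul (by positivity)]
      refine ENNReal.ofReal_le_ofReal ?_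
      rw [← mul_pow]
      refine pow_le_pow_left₀ (by positivity) ?_ κ
      have hdz : dist z (P.idx z) < τ := P.cell_subset _ (P.mem_cell_idx z)
      have hd : dist z w / τ ≤ 1 + dist (P.idx z : X) w / τ := by
        rw [div_le_iff₀ hτ, add_mul, div_mul_cancel₀ _ hτ.ne', one_mul]
        linarith [dist_triangle z (P.idx z : X) w]
      have hmin : min (dist z w / τ) (N : ℝ) ≤ 1 + min (dist (P.idx z : X) w / τ) N := by
        rw [← min_add_add_left]
        exact min_le_min hd (by linarith)
      -- Moving from z to the center of its cell changes d/τ by at most 1 ≤ R, hence the factor 2.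
      have h2γ : R + min (dist z w / τ) (N : ℝ) ≤ 2 * γ (P.idx z) := by
        have : γ (P.idx z) = R + min (dist (P.idx z : X) w / τ) N := rfl
        linarith
      calc 1 + min (dist z w / τ) (N : ℝ) / R = (R + min (dist z w / τ) (N : ℝ)) / R := by
            field_simp
        _ ≤ 2 * γ (P.idx z) / R := by gcongr
        _ = 2 / R * γ (P.idx z) := by ring
    refine h1.trans ?_
    rw [lintegral_const_mul'' _ ((Lp.aestronglyMeasurable v).enorm.pow_const 2),
      ← eLpNorm_two_sq_eq_lintegral, ← Lp.enorm_def, ← mul_pow]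
    refine pow_le_pow_left₀ zero_le ((mul_le_mul_right (hu N) _).trans (le_of_eq ?_)) 2
    rw [← mul_assoc, ← ENNReal.ofReal_mul (by positivity), ← mul_pow,
      div_mul_cancel₀ _ hR0.ne', ENNReal.ofReal_pow (by norm_num), ENNReal.ofReal_ofNat]
  simp_rw [hlim]
  refine (lintegral_liminf_le' fun N => ?_).trans ?_
  · have : Continuous fun z : X => (1 + min (dist z w / τ) (N : ℝ) / R) ^ κ := by fun_prop
    exact ((ENNReal.measurable_ofReal.comp this.measurable).aemeasurable.pow_const 2).mul
      ((Lp.aestronglyMeasurable u).enorm.pow_const 2)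
  · exact Filter.liminf_le_of_le (by isBoundedDefault) fun c hc => by
      obtain ⟨N, hN⟩ := hc.exists
      exact hN.trans (hbound N)

end DistWeight

/-! ### `L^p` bounds for the unitary groups generated by functions of an operator -/

/-- `F` is the inverse Fourier transform of the rapidly decreasing function `Fh`. -/
structure IsFourierSymbol (F Fh : ℝ → ℂ) : Prop where
  integrable : Integrable Fh
  eq_integral : ∀ x : ℝ,
    F x = ∫ ξ, Fh ξ * Complex.exp (Complex.I * (2 * Real.pi * ξ : ℝ) * x)
  integrable_mul : ∀ (D : ℝ) (κ : ℕ),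
    Integrable fun ξ => ‖Fh ξ‖ * (1 + D * (2 * Real.pi * |ξ|)) ^ κ

namespace ProjectionMeasure

variable {H : Type*} [NormedAddCommGroup H] [InnerProductSpace ℂ H] [CompleteSpace H]

/-- Weighted bounds for the unitary group generated by `h(A)`, `A = ∫ v dE`, at times up to the
size of the lower bound `R` of the weight. -/
theorem norm_pow_group_comp_le {E : ProjectionMeasure H} {v : ℝ → ℝ} (hv : Measurable v)
    (hv1 : ∀ l, |v l| ≤ 1) {M : H →L[ℂ] H} {κ : ℕ} {D R : ℝ} (hD0 : 0 ≤ D) (hR : 1 ≤ R)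
    (hD : ∀ k, k + 1 ≤ κ → ∀ u : H, ‖(M ^ (k + 1)) (E.integral (fun l => (v l : ℂ)) u) -
      E.integral (fun l => (v l : ℂ)) ((M ^ (k + 1)) u)‖ ≤ D * ‖(M ^ k) u‖)
    (hM : ∀ (k : ℕ) (u : H), R * ‖(M ^ k) u‖ ≤ ‖(M ^ (k + 1)) u‖)
    {h : ℝ → ℝ} {ω hh ωh : ℝ → ℂ} {Ch : ℝ} (hhm : Measurable h) (hhC : ∀ x, |h x| ≤ Ch)
    (hhs : IsFourierSymbol (fun x => (h x : ℂ)) hh) (hωs : IsFourierSymbol ω ωh)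
    {t : ℝ} (htR : |t| ≤ R) (u : H) :
    ‖(M ^ κ) (E.group (fun l => h (v l)) t (E.integral (fun l => ω (v l)) u))‖ ≤
      (1 + ∫ ξ, ‖hh ξ‖ * (1 + D * (2 * Real.pi * |ξ|)) ^ κ) ^ κ *
        (∫ ξ, ‖ωh ξ‖ * (1 + D * (2 * Real.pi * |ξ|)) ^ κ) * ‖(M ^ κ) u‖ := by
  have hR0 : 0 < R := by linarith
  have hI : 0 ≤ ∫ ξ, ‖hh ξ‖ * (1 + D * (2 * Real.pi * |ξ|)) ^ κ :=
    integral_nonneg fun ξ => by positivity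
  have hM1 : ∀ (k : ℕ) u, ‖(M ^ k) u‖ ≤ ‖(M ^ (k + 1)) u‖ := fun k u =>
    (le_mul_of_one_le_left (norm_nonneg _) hR).trans (hM k u)
  -- h(A) inherits the commutator property of A, so the Duhamel argument runs a second time, now for
  -- e^{ith(A)}; |t| ≤ R keeps the resulting factor bounded.
  have hcomm : ∀ k, k + 1 ≤ κ → ∀ u : H,
      ‖(M ^ (k + 1)) (E.integral (fun l => (h (v l) : ℂ)) u) -
        E.integral (fun l => (h (v l) : ℂ)) ((M ^ (k + 1)) u)‖ ≤
      (∫ ξ, ‖hh ξ‖ * (1 + D * (2 * Real.pi * |ξ|)) ^ κ) * ‖(M ^ k) u‖ := fun k hk u =>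
    norm_commutator_integral_comp_le (F := fun x => (h x : ℂ)) hv hv1 hD0 hD hM1 hhs.integrable
      (fun l => hhs.eq_integral (v l)) (hhs.integrable_mul D κ) k hk u
  have h1 := norm_pow_group_le (E := E) (g := fun l => h (v l)) (hhm.comp hv)
    (fun l => hhC (v l)) hI hR0 hcomm hM t κ le_rfl (E.integral (fun l => ω (v l)) u)
  have h2 := norm_pow_integral_comp_le (F := ω) hv hv1 hD0 hD hM1 hωs.integrable
      (fun l => hωs.eq_integral (v l)) (hωs.integrable_mul D κ) u
  refine h1.trans ?_
  rw [mul_assoc]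
  refine mul_le_mul ?_ ?_ (norm_nonneg _) (by positivity)
  · refine pow_le_pow_left₀ (by positivity) ?_ κ
    rw [mul_div_assoc]
    gcongr
    exact mul_le_of_le_one_right hI ((div_le_one hR0).2 htR)
  · exact h2

end ProjectionMeasure

section GroupBound

variable {X : Type*} [MetricSpace X] [MeasurableSpace X] {μ : Measure X} {n : ℝ}

/-- Volumes of comparable balls in a space of homogeneous type. -/
theorem inv_measure_ball_le (hμ : IsHomogeneousType μ n) {c : ℝ≥0}
    (hc : ∀ (x : X) (r l : ℝ), 0 < r → 1 ≤ l →
      μ (ball x (l * r)) ≤ c * ENNReal.ofReal (l ^ n) * μ (ball x r))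
    {x y : X} {r s l : ℝ} (hr : 0 < r) (hs : 0 < s) (hl : 1 ≤ l) (hxy : dist x y + s ≤ l * r) :
    (μ (ball x r))⁻¹ ≤ c * ENNReal.ofReal (l ^ n) * (μ (ball y s))⁻¹ := by
  have h1 : μ (ball y s) ≤ c * ENNReal.ofReal (l ^ n) * μ (ball x r) :=
    (measure_mono (ball_subset_ball' (by rw [dist_comm]; linarith))).trans (hc x r l hr hl)
  have hx0 := (hμ.volume_pos x r hr).ne'
  have hx1 := (hμ.volume_lt_top x r hr).ne
  have hy0 := (hμ.volume_pos y s hs).ne'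
  have hy1 := (hμ.volume_lt_top y s hs).ne
  calc (μ (ball x r))⁻¹ = (μ (ball x r))⁻¹ * (μ (ball y s) * (μ (ball y s))⁻¹) := by
        rw [ENNReal.mul_inv_cancel hy0 hy1, mul_one]
    _ ≤ (μ (ball x r))⁻¹ * (c * ENNReal.ofReal (l ^ n) * μ (ball x r) * (μ (ball y s))⁻¹) := by
        gcongr
    _ = c * ENNReal.ofReal (l ^ n) * (μ (ball y s))⁻¹ * ((μ (ball x r))⁻¹ * μ (ball x r)) := by
        ring
    _ = c * ENNReal.ofReal (l ^ n) * (μ (ball y s))⁻¹ := by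
        rw [ENNReal.inv_mul_cancel hx0 hx1, mul_one]

theorem inter_nonempty_of_eLpNorm_indOp_ne_zero {X : Type*} [MeasurableSpace X]
    {μ : Measure X} {S S' : Set X} (hS : MeasurableSet S)
    (hS' : MeasurableSet S') {q : ℝ≥0∞} {f : Lp ℂ 2 μ}
    (h : eLpNorm (indOp S hS f) q (μ.restrict S') ≠ 0) : (S ∩ S').Nonempty := by
  by_contra hne
  rw [not_nonempty_iff_eq_empty] at hne
  refine h (eLpNorm_eq_zero_of_ae_zero ?_)
  filter_upwards [ae_restrict_of_ae (coeFn_indOp hS f), ae_restrict_mem hS'] with z h1 h2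
  rw [h1, indicator_of_notMem (fun hz => (hne ▸ ⟨hz, h2⟩ : z ∈ (∅ : Set X)))]
  rfl

/-- Weighted bounds, with distance weights of size at least `R`, for the unitary group generated
by `h(A)` at times up to `R`. -/
theorem exists_enorm_weightOp_pow_group_le [BorelSpace X] (hμ : IsHomogeneousType μ n) (hn : 0 < n)
    {p a : ℝ} {κ : ℕ} (hp1 : 1 ≤ p) (hp2 : p < 2) (hκ : κ < a) (K : ℝ≥0)
    {h : ℝ → ℝ} {ω hh ωh : ℝ → ℂ} {Ch : ℝ} (hhm : Measurable h) (hhC : ∀ x, |h x| ≤ Ch)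
    (hhs : IsFourierSymbol (fun x => (h x : ℂ)) hh) (hωs : IsFourierSymbol ω ωh) :
    ∃ C : ℝ≥0, ∀ τ : ℝ, 0 < τ → ∀ (E : ProjectionMeasure (Lp ℂ 2 μ)) (v : ℝ → ℝ),
      Measurable v → (∀ l, |v l| ≤ 1) → PVE n a p τ K (E.integral fun l => (v l : ℂ)) →
      ∀ (P : BallPartition X τ) (γ : P.centers → ℝ) (B : ℝ) (hB : ∀ i, |γ i| ≤ B) (R : ℝ),
        1 ≤ R → (∀ i, R ≤ γ i) → (∀ i l : P.centers, |γ i - γ l| ≤ dist (i : X) l / τ) →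
        ∀ t : ℝ, |t| ≤ R → ∀ u, ‖(P.weightOp γ hB ^ κ) (E.group (fun l => h (v l)) t
          (E.integral (fun l => ω (v l)) u))‖ₑ ≤ C * ‖(P.weightOp γ hB ^ κ) u‖ₑ := by
  obtain ⟨D, hD⟩ := exists_norm_commutator_weightOp_le hμ hn hp1 hp2 hκ K
  refine ⟨((1 + ∫ ξ, ‖hh ξ‖ * (1 + D * (2 * Real.pi * |ξ|)) ^ κ) ^ κ *
    (∫ ξ, ‖ωh ξ‖ * (1 + D * (2 * Real.pi * |ξ|)) ^ κ)).toNNReal,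
    fun τ hτ E v hv hv1 hA P γ B hB R hR1 hγ hγ' t ht u => ?_⟩
  have h1 := ProjectionMeasure.norm_pow_group_comp_le (E := E) hv hv1 D.2 hR1
    (fun k hk u => hD τ hτ _ (ProjectionMeasure.isSelfAdjoint_integral hv hv1) hA P γ B hB
      (fun i => hR1.trans (hγ i)) hγ' k hk u)
    (fun k u => norm_weightOp_pow_le_succ (zero_le_one.trans hR1) hγ k u) hhm hhC hhs hωs ht u
  rw [← ofReal_norm, ← ofReal_norm, ← ENNReal.ofReal_coe_nnreal, ← ENNReal.ofReal_mul NNReal.zero_le_coe]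
  refine ENNReal.ofReal_le_ofReal (h1.trans ?_)
  gcongr
  exact Real.le_coe_toNNReal _

/-- Polynomial growth on `L^p` of the unitary group generated by `h(A)`, after composition with
`ω(A) A`, for a self-adjoint operator `A` with polynomial off-diagonal bounds. -/
theorem exists_eLpNorm_group_le [BorelSpace X] [TopologicalSpace.SeparableSpace X]
    (hμ : IsHomogeneousType μ n) (hn : 0 < n)
    {p a : ℝ} {κ : ℕ} (hp1 : 1 ≤ p) (hp2 : p < 2) (hκ : κ < a) (hκn : n < 2 * κ) (K : ℝ≥0)
    {h : ℝ → ℝ} {ω hh ωh : ℝ → ℂ} {Ch : ℝ} (hhm : Measurable h) (hhC : ∀ x, |h x| ≤ Ch)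
    (hhs : IsFourierSymbol (fun x => (h x : ℂ)) hh) (hωs : IsFourierSymbol ω ωh) :
    ∃ C : ℝ≥0, ∀ τ : ℝ, 0 < τ → ∀ (E : ProjectionMeasure (Lp ℂ 2 μ)) (v : ℝ → ℝ),
      Measurable v → (∀ l, |v l| ≤ 1) → PVE n a p τ K (E.integral fun l => (v l : ℂ)) →
      ∀ (t : ℝ) (f : Lp ℂ 2 μ),
        eLpNorm (E.group (fun l => h (v l)) t (E.integral (fun l => ω (v l))
          (E.integral (fun l => (v l : ℂ)) f))) (ENNReal.ofReal p) μ ≤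
        C * ENNReal.ofReal ((1 + |t|) ^ (n * (1 / p - 1 / 2))) *
          eLpNorm f (ENNReal.ofReal p) μ := by
  obtain ⟨c, hc⟩ := hμ.doubling
  obtain ⟨D1, hweight⟩ := exists_enorm_weightOp_pow_group_le hμ hn hp1 hp2 hκ K hhm hhC hhs hωs
  obtain ⟨D3, hD3⟩ := exists_enorm_weightOp_pow_le hμ hn hp1 hp2 hκ K
  obtain ⟨C0, hC0⟩ := exists_eLpNorm_le_of_weighted hμ hn hp1 hp2 hκn
  have hp0 : 0 < p := by linarith
  have hσ : 0 ≤ 1 / p - 1 / 2 := sub_nonneg.2 (one_div_le_one_div_of_le hp0 hp2.le)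
  set σ := 1 / p - 1 / 2 with hσdef
  set B : ℝ≥0∞ := D1 * (D3 * ENNReal.ofReal (3 ^ κ) *
    (c * ENNReal.ofReal (3 ^ n)) ^ σ) with hB
  have hBtop : B ≠ ∞ := by
    refine ENNReal.mul_ne_top ENNReal.coe_ne_top (ENNReal.mul_ne_top (ENNReal.mul_ne_top
      ENNReal.coe_ne_top ENNReal.ofReal_ne_top) (ENNReal.rpow_ne_top_of_nonneg hσ
      (ENNReal.mul_ne_top ENNReal.coe_ne_top ENNReal.ofReal_ne_top)))
  have hCtop : C0 * (2 ^ κ * B) ≠ ∞ := ENNReal.mul_ne_top ENNReal.coe_ne_top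
    (ENNReal.mul_ne_top (ENNReal.pow_ne_top ENNReal.ofNat_ne_top) hBtop)
  refine ⟨(C0 * (2 ^ κ * B)).toNNReal, fun τ hτ E v hv hv1 hA t f => ?_⟩
  rw [ENNReal.coe_toNNReal hCtop]
  set A := E.integral fun l => (v l : ℂ) with hAdef
  set R : ℝ := 1 + |t| with hR
  have hR1 : 1 ≤ R := by rw [hR]; linarith [abs_nonneg t]
  have hR0 : 0 < R := by linarith
  -- Two scales: cells of size τ carry the weights and the blocks of A, while cells of size Rτ, the
  -- distance reached by time t, cut f into pieces.
  obtain ⟨P⟩ := BallPartition.nonempty X hτ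
  obtain ⟨P'⟩ := BallPartition.nonempty X (mul_pos hR0 hτ)
  set T : Lp ℂ 2 μ →L[ℂ] Lp ℂ 2 μ := E.group (fun l => h (v l)) t ∘L
    (E.integral (fun l => ω (v l)) ∘L A) with hT
  have key := hC0 (R * τ) (mul_pos hR0 hτ) P' T (2 ^ κ * (B * ENNReal.ofReal (R ^ (n * σ)))) f ?_
  · refine key.trans (le_of_eq ?_)
    ring
  intro w
  set fw := indOp (P'.cell w) (P'.measurableSet_cell w) f with hfw
  set V := μ (ball (w : X) (R * τ)) with hV
  have hmain := lintegral_dist_rpow_le (P := P) (w := w) (κ := κ) (u := T fw)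
    (b := B * ENNReal.ofReal (R ^ (n * σ)) * eLpNorm f (ENNReal.ofReal p)
      (μ.restrict (P'.cell w)) * V⁻¹ ^ σ) hτ hR1 ?_
  · refine hmain.trans (le_of_eq ?_)
    congr 1
    ring
  intro N
  have hγ1 : ∀ i, 1 ≤ distWeight P R (w : X) N i := fun i => hR1.trans (le_distWeight hτ i)
  have h2 := hweight τ hτ E v hv hv1 hA P (distWeight P R (w : X) N) _
    (abs_distWeight_le (zero_le_one.trans hR1) hτ) R hR1
    (le_distWeight hτ) (abs_distWeight_sub_le hτ) t (by rw [hR]; linarith) (A fw)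
  -- A cell l meeting the piece w has its center within 2Rτ of w. Its weight is thus at most R + 2R,
  -- and B(w, Rτ) ⊆ B(l, 3Rτ) gives V(l, τ)⁻¹ ≤ c(3R)^n V(w, Rτ)⁻¹. The power σ of R^n is the
  -- asserted growth.
  have h3 := hD3 τ hτ A hA P (distWeight P R (w : X) N) _ (abs_distWeight_le (zero_le_one.trans hR1) hτ) hγ1
    (abs_distWeight_sub_le hτ) fw (3 * R) (c * ENNReal.ofReal ((3 * R) ^ n) * V⁻¹) (by
      intro l hl
      obtain ⟨z, hz1, hz2⟩ := inter_nonempty_of_eLpNorm_indOp_ne_zero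
        (P'.measurableSet_cell w) (P.measurableSet_cell l) hl
      have hzw : dist z w < R * τ := P'.cell_subset _ hz1
      have hzl : dist z l < τ := P.cell_subset _ hz2
      have hτR : τ ≤ R * τ := le_mul_of_one_le_left hτ.le hR1
      have hlw : dist (l : X) w ≤ 2 * R * τ := by
        linarith [dist_triangle_left (l : X) w z]
      refine ⟨(distWeight_le l).trans ?_, inv_measure_ball_le hμ hc hτ (mul_pos hR0 hτ)
        (by linarith) (by linarith)⟩
      have : dist (l : X) w / τ ≤ 2 * R := by rwa [div_le_iff₀ hτ]
      linarith)
  refine (h2.trans (mul_le_mul_right h3 _)).trans (le_of_eq ?_)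
  have e1 : ENNReal.ofReal ((3 * R) ^ κ) = ENNReal.ofReal (3 ^ κ) * ENNReal.ofReal (R ^ κ) := by
    rw [mul_pow, ENNReal.ofReal_mul (by positivity)]
  have e2 : (c * ENNReal.ofReal ((3 * R) ^ n) * V⁻¹) ^ σ =
      (c * ENNReal.ofReal (3 ^ n)) ^ σ * ENNReal.ofReal (R ^ (n * σ)) * V⁻¹ ^ σ := by
    rw [Real.mul_rpow (by norm_num) hR0.le, ENNReal.ofReal_mul (by positivity), ← mul_assoc,
      ENNReal.mul_rpow_of_nonneg _ _ hσ, ENNReal.mul_rpow_of_nonneg _ _ hσ,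
      ENNReal.ofReal_rpow_of_pos (Real.rpow_pos_of_pos hR0 n), ← Real.rpow_mul hR0.le]
  rw [e1, e2, hfw, eLpNorm_indOp, hB]
  ring

end GroupBound

/-! ### Integration over the unitary group -/

section IntegrateGroup

/-- Minkowski's inequality for a Bochner integral in L². Divided by ρ, the integrand stays in a
closed convex set, which therefore contains its average against ρ dξ; no jointly measurable
representatives enter. -/
theorem eLpNorm_integral_le {X : Type*} [MeasurableSpace X] {μ : Measure X}
    {V : ℝ → Lp ℂ 2 μ} (hV : Integrable V) {q : ℝ≥0∞} (hq : 1 ≤ q) {ρ : ℝ → ℝ≥0}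
    (hρ : Measurable ρ) (hρi : ∫⁻ ξ, ρ ξ ≠ ∞) {B : ℝ≥0∞}
    (hb : ∀ ξ, eLpNorm (V ξ) q μ ≤ ρ ξ * B) :
    eLpNorm (∫ ξ, V ξ : Lp ℂ 2 μ) q μ ≤ (∫⁻ ξ, ρ ξ) * B := by
  have hq0 : q ≠ 0 := (zero_lt_one.trans_le hq).ne'
  have hV0 : ∀ ξ, ρ ξ = 0 → V ξ = 0 := fun ξ h0 => by
    have h1 := hb ξ
    rw [h0, ENNReal.coe_zero, zero_mul, nonpos_iff_eq_zero,
      eLpNorm_eq_zero_iff (Lp.aestronglyMeasurable _) hq0] at h1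
    exact (Lp.eq_zero_iff_ae_eq_zero).2 h1
  by_cases hN : ∫⁻ ξ, (ρ ξ : ℝ≥0∞) = 0
  · have h0 : V =ᵐ[volume] 0 := by
      filter_upwards [(lintegral_eq_zero_iff hρ.coe_nnreal_ennreal).1 hN] with ξ hξ
      exact hV0 ξ (by simpa using hξ)
    rw [integral_congr_ae h0]
    simp only [Pi.zero_apply, integral_zero]
    rw [eLpNorm_congr_ae (Lp.coeFn_zero ℂ 2 μ), eLpNorm_zero]
    exact zero_le
  set ν : Measure ℝ := volume.withDensity fun ξ => (ρ ξ : ℝ≥0∞) with hν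
  have hνu : ν univ = ∫⁻ ξ, ρ ξ := by rw [hν, withDensity_apply _ .univ, setLIntegral_univ]
  have : IsFiniteMeasure ν := ⟨by rw [hνu]; exact hρi.lt_top⟩
  have : NeZero ν := ⟨fun h => hN (by rw [← hνu, h, Measure.coe_zero, Pi.zero_apply])⟩
  have hsm : (fun ξ => ρ ξ • ((ρ ξ)⁻¹ • V ξ)) = V := by
    funext ξ
    by_cases h0 : ρ ξ = 0
    · rw [hV0 ξ h0, smul_zero, smul_zero]
    · rw [smul_smul, mul_inv_cancel₀ h0, one_smul]
  have hint : Integrable (fun ξ => (ρ ξ)⁻¹ • V ξ) ν := by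
    rw [hν, integrable_withDensity_iff_integrable_smul hρ, hsm]
    exact hV
  have hI : ∫ ξ, (ρ ξ)⁻¹ • V ξ ∂ν = ∫ ξ, V ξ := by
    rw [hν, integral_withDensity_eq_integral_smul hρ, hsm]
  have hmem : (⨍ ξ, (ρ ξ)⁻¹ • V ξ ∂ν) ∈ {g : Lp ℂ 2 μ | eLpNorm g q μ ≤ B} := by
    refine (convex_setOf_eLpNorm_le hq B).average_mem (isClosed_setOf_eLpNorm_le q B)
      (Filter.Eventually.of_forall fun ξ => ?_) hint
    by_cases h0 : ρ ξ = 0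
    · rw [mem_ofPred_eq, hV0 ξ h0, smul_zero, eLpNorm_congr_ae (Lp.coeFn_zero ℂ 2 μ), eLpNorm_zero]
      exact zero_le
    · rw [mem_ofPred_eq, NNReal.smul_def, eLpNorm_congr_ae (Lp.coeFn_smul _ _),
        eLpNorm_const_smul, Real.enorm_of_nonneg NNReal.zero_le_coe, ENNReal.ofReal_coe_nnreal]
      calc (((ρ ξ)⁻¹ : ℝ≥0) : ℝ≥0∞) * eLpNorm (V ξ) q μ ≤ ((ρ ξ)⁻¹ : ℝ≥0) * (ρ ξ * B) :=
            mul_le_mul' le_rfl (hb ξ)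
        _ = B := by
            rw [← mul_assoc, ← ENNReal.coe_mul, inv_mul_cancel₀ h0, ENNReal.coe_one, one_mul]
  rw [average_eq, hI] at hmem
  have hr : ν.real univ ≠ 0 := measureReal_univ_ne_zero
  have e : (∫ ξ, V ξ : Lp ℂ 2 μ) = ν.real univ • ((ν.real univ)⁻¹ • ∫ ξ, V ξ) := by
    rw [smul_smul, mul_inv_cancel₀ hr, one_smul]
  rw [e, eLpNorm_congr_ae (Lp.coeFn_smul _ _), eLpNorm_const_smul]
  refine mul_le_mul' (le_of_eq ?_) hmem
  rw [Real.enorm_of_nonneg measureReal_nonneg, ofReal_measureReal, hνu]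

theorem IsFourierSymbol.norm_le {F Fh : ℝ → ℂ}
    (hF : ∀ x : ℝ, F x = ∫ ξ, Fh ξ * Complex.exp (Complex.I * (2 * Real.pi * ξ : ℝ) * x))
    (x : ℝ) : ‖F x‖ ≤ ∫ ξ, ‖Fh ξ‖ := by
  rw [hF]
  refine (norm_integral_le_integral_norm _).trans (le_of_eq ?_)
  congr 1
  funext ξ
  rw [norm_mul, ProjectionMeasure.norm_exp_I_mul, mul_one]

variable {X : Type*} [MetricSpace X] [MeasurableSpace X] [BorelSpace X] {μ : Measure X} {n : ℝ}

/-- `L^p` bounds for `G(h(A)) ω(A) A` in terms of the Fourier transform of `G`. -/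
theorem exists_eLpNorm_integral_comp_le [TopologicalSpace.SeparableSpace X]
    (hμ : IsHomogeneousType μ n) (hn : 0 < n)
    {p a : ℝ} {κ : ℕ} (hp1 : 1 ≤ p) (hp2 : p < 2) (hκ : κ < a) (hκn : n < 2 * κ) (K : ℝ≥0)
    {h : ℝ → ℝ} {ω hh ωh : ℝ → ℂ} {Ch : ℝ} (hhm : Measurable h) (hhC : ∀ x, |h x| ≤ Ch)
    (hhs : IsFourierSymbol (fun x => (h x : ℂ)) hh) (hωm : Measurable ω)
    (hωs : IsFourierSymbol ω ωh) :
    ∃ C : ℝ≥0, ∀ τ : ℝ, 0 < τ → ∀ (E : ProjectionMeasure (Lp ℂ 2 μ)) (v : ℝ → ℝ),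
      Measurable v → (∀ l, |v l| ≤ 1) → PVE n a p τ K (E.integral fun l => (v l : ℂ)) →
      ∀ G Gh : ℝ → ℂ, Measurable G → Measurable Gh → Integrable Gh →
        (∀ x : ℝ, G x = ∫ ξ, Gh ξ * Complex.exp (Complex.I * (2 * Real.pi * ξ : ℝ) * x)) →
        ∫⁻ ξ, ‖Gh ξ‖ₑ * ENNReal.ofReal ((1 + 2 * Real.pi * |ξ|) ^ (n * (1 / p - 1 / 2))) ≠ ∞ →
        ∀ f : Lp ℂ 2 μ,
          eLpNorm (E.integral (fun l => G (h (v l)) * (ω (v l) * v l)) f) (ENNReal.ofReal p) μ ≤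
          C * (∫⁻ ξ, ‖Gh ξ‖ₑ *
              ENNReal.ofReal ((1 + 2 * Real.pi * |ξ|) ^ (n * (1 / p - 1 / 2)))) *
            eLpNorm f (ENNReal.ofReal p) μ := by
  obtain ⟨C, hC⟩ := exists_eLpNorm_group_le hμ hn hp1 hp2 hκ hκn K hhm hhC hhs hωs
  refine ⟨C, fun τ hτ E v hv hv1 hA G Gh hG hGhm hGh hGG hfin f => ?_⟩
  set θ := n * (1 / p - 1 / 2) with hθ
  have hvm : Measurable fun l => (v l : ℂ) := by fun_prop
  have hvn : ∀ l, ‖(v l : ℂ)‖ ≤ 1 := fun l => by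
    rw [Complex.norm_real]; exact hv1 l
  have hωv : Measurable fun l => ω (v l) := hωm.comp hv
  have hωn : ∀ l, ‖ω (v l)‖ ≤ ∫ ξ, ‖ωh ξ‖ := fun l => IsFourierSymbol.norm_le hωs.eq_integral _
  have hGv : Measurable fun l => G (h (v l)) := hG.comp (hhm.comp hv)
  have hGn : ∀ l, ‖G (h (v l))‖ ≤ ∫ ξ, ‖Gh ξ‖ := fun l => IsFourierSymbol.norm_le hGG _
  have e : E.integral (fun l => G (h (v l)) * (ω (v l) * v l)) f =
      E.integral (fun l => G (h (v l))) (E.integral (fun l => ω (v l))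
        (E.integral (fun l => (v l : ℂ)) f)) := by
    rw [ProjectionMeasure.integral_mul (G := fun l => ω (v l) * v l) hGv (hωv.mul hvm) hGn
      (C' := (∫ ξ, ‖ωh ξ‖) * 1) (fun l => by
        rw [norm_mul]
        exact mul_le_mul (hωn l) (hvn l) (norm_nonneg _) (integral_nonneg fun _ => norm_nonneg _)),
      ProjectionMeasure.integral_mul hωv hvm hωn hvn]
    rfl
  obtain ⟨h1, h2⟩ := ProjectionMeasure.integral_comp_apply (E := E) (g := fun l => h (v l)) (F := G)
    (hhm.comp hv) (fun l => hhC (v l)) hGh (fun l => hGG (h (v l)))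
    (E.integral (fun l => ω (v l)) (E.integral (fun l => (v l : ℂ)) f))
  rw [e, h2]
  have hρ : ∀ ξ, ((‖Gh ξ‖₊ * ((1 + 2 * Real.pi * |ξ|) ^ θ).toNNReal : ℝ≥0) : ℝ≥0∞) =
      ‖Gh ξ‖ₑ * ENNReal.ofReal ((1 + 2 * Real.pi * |ξ|) ^ θ) := fun ξ => by
    rw [ENNReal.coe_mul]; rfl
  have hmeas : Measurable fun ξ : ℝ => (1 + 2 * Real.pi * |ξ|) ^ θ := by
    have : Measurable fun ξ : ℝ => |ξ| := measurable_abs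
    fun_prop
  have key := eLpNorm_integral_le (μ := μ) h1 (q := ENNReal.ofReal p)
    (by rw [← ENNReal.ofReal_one]; exact ENNReal.ofReal_le_ofReal hp1)
    (ρ := fun ξ => ‖Gh ξ‖₊ * ((1 + 2 * Real.pi * |ξ|) ^ θ).toNNReal)
    (hGhm.nnnorm.mul hmeas.real_toNNReal) (by simp_rw [hρ]; exact hfin)
    (B := C * eLpNorm f (ENNReal.ofReal p) μ) (fun ξ => ?_)
  · simp_rw [hρ] at key
    exact key.trans (le_of_eq (by ring))
  · rw [hρ, eLpNorm_congr_ae (Lp.coeFn_smul _ _), eLpNorm_const_smul]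
    refine (mul_le_mul_right (hC τ hτ E v hv hv1 hA (2 * Real.pi * ξ) f) _).trans (le_of_eq ?_)
    rw [abs_mul, abs_of_pos Real.two_pi_pos]
    ring

end IntegrateGroup

/-! ### Smooth symbols -/

section Symbols

open scoped ContDiff

/-- The inversion formula, in the form used for spectral integrals. -/
theorem eq_integral_fourier {F : ℝ → ℂ} (hF : Continuous F) (hFi : Integrable F)
    (hFh : Integrable (𝓕 F)) (x : ℝ) :
    F x = ∫ ξ, 𝓕 F ξ * Complex.exp (Complex.I * (2 * Real.pi * ξ : ℝ) * x) := by
  have h := congrFun (hF.fourierInv_fourier_eq hFi hFh) x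
  rw [Real.fourierInv_eq'] at h
  rw [← h]
  congr 1
  funext ξ
  rw [smul_eq_mul, mul_comm]
  congr 2
  simp only [RCLike.inner_apply, conj_trivial]
  push_cast
  ring

theorem isFourierSymbol_of_contDiff {F : ℝ → ℂ} (hF : ContDiff ℝ ∞ F) (hFc : HasCompactSupport F) :
    IsFourierSymbol F (𝓕 F) := by
  set S := hFc.toSchwartzMap hF with hS
  have hSF : (S : ℝ → ℂ) = F := rfl
  have hSh : ((𝓕 S : SchwartzMap ℝ ℂ) : ℝ → ℂ) = 𝓕 F := by rw [SchwartzMap.fourier_coe, hSF]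
  have hint : Integrable (𝓕 F) := hSh ▸ (𝓕 S : SchwartzMap ℝ ℂ).integrable
  refine ⟨hint, eq_integral_fourier hF.continuous (hSF ▸ S.integrable) hint, fun D κ => ?_⟩
  have e : (fun ξ : ℝ => ‖𝓕 F ξ‖ * (1 + D * (2 * Real.pi * |ξ|)) ^ κ) = fun ξ : ℝ =>
      ∑ m ∈ Finset.range (κ + 1), ((D * (2 * Real.pi)) ^ (κ - m) * (κ.choose m)) *
        (‖ξ‖ ^ (κ - m) * ‖𝓕 F ξ‖) := by
    funext ξ
    rw [add_pow, Finset.mul_sum]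
    refine Finset.sum_congr rfl fun m _ => ?_
    rw [one_pow, one_mul, Real.norm_eq_abs, ← mul_assoc D, mul_pow]
    ring
  rw [e]
  refine integrable_finsetSum _ fun m _ => Integrable.const_mul ?_ _
  have := (𝓕 S : SchwartzMap ℝ ℂ).integrable_pow_mul volume (κ - m)
  rwa [hSh] at this

/-- A smooth positive function that equals the identity on `[e⁻¹, ∞)`. -/
def posIdentity (x : ℝ) : ℝ :=
  Real.exp (-2) + (x - Real.exp (-2)) *
    Real.smoothTransition ((x - Real.exp (-2)) / (Real.exp (-1) - Real.exp (-2)))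

theorem exp_neg_two_lt : Real.exp (-2) < Real.exp (-1) := Real.exp_lt_exp.2 (by norm_num)

theorem contDiff_posIdentity : ContDiff ℝ ∞ posIdentity := by
  unfold posIdentity
  have h : ContDiff ℝ ∞ Real.smoothTransition := Real.smoothTransition.contDiff
  exact contDiff_const.add ((contDiff_id.sub contDiff_const).mul
    (h.comp ((contDiff_id.sub contDiff_const).div_const _)))

theorem exp_le_posIdentity (x : ℝ) : Real.exp (-2) ≤ posIdentity x := by
  unfold posIdentity
  have h := sub_pos.2 exp_neg_two_lt
  rcases le_total x (Real.exp (-2)) with hx | hx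
  · rw [Real.smoothTransition.zero_of_nonpos (div_nonpos_of_nonpos_of_nonneg (by linarith) h.le)]
    simp
  · have := mul_nonneg (sub_nonneg.2 hx) (Real.smoothTransition.nonneg
      ((x - Real.exp (-2)) / (Real.exp (-1) - Real.exp (-2))))
    linarith

theorem posIdentity_pos (x : ℝ) : 0 < posIdentity x :=
  (Real.exp_pos _).trans_le (exp_le_posIdentity x)

theorem posIdentity_of_le {x : ℝ} (hx : Real.exp (-1) ≤ x) : posIdentity x = x := by
  unfold posIdentity
  have h := sub_pos.2 exp_neg_two_lt
  rw [Real.smoothTransition.one_of_one_le ((one_le_div h).2 (by linarith))]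
  ring

/-- This makes the logarithmic symbol at least 1 where τL ≥ 1, so that multipliers vanishing on [1,
∞) still vanish there. -/
theorem posIdentity_le {x : ℝ} (hx : x ≤ Real.exp (-1)) : posIdentity x ≤ Real.exp (-1) := by
  unfold posIdentity
  have h := sub_pos.2 exp_neg_two_lt
  have h0 := Real.smoothTransition.nonneg
    ((x - Real.exp (-2)) / (Real.exp (-1) - Real.exp (-2)))
  have h1 := Real.smoothTransition.le_one
    ((x - Real.exp (-2)) / (Real.exp (-1) - Real.exp (-2)))
  nlinarith

/-- A smooth function with compact support that equals `1` on `[0, 1]`. -/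
theorem exists_contDiff_eq_one : ∃ χ : ℝ → ℝ, ContDiff ℝ ∞ χ ∧ HasCompactSupport χ ∧
    ∀ x ∈ Icc (0 : ℝ) 1, χ x = 1 := by
  let b : ContDiffBump (0 : ℝ) := ⟨1, 2, one_pos, one_lt_two⟩
  refine ⟨b, b.contDiff, b.hasCompactSupport, fun x hx => b.one_of_mem_closedBall ?_⟩
  rw [mem_closedBall, Real.dist_eq, sub_zero, abs_of_nonneg hx.1]
  exact hx.2

/-- A smooth version of `- log x`, cut off near `0`. -/
theorem exists_log_symbol : ∃ (h : ℝ → ℝ) (hh : ℝ → ℂ) (C : ℝ), Measurable h ∧ (∀ x, |h x| ≤ C) ∧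
    IsFourierSymbol (fun x => (h x : ℂ)) hh ∧ (∀ x ∈ Icc (Real.exp (-1)) 1, h x = -Real.log x) ∧
    ∀ x ∈ Icc 0 (Real.exp (-1)), 1 ≤ h x := by
  obtain ⟨χ, hχ, hχc, hχ1⟩ := exists_contDiff_eq_one
  have hc : ContDiff ℝ ∞ fun x => -Real.log (posIdentity x) * χ x :=
    (contDiff_posIdentity.log fun x => (posIdentity_pos x).ne').neg.mul hχ
  have hs : HasCompactSupport fun x => -Real.log (posIdentity x) * χ x := hχc.mul_left
  obtain ⟨C, hC⟩ := hs.exists_bound_of_continuous hc.continuous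
  have he : Real.exp (-1) ≤ 1 := Real.exp_le_one_iff.2 (by norm_num)
  refine ⟨_, _, C, hc.continuous.measurable, hC, isFourierSymbol_of_contDiff
    (Complex.ofRealCLM.contDiff.comp hc) (hs.comp_left Complex.ofReal_zero), fun x hx => ?_,
    fun x hx => ?_⟩
  · rw [posIdentity_of_le hx.1, hχ1 x ⟨(Real.exp_pos _).le.trans hx.1, hx.2⟩, mul_one]
  · rw [hχ1 x ⟨hx.1, hx.2.trans he⟩, mul_one]
    have := Real.log_le_log (posIdentity_pos x) (posIdentity_le hx.2)
    rw [Real.log_exp] at this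
    linarith

/-- Undoes, on the window τL ≤ 1, the factor A that was needed to pass from L^p to L². -/
theorem exists_inv_symbol : ∃ w wh : ℝ → ℂ, Measurable w ∧ IsFourierSymbol w wh ∧
    ∀ x ∈ Icc (Real.exp (-1)) 1, w x * x = 1 := by
  obtain ⟨χ, hχ, hχc, hχ1⟩ := exists_contDiff_eq_one
  have hc : ContDiff ℝ ∞ fun x => (posIdentity x)⁻¹ * χ x :=
    (contDiff_posIdentity.inv fun x => (posIdentity_pos x).ne').mul hχ
  have hs : HasCompactSupport fun x => (posIdentity x)⁻¹ * χ x := hχc.mul_left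
  refine ⟨fun x => (((posIdentity x)⁻¹ * χ x : ℝ) : ℂ), _,
    (Complex.continuous_ofReal.comp hc.continuous).measurable, isFourierSymbol_of_contDiff
    (Complex.ofRealCLM.contDiff.comp hc) (hs.comp_left Complex.ofReal_zero), fun x hx => ?_⟩
  have hx0 : 0 < x := (Real.exp_pos _).trans_le hx.1
  change (((posIdentity x)⁻¹ * χ x : ℝ) : ℂ) * x = 1
  rw [posIdentity_of_le hx.1, hχ1 x ⟨hx0.le, hx.2⟩, mul_one, ← Complex.ofReal_mul,
    inv_mul_cancel₀ hx0.ne', Complex.ofReal_one]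

/-- For multipliers that already contain the factor e^{-x}, where A is to be kept. -/
theorem exists_one_symbol : ∃ w wh : ℝ → ℂ, Measurable w ∧ IsFourierSymbol w wh ∧
    ∀ x ∈ Icc (0 : ℝ) 1, w x = 1 := by
  obtain ⟨χ, hχ, hχc, hχ1⟩ := exists_contDiff_eq_one
  refine ⟨fun x => (χ x : ℂ), _, (Complex.continuous_ofReal.comp hχ.continuous).measurable,
    isFourierSymbol_of_contDiff (Complex.ofRealCLM.contDiff.comp hχ)
      (hχc.comp_left Complex.ofReal_zero), fun x hx => ?_⟩
  change (χ x : ℂ) = 1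
  rw [hχ1 x hx, Complex.ofReal_one]

end Symbols

/-! ### Fourier transforms with polynomial weights -/

section FourierWeights

theorem continuous_fourier {F : ℝ → ℂ} (hF : Integrable F) : Continuous (𝓕 F) :=
  VectorFourier.fourierIntegral_continuous (L := innerₗ ℝ) Real.continuous_fourierChar
    (by exact continuous_inner) hF

/-- The two usual forms of the weight are comparable. -/
theorem one_add_rpow_le {θ : ℝ} (hθ : 0 ≤ θ) (x : ℝ) :
    (1 + |x|) ^ θ ≤ 2 ^ (θ / 2) * (1 + x ^ 2) ^ (θ / 2) := by
  have h0 : 0 ≤ 1 + |x| := by positivity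
  rw [← Real.mul_rpow (by norm_num) (by positivity)]
  calc (1 + |x|) ^ θ = ((1 + |x|) ^ 2) ^ (θ / 2) := by
        rw [← Real.rpow_natCast, ← Real.rpow_mul h0]
        congr 1
        push_cast
        ring
    _ ≤ (2 * (1 + x ^ 2)) ^ (θ / 2) := by
        refine Real.rpow_le_rpow (by positivity) ?_ (by positivity)
        nlinarith [sq_nonneg (1 - |x|), sq_abs x]

theorem integrable_japanese {r : ℝ} (hr : 1 < r) :
    Integrable fun ξ : ℝ => (1 + (2 * Real.pi * ξ) ^ 2) ^ (-r / 2) := by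
  have h := integrable_rpow_neg_one_add_norm_sq (E := ℝ) (μ := volume) (r := r) (by simpa using hr)
  simp only [Real.norm_eq_abs, sq_abs] at h
  exact h.comp_mul_left' Real.two_pi_pos.ne'

theorem measurable_japanese (r : ℝ) :
    Measurable fun ξ : ℝ => (1 + (2 * Real.pi * ξ) ^ 2) ^ r := by
  fun_prop

/-- Weighted `L¹` norms of the Fourier transform are controlled by Sobolev norms. -/
theorem exists_lintegral_fourier_le_sobolevNorm {θ s : ℝ} (hθ : 0 ≤ θ) (hs : θ + 1 / 2 < s) :
    ∃ C : ℝ≥0, ∀ F : ℝ → ℂ, Integrable F →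
      ∫⁻ ξ, ‖𝓕 F ξ‖ₑ * ENNReal.ofReal ((1 + 2 * Real.pi * |ξ|) ^ θ) ≤ C * sobolevNorm s F := by
  -- Cauchy–Schwarz against the weight complementary to that of H^s, which is square integrable
  -- because 2(s - θ) > 1.
  set g : ℝ → ℂ := fun ξ => ((2 ^ (θ / 2) * (1 + (2 * Real.pi * ξ) ^ 2) ^ ((θ - s) / 2) : ℝ) : ℂ)
    with hg
  have hgm : Measurable g :=
    Complex.measurable_ofReal.comp ((measurable_japanese _).const_mul _)
  have hg2 : MemLp g 2 volume := by
    rw [memLp_two_iff_integrable_sq_norm hgm.aestronglyMeasurable]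
    refine ((integrable_japanese (r := 2 * (s - θ)) (by linarith)).const_mul (2 ^ θ)).congr
      (Filter.Eventually.of_forall fun ξ => ?_)
    have h0 : 0 ≤ 1 + (2 * Real.pi * ξ) ^ 2 := by positivity
    simp only [hg]
    rw [Complex.norm_real, Real.norm_of_nonneg (by positivity), mul_pow ((2 : ℝ) ^ (θ / 2)),
      ← Real.rpow_mul_natCast h0,
      ← Real.rpow_mul_natCast (by norm_num)]
    congr 2 <;> push_cast <;> ring
  refine ⟨(eLpNorm g 2 volume).toNNReal, fun F hF => ?_⟩
  rw [ENNReal.coe_toNNReal hg2.2.ne]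
  have hFm : AEStronglyMeasurable (fun ξ : ℝ =>
      (((1 + (2 * Real.pi * ξ) ^ 2) ^ (s / 2) : ℝ) : ℂ) * 𝓕 F ξ) volume :=
    ((Complex.measurable_ofReal.comp (measurable_japanese _)).mul
      (continuous_fourier hF).measurable).aestronglyMeasurable
  have h := eLpNorm_smul_le_mul_eLpNorm (r := 1) (p := 2) (q := 2) hFm hgm.aestronglyMeasurable
  refine le_trans ?_ h
  rw [eLpNorm_one_eq_lintegral_enorm]
  refine lintegral_mono fun ξ => ?_
  have h0 : 0 < 1 + (2 * Real.pi * ξ) ^ 2 := by positivity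
  rw [Pi.smul_apply', smul_eq_mul, ← mul_assoc, hg, ← Complex.ofReal_mul, enorm_mul, mul_comm]
  refine mul_le_mul_left ?_ _
  rw [← ofReal_norm, Complex.norm_real, Real.norm_of_nonneg (by positivity),
    mul_assoc ((2 : ℝ) ^ (θ / 2)), ← Real.rpow_add h0, mul_assoc 2, ← mul_assoc 2]
  refine ENNReal.ofReal_le_ofReal ?_
  have h1 := one_add_rpow_le hθ (2 * Real.pi * ξ)
  rw [abs_mul, abs_of_pos Real.two_pi_pos] at h1
  refine h1.trans (le_of_eq ?_)
  congr 2
  ring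

/-! ### The Bochner–Riesz profile and its Fourier transform. -/

/-- The function `y_+^α e^{-y}`. -/
def gammaFun (α : ℝ) (y : ℝ) : ℂ := ((max y 0 ^ α * Real.exp (-y) : ℝ) : ℂ)

variable {α : ℝ}

theorem continuous_gammaFun (hα : 0 < α) : Continuous (gammaFun α) := by
  unfold gammaFun
  have : Continuous fun y : ℝ => max y 0 ^ α :=
    (continuous_id.max continuous_const).rpow_const fun _ => Or.inr hα.le
  fun_prop

theorem integrable_gammaFun (hα : 0 < α) : Integrable (gammaFun α) := by
  have h := (Real.GammaIntegral_convergent (s := α + 1) (by linarith)).integrable_indicator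
    measurableSet_Ioi
  refine (h.ofReal (𝕜 := ℂ)).congr (Filter.Eventually.of_forall fun y => ?_)
  simp only [gammaFun]
  refine congrArg Complex.ofReal ?_
  by_cases hy : 0 < y
  · rw [indicator_of_mem (mem_Ioi.2 hy), max_eq_left hy.le, add_sub_cancel_right, mul_comm]
    rfl
  · rw [indicator_of_notMem (by simpa using hy), max_eq_right (not_lt.1 hy),
      Real.zero_rpow hα.ne', zero_mul]
    rfl

theorem hasDerivAt_max_rpow (hα : 0 < α) (y : ℝ) :
    HasDerivAt (fun y : ℝ => max y 0 ^ (α + 1)) ((α + 1) * max y 0 ^ α) y := by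
  have hneg : ∀ y : ℝ, y ≤ 0 → max y 0 ^ (α + 1) = 0 := fun y hy => by
    rw [max_eq_right hy, Real.zero_rpow (by linarith)]
  have hpos : HasDerivAt (fun y : ℝ => y ^ (α + 1)) ((α + 1) * y ^ α) y := by
    have := Real.hasDerivAt_rpow_const (x := y) (p := α + 1) (Or.inr (by linarith))
    rwa [add_sub_cancel_right] at this
  rcases lt_trichotomy y 0 with hy | hy | hy
  · rw [max_eq_right hy.le, Real.zero_rpow hα.ne', mul_zero]
    refine (hasDerivAt_const y (0 : ℝ)).congr_of_eventuallyEq ?_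
    filter_upwards [gt_mem_nhds hy] with z hz
    exact hneg z hz.le
  · subst hy
    rw [max_self]
    rw [← hasDerivWithinAt_univ, ← Iic_union_Ici (a := (0 : ℝ))]
    refine HasDerivWithinAt.union ?_ ?_
    · rw [Real.zero_rpow hα.ne', mul_zero]
      exact (hasDerivWithinAt_const (0 : ℝ) _ (0 : ℝ)).congr (fun z hz => hneg z hz) (hneg 0 le_rfl)
    · exact hpos.hasDerivWithinAt.congr (fun z hz => by rw [max_eq_left hz]) (by rw [max_self])
  · rw [max_eq_left hy.le]
    refine hpos.congr_of_eventuallyEq ?_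
    filter_upwards [lt_mem_nhds hy] with z hz
    rw [max_eq_left hz.le]

theorem hasDerivAt_gammaFun (hα : 0 < α) (y : ℝ) :
    HasDerivAt (gammaFun (α + 1)) ((α + 1) * gammaFun α y - gammaFun (α + 1) y) y := by
  have h := ((hasDerivAt_max_rpow hα y).mul ((hasDerivAt_neg y).exp)).ofReal_comp
  refine h.congr_deriv ?_
  simp only [gammaFun]
  push_cast
  ring

theorem smul_gammaFun (hα : 0 < α) (y : ℝ) : (y : ℂ) * gammaFun α y = gammaFun (α + 1) y := by
  simp only [gammaFun]
  rw [← Complex.ofReal_mul]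
  congr 1
  rcases le_total y 0 with hy | hy
  · rw [max_eq_right hy, Real.zero_rpow hα.ne', Real.zero_rpow (by linarith)]
    ring
  · rw [max_eq_left hy, Real.rpow_add_one' hy (by linarith)]
    ring

/-- The transform of the identity g_{α+1}' = (α + 1)g_α - g_{α+1}, where g_α is `gammaFun α`. -/
theorem fourier_gammaFun_succ (hα : 0 < α) (ξ : ℝ) :
    (1 + 2 * Real.pi * Complex.I * ξ) * 𝓕 (gammaFun (α + 1)) ξ = (α + 1) * 𝓕 (gammaFun α) ξ := by
  have hα1 : 0 < α + 1 := by linarith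
  have hd : deriv (gammaFun (α + 1)) = fun y => (α + 1) * gammaFun α y - gammaFun (α + 1) y :=
    funext fun y => (hasDerivAt_gammaFun hα y).deriv
  have hi := ((integrable_gammaFun hα).const_mul ((α : ℂ) + 1)).sub (integrable_gammaFun hα1)
  have h := congrFun (Real.fourier_deriv (integrable_gammaFun hα1)
    (fun y => (hasDerivAt_gammaFun hα y).differentiableAt) (by rw [hd]; exact hi)) ξ
  have h2 : 𝓕 (fun y => (α + 1) * gammaFun α y - gammaFun (α + 1) y) ξ =
      (α + 1) * 𝓕 (gammaFun α) ξ - 𝓕 (gammaFun (α + 1)) ξ := by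
    simp only [Real.fourier_eq]
    rw [← integral_const_mul, ← integral_sub
      (((Real.fourierIntegral_convergent_iff ξ).2 (integrable_gammaFun hα)).const_mul _)
      ((Real.fourierIntegral_convergent_iff ξ).2 (integrable_gammaFun hα1))]
    congr 1
    funext y
    rw [smul_sub, mul_smul_comm]
  rw [hd, h2, smul_eq_mul] at h
  linear_combination -h

theorem hasDerivAt_fourier_gammaFun (hα : 0 < α) (ξ : ℝ) :
    HasDerivAt (𝓕 (gammaFun α)) (-2 * Real.pi * Complex.I * 𝓕 (gammaFun (α + 1)) ξ) ξ := by
  have e1 : (fun x : ℝ => x • gammaFun α x) = gammaFun (α + 1) := by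
    funext x
    rw [Complex.real_smul, smul_gammaFun hα]
  have e2 : (fun x : ℝ => (-2 * Real.pi * Complex.I * x) • gammaFun α x) =
      (-2 * Real.pi * Complex.I) • gammaFun (α + 1) := by
    funext x
    rw [Pi.smul_apply, smul_eq_mul, smul_eq_mul, mul_assoc, smul_gammaFun hα]
  have h := Real.hasDerivAt_fourier (integrable_gammaFun hα)
    (by rw [e1]; exact integrable_gammaFun (by linarith)) ξ
  rw [e2] at h
  refine h.congr_deriv ?_
  have := congrFun (VectorFourier.fourierIntegral_const_smul Real.fourierChar volume (innerₗ ℝ)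
    (gammaFun (α + 1)) (-2 * Real.pi * Complex.I)) ξ
  exact this

/-- The Fourier transform of `y_+^α e^{-y}` is a multiple of `(1 + 2πiξ)^{-α-1}`. -/
theorem norm_fourier_gammaFun (hα : 0 < α) (ξ : ℝ) :
    ‖𝓕 (gammaFun α) ξ‖ = ‖𝓕 (gammaFun α) 0‖ * (1 + (2 * Real.pi * ξ) ^ 2) ^ (-(α + 1) / 2) := by
  set z : ℝ → ℂ := fun ξ => 1 + 2 * Real.pi * Complex.I * ξ with hz
  have hzre : ∀ ξ, (z ξ).re = 1 := fun ξ => by simp [hz]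
  have hslit : ∀ ξ, z ξ ∈ Complex.slitPlane := fun ξ => Or.inl (by rw [hzre]; exact one_pos)
  have hz0 : ∀ ξ, z ξ ≠ 0 := fun ξ => Complex.slitPlane_ne_zero (hslit ξ)
  have hzd : ∀ ξ, HasDerivAt (fun ξ => z ξ ^ ((α + 1 : ℝ) : ℂ))
      (((α + 1 : ℝ) : ℂ) * z ξ ^ (((α + 1 : ℝ) : ℂ) - 1) * (2 * Real.pi * Complex.I)) ξ := by
    intro ξ
    have h1 : HasDerivAt (fun w : ℂ => 1 + 2 * Real.pi * Complex.I * w)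
        (2 * Real.pi * Complex.I) (ξ : ℂ) := by
      simpa using ((hasDerivAt_id (ξ : ℂ)).const_mul (2 * Real.pi * Complex.I)).const_add 1
    exact (h1.cpow_const (c := ((α + 1 : ℝ) : ℂ)) (hslit ξ)).comp_ofReal
  -- The two relations between the transforms for α and α + 1 form a first order linear equation,
  -- for which (1 + 2πiξ)^{α+1} is an integrating factor.
  have hd : ∀ ξ, HasDerivAt (fun ξ => 𝓕 (gammaFun α) ξ * z ξ ^ ((α + 1 : ℝ) : ℂ)) 0 ξ := by
    intro ξ
    refine ((hasDerivAt_fourier_gammaFun hα ξ).mul (hzd ξ)).congr_deriv ?_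
    have h1 := fourier_gammaFun_succ hα ξ
    have h2 : z ξ ^ ((α + 1 : ℝ) : ℂ) = z ξ ^ (((α + 1 : ℝ) : ℂ) - 1) * z ξ := by
      rw [Complex.cpow_sub _ _ (hz0 ξ), Complex.cpow_one, div_mul_cancel₀ _ (hz0 ξ)]
    rw [h2]
    have h3 : z ξ = 1 + 2 * Real.pi * Complex.I * ξ := rfl
    rw [← h3] at h1
    push_cast
    linear_combination (-2 * Real.pi * Complex.I * z ξ ^ (((α : ℂ) + 1) - 1)) * h1
  have hc := is_const_of_deriv_eq_zero (fun ξ => (hd ξ).differentiableAt)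
    (fun ξ => (hd ξ).deriv) ξ 0
  have hz1 : z 0 = 1 := by simp [hz]
  rw [hz1, Complex.one_cpow, mul_one] at hc
  have hn := congrArg norm hc
  have hzn : ‖z ξ‖ = (1 + (2 * Real.pi * ξ) ^ 2) ^ (1 / 2 : ℝ) := by
    rw [← Real.sqrt_eq_rpow, ← Real.sqrt_sq (norm_nonneg _), Complex.sq_norm, Complex.normSq_apply]
    congr 1
    simp [hz]
    ring
  have h0 : 0 < 1 + (2 * Real.pi * ξ) ^ 2 := by positivity
  rw [norm_mul, Complex.norm_cpow_real, hzn, ← Real.rpow_mul h0.le] at hn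
  rw [← hn, mul_assoc, ← Real.rpow_add h0]
  have : 1 / 2 * (α + 1) + -(α + 1) / 2 = 0 := by ring
  rw [this, Real.rpow_zero, mul_one]

theorem integrable_fourier_gammaFun (hα : 0 < α) : Integrable (𝓕 (gammaFun α)) := by
  refine ((integrable_japanese (r := α + 1) (by linarith)).const_mul
    ‖𝓕 (gammaFun α) 0‖).mono' (continuous_fourier (integrable_gammaFun hα)).aestronglyMeasurable
    (Filter.Eventually.of_forall fun ξ => (norm_fourier_gammaFun hα ξ).le)

/-- The integrand is O(|ξ|^{θ-α-1}) at infinity; this is where the critical order of Bochner–Riesz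
summability enters. -/
theorem lintegral_fourier_gammaFun_ne_top (hα : 0 < α) {θ : ℝ} (hθ : 0 ≤ θ) (hθα : θ < α) :
    ∫⁻ ξ, ‖𝓕 (gammaFun α) ξ‖ₑ * ENNReal.ofReal ((1 + 2 * Real.pi * |ξ|) ^ θ) ≠ ∞ := by
  have hi := (integrable_japanese (r := α + 1 - θ) (by linarith)).const_mul
    (‖𝓕 (gammaFun α) 0‖ * 2 ^ (θ / 2))
  refine ((lintegral_mono fun ξ => ?_).trans_lt hi.lintegral_lt_top).ne
  have h0 : 0 < 1 + (2 * Real.pi * ξ) ^ 2 := by positivity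
  have h1 := one_add_rpow_le hθ (2 * Real.pi * ξ)
  rw [abs_mul, abs_of_pos Real.two_pi_pos] at h1
  rw [← ofReal_norm, ← ENNReal.ofReal_mul (norm_nonneg _), norm_fourier_gammaFun hα]
  refine ENNReal.ofReal_le_ofReal ?_
  calc ‖𝓕 (gammaFun α) 0‖ * (1 + (2 * Real.pi * ξ) ^ 2) ^ (-(α + 1) / 2) *
        (1 + 2 * Real.pi * |ξ|) ^ θ
      ≤ ‖𝓕 (gammaFun α) 0‖ * (1 + (2 * Real.pi * ξ) ^ 2) ^ (-(α + 1) / 2) *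
        (2 ^ (θ / 2) * (1 + (2 * Real.pi * ξ) ^ 2) ^ (θ / 2)) := by gcongr
    _ = ‖𝓕 (gammaFun α) 0‖ * 2 ^ (θ / 2) * ((1 + (2 * Real.pi * ξ) ^ 2) ^ (-(α + 1) / 2) *
        (1 + (2 * Real.pi * ξ) ^ 2) ^ (θ / 2)) := by ring
    _ = _ := by
        rw [← Real.rpow_add h0]
        congr 2
        ring

end FourierWeights

/-! ### Spectral multipliers -/

section Multipliers

variable {X : Type*} [MetricSpace X] [MeasurableSpace X] [BorelSpace X] {μ : Measure X} {n : ℝ}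

theorem spectralFunction_of_not_exists {H : Type*} [NormedAddCommGroup H] [InnerProductSpace ℂ H]
    [CompleteSpace H] {L : H →ₗ.[ℂ] H} (hE : ¬∃ E : ProjectionMeasure H, E.IsResolutionOf L)
    (F : ℝ → ℂ) : spectralFunction L F = 0 := by
  rw [spectralFunction, dif_neg hE]

/-- `L^p` bounds for `Φ(L)` when `Φ` agrees on `[0, ∞)` with a function
`G(h(v)) ω(v) v` of `v = e^{-τ l}`. -/
theorem exists_lebesgueOpNorm_le [TopologicalSpace.SeparableSpace X]
    (hμ : IsHomogeneousType μ n) (hn : 0 < n) {p a : ℝ} (hp1 : 1 ≤ p) (hp2 : p < 2)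
    (ha : (⌊n / 2⌋ : ℝ) + 1 < a) (K : ℝ≥0)
    {h : ℝ → ℝ} {ω hh ωh : ℝ → ℂ} {Ch : ℝ} (hhm : Measurable h) (hhC : ∀ x, |h x| ≤ Ch)
    (hhs : IsFourierSymbol (fun x => (h x : ℂ)) hh) (hωm : Measurable ω)
    (hωs : IsFourierSymbol ω ωh) :
    ∃ C : ℝ≥0, ∀ L : Lp ℂ 2 μ →ₗ.[ℂ] Lp ℂ 2 μ,
      (∀ f : L.domain, 0 ≤ (inner ℂ (f : Lp ℂ 2 μ) (L f)).re) →
      ∀ τ : ℝ, 0 < τ → PVE n a p τ K (heatSemigroup L τ) →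
      ∀ G Gh : ℝ → ℂ, Measurable G → Measurable Gh → Integrable Gh →
        (∀ x : ℝ, G x = ∫ ξ, Gh ξ * Complex.exp (Complex.I * (2 * Real.pi * ξ : ℝ) * x)) →
        ∫⁻ ξ, ‖Gh ξ‖ₑ * ENNReal.ofReal ((1 + 2 * Real.pi * |ξ|) ^ (n * (1 / p - 1 / 2))) ≠ ∞ →
        ∀ Φ : ℝ → ℂ, (∀ l, 0 ≤ l → Φ l = G (h (Real.exp (-(τ * l)))) *
          (ω (Real.exp (-(τ * l))) * (Real.exp (-(τ * l)) : ℝ))) →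
        lebesgueOpNorm (ENNReal.ofReal p) (ENNReal.ofReal p)
            (fun f : Lp ℂ 2 μ => spectralFunction L Φ f) ≤
          C * ∫⁻ ξ, ‖Gh ξ‖ₑ *
            ENNReal.ofReal ((1 + 2 * Real.pi * |ξ|) ^ (n * (1 / p - 1 / 2))) := by
  -- κ = ⌊n/2⌋ + 1 is the least integer with 2κ > n, and κ < a is the hypothesis on a.
  have hfl : 0 ≤ ⌊n / 2⌋ := Int.floor_nonneg.2 (by positivity)
  obtain ⟨m, hm⟩ := Int.eq_ofNat_of_zero_le hfl
  have hm' : (⌊n / 2⌋ : ℝ) = m := by rw [hm]; norm_cast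
  have hκ : ((m + 1 : ℕ) : ℝ) < a := by push_cast; rwa [← hm']
  have hκn : n < 2 * ((m + 1 : ℕ) : ℝ) := by
    have := Int.lt_floor_add_one (n / 2)
    push_cast
    rw [← hm']
    linarith
  obtain ⟨C, hC⟩ := exists_eLpNorm_integral_comp_le hμ hn hp1 hp2 hκ hκn K hhm hhC hhs hωm hωs
  refine ⟨C, fun L hL τ hτ hA G Gh hG hGm hGi hGG hN Φ hΦ => sInf_le fun f _ => ?_⟩
  change eLpNorm (spectralFunction L Φ f) _ _ ≤ _
  by_cases hE : ∃ E : ProjectionMeasure (Lp ℂ 2 μ), E.IsResolutionOf L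
  swap
  · rw [spectralFunction_of_not_exists hE, zero_apply,
      eLpNorm_congr_ae (Lp.coeFn_zero ℂ 2 μ), eLpNorm_zero]
    exact zero_le
  -- Cutting l at 0 bounds the symbol by 1 on all of ℝ and changes no operator, since the spectral
  -- measures live on [0, ∞).
  set v : ℝ → ℝ := fun l => Real.exp (-(τ * max l 0)) with hv
  have hvm : Measurable v := by fun_prop
  have hv1 : ∀ l, |v l| ≤ 1 := fun l => by
    rw [abs_of_pos (Real.exp_pos _), Real.exp_le_one_iff, neg_nonpos]
    positivity
  have hspec : ∀ F F' : ℝ → ℂ, (∀ l, 0 ≤ l → F l = F' l) →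
      spectralFunction L F = hE.choose.integral F' := fun F F' hFF' => by
    rw [spectralFunction, dif_pos hE]
    refine ProjectionMeasure.integral_congr_ae fun g => ?_
    filter_upwards [hE.choose_spec.ae_nonneg hL g] with l hl
    exact hFF' l hl
  have hheat : heatSemigroup L τ = hE.choose.integral fun l => (v l : ℂ) :=
    hspec _ _ fun l hl => by
      simp only [hv]
      rw [max_eq_left hl]
      push_cast
      rfl
  rw [hheat] at hA
  rw [hspec Φ (fun l => G (h (v l)) * (ω (v l) * v l)) fun l hl => by
    simp only [hv]
    rw [max_eq_left hl]
    exact hΦ l hl]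
  exact hC τ hτ hE.choose v hvm hv1 hA G Gh hG hGm hGi hGG hN f

theorem exp_neg_mem {x : ℝ} (h0 : 0 ≤ x) :
    (x ≤ 1 → Real.exp (-x) ∈ Icc (Real.exp (-1)) 1) ∧
      (1 ≤ x → Real.exp (-x) ∈ Icc 0 (Real.exp (-1))) :=
  ⟨fun h => ⟨Real.exp_le_exp.2 (by linarith), Real.exp_le_one_iff.2 (by linarith)⟩,
    fun h => ⟨(Real.exp_pos _).le, Real.exp_le_exp.2 (by linarith)⟩⟩

/-- The support condition gives the open half-line, continuity the endpoint 1. -/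
theorem eq_zero_of_one_le {F : ℝ → ℂ} (hF : Continuous F) (hs : tsupport F ⊆ Icc (-1) 1) {x : ℝ}
    (hx : 1 ≤ x) : F x = 0 := by
  have h1 : ∀ y ∈ Ioi (1 : ℝ), F y = 0 := fun y hy =>
    image_eq_zero_of_notMem_tsupport fun h => absurd (hs h).2 (not_le.2 hy)
  have h2 : closure (Ioi (1 : ℝ)) ⊆ {y | F y = 0} :=
    closure_minimal h1 (isClosed_singleton.preimage hF)
  rw [closure_Ioi] at h2
  exact h2 hx

theorem exists_multiplier_le [TopologicalSpace.SeparableSpace X]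
    (hμ : IsHomogeneousType μ n) (hn : 0 < n) {p a : ℝ} (hp1 : 1 ≤ p) (hp2 : p < 2)
    (ha : (⌊n / 2⌋ : ℝ) + 1 < a) (K : ℝ≥0) {s : ℝ} (hs : n * (1 / p - 1 / 2) + 1 / 2 < s) :
    ∃ C : ℝ≥0, ∀ L : Lp ℂ 2 μ →ₗ.[ℂ] Lp ℂ 2 μ,
      (∀ f : L.domain, 0 ≤ (inner ℂ (f : Lp ℂ 2 μ) (L f)).re) →
      ∀ τ : ℝ, 0 < τ → PVE n a p τ K (heatSemigroup L τ) →
      ∀ F : ℝ → ℂ, Continuous F → tsupport F ⊆ Icc (-1) 1 → sobolevNorm s F < ∞ →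
        lebesgueOpNorm (ENNReal.ofReal p) (ENNReal.ofReal p)
            (fun f : Lp ℂ 2 μ => spectralFunction L (fun l => F (τ * l)) f) ≤
          C * sobolevNorm s F := by
  have hθ : 0 ≤ n * (1 / p - 1 / 2) := mul_nonneg hn.le
    (sub_nonneg.2 (one_div_le_one_div_of_le (by linarith) hp2.le))
  obtain ⟨h, hh, Ch, hhm, hhC, hhs, hlog, hone⟩ := exists_log_symbol
  obtain ⟨w, wh, hwm, hws, hw⟩ := exists_inv_symbol
  obtain ⟨C1, hC1⟩ := exists_lebesgueOpNorm_le hμ hn hp1 hp2 ha K hhm hhC hhs hwm hws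
  obtain ⟨C2, hC2⟩ := exists_lintegral_fourier_le_sobolevNorm hθ hs
  refine ⟨C1 * C2, fun L hL τ hτ hA F hF hFs hFn => ?_⟩
  have hFi : Integrable F := hF.integrable_of_hasCompactSupport
    (isCompact_Icc.of_isClosed_subset (isClosed_tsupport F) hFs)
  have hFw := hC2 F hFi
  have hFhm := (continuous_fourier hFi).measurable
  have hFh : Integrable (𝓕 F) := by
    refine ⟨hFhm.aestronglyMeasurable, lt_of_le_of_lt (lintegral_mono fun ξ => ?_)
      (hFw.trans_lt (ENNReal.mul_lt_top ENNReal.coe_lt_top hFn))⟩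
    refine le_mul_of_one_le_right' (ENNReal.one_le_ofReal.2 (Real.one_le_rpow ?_ hθ))
    have : 0 ≤ 2 * Real.pi * |ξ| := by positivity
    linarith
  refine (hC1 L hL τ hτ hA F (𝓕 F) hF.measurable hFhm hFh (eq_integral_fourier hF hFi hFh)
    (hFw.trans_lt (ENNReal.mul_lt_top ENNReal.coe_lt_top hFn)).ne _ fun l hl => ?_).trans ?_
  · have hx : 0 ≤ τ * l := by positivity
    -- On τl ≤ 1 the symbols reproduce F(τl); on τl ≥ 1 both sides vanish, because the logarithmic
    -- symbol is at least 1 there.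
    rcases le_total (τ * l) 1 with hx1 | hx1
    · have hm := (exp_neg_mem hx).1 hx1
      rw [hlog _ hm, hw _ hm, Real.log_exp, neg_neg, mul_one]
    · rw [eq_zero_of_one_le hF hFs hx1,
        eq_zero_of_one_le hF hFs (hone _ ((exp_neg_mem hx).2 hx1)), zero_mul]
  · rw [ENNReal.coe_mul, mul_assoc]
    exact mul_le_mul_right hFw _

theorem gammaFun_one_sub_eq_integral {α : ℝ} (hα : 0 < α) (x : ℝ) :
    gammaFun α (1 - x) = ∫ ξ, (𝓕 (gammaFun α) (-ξ) * Complex.exp (-(Complex.I *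
      (2 * Real.pi * ξ : ℝ)))) * Complex.exp (Complex.I * (2 * Real.pi * ξ : ℝ) * x) := by
  rw [eq_integral_fourier (continuous_gammaFun hα) (integrable_gammaFun hα)
    (integrable_fourier_gammaFun hα), ← integral_neg_eq_self]
  congr 1
  funext ξ
  rw [mul_assoc (𝓕 (gammaFun α) (-ξ)) (Complex.exp _), ← Complex.exp_add]
  congr 2
  push_cast
  ring

theorem exists_bochnerRiesz_le [TopologicalSpace.SeparableSpace X]
    (hμ : IsHomogeneousType μ n) (hn : 0 < n) {p a : ℝ} (hp1 : 1 ≤ p) (hp2 : p < 2)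
    (ha : (⌊n / 2⌋ : ℝ) + 1 < a) (K : ℝ≥0) {α : ℝ} (hα : n * (1 / p - 1 / 2) < α) :
    ∃ C : ℝ≥0, ∀ L : Lp ℂ 2 μ →ₗ.[ℂ] Lp ℂ 2 μ,
      (∀ f : L.domain, 0 ≤ (inner ℂ (f : Lp ℂ 2 μ) (L f)).re) →
      ∀ R : ℝ, 0 < R → PVE n a p R⁻¹ K (heatSemigroup L R⁻¹) →
        lebesgueOpNorm (ENNReal.ofReal p) (ENNReal.ofReal p)
          (fun f : Lp ℂ 2 μ => bochnerRiesz L α R f) ≤ C := by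
  have hθ : 0 ≤ n * (1 / p - 1 / 2) := mul_nonneg hn.le
    (sub_nonneg.2 (one_div_le_one_div_of_le (by linarith) hp2.le))
  have hα0 : 0 < α := hθ.trans_lt hα
  obtain ⟨h, hh, Ch, hhm, hhC, hhs, hlog, hone⟩ := exists_log_symbol
  obtain ⟨w, wh, hwm, hws, hw⟩ := exists_one_symbol
  obtain ⟨C1, hC1⟩ := exists_lebesgueOpNorm_le hμ hn hp1 hp2 ha K hhm hhC hhs hwm hws
  -- The transform of e · g(1 - x) with g = `gammaFun α`, which is a reflection and a phase. As e ·
  -- g(1 - x) = (1 - x)_+^α e^x, multiplication by A = e^{-x} completes the Bochner–Riesz mean.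
  set Gh : ℝ → ℂ := fun ξ => Complex.exp 1 * (𝓕 (gammaFun α) (-ξ) * Complex.exp (-(Complex.I *
      (2 * Real.pi * ξ : ℝ)))) with hGh
  have hexp : ∀ ξ : ℝ, ‖Complex.exp (-(Complex.I * (2 * Real.pi * ξ : ℝ)))‖ = 1 := fun ξ => by
    have := ProjectionMeasure.norm_exp_I_mul (2 * Real.pi * ξ) (-1)
    rwa [Complex.ofReal_neg, Complex.ofReal_one, mul_neg_one] at this
  have hGhn : ∀ ξ, ‖Gh ξ‖ = Real.exp 1 * ‖𝓕 (gammaFun α) (-ξ)‖ := fun ξ => by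
    rw [hGh, norm_mul, norm_mul, hexp, mul_one, Complex.norm_exp, Complex.one_re]
  have hFc := continuous_fourier (integrable_gammaFun hα0)
  have hGhm : Measurable Gh := by
    have : Continuous Gh := by fun_prop
    exact this.measurable
  have hGhi : Integrable Gh :=
    (((integrable_fourier_gammaFun hα0).comp_neg).norm.const_mul (Real.exp 1)).mono'
      hGhm.aestronglyMeasurable (Filter.Eventually.of_forall fun ξ => (hGhn ξ).le)
  have hNtop : ∫⁻ ξ, ‖Gh ξ‖ₑ *
      ENNReal.ofReal ((1 + 2 * Real.pi * |ξ|) ^ (n * (1 / p - 1 / 2))) ≠ ∞ := by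
    have h1 := lintegral_fourier_gammaFun_ne_top hα0 hθ hα
    rw [← lintegral_neg_eq_self] at h1
    have e : ∀ ξ : ℝ, ‖Gh ξ‖ₑ *
        ENNReal.ofReal ((1 + 2 * Real.pi * |ξ|) ^ (n * (1 / p - 1 / 2))) =
        ENNReal.ofReal (Real.exp 1) * (‖𝓕 (gammaFun α) (-ξ)‖ₑ *
          ENNReal.ofReal ((1 + 2 * Real.pi * |(-ξ)|) ^ (n * (1 / p - 1 / 2)))) := fun ξ => by
      rw [← ofReal_norm, hGhn, ENNReal.ofReal_mul (Real.exp_pos 1).le, ofReal_norm, abs_neg,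
        mul_assoc]
    simp_rw [e]
    rw [lintegral_const_mul' _ _ ENNReal.ofReal_ne_top]
    exact ENNReal.mul_ne_top ENNReal.ofReal_ne_top h1
  refine ⟨(C1 * ∫⁻ ξ, ‖Gh ξ‖ₑ *
      ENNReal.ofReal ((1 + 2 * Real.pi * |ξ|) ^ (n * (1 / p - 1 / 2)))).toNNReal,
    fun L hL R hR hA => ?_⟩
  rw [ENNReal.coe_toNNReal (ENNReal.mul_ne_top ENNReal.coe_ne_top hNtop)]
  refine hC1 L hL R⁻¹ (inv_pos.2 hR) hA (fun x => Complex.exp 1 * gammaFun α (1 - x)) Gh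
    ?_ hGhm hGhi (fun x => ?_) hNtop _ fun l hl => ?_
  · exact (((continuous_gammaFun hα0).comp (continuous_const.sub continuous_id)).measurable).const_mul _
  · rw [gammaFun_one_sub_eq_integral hα0, ← integral_const_mul]
    simp only [hGh, mul_assoc]
  · have hx : 0 ≤ R⁻¹ * l := by positivity
    have hxl : l / R = R⁻¹ * l := by rw [div_eq_inv_mul]
    rw [hxl, hw _ ⟨(Real.exp_pos _).le, Real.exp_le_one_iff.2 (by linarith)⟩, one_mul]
    rcases le_total (R⁻¹ * l) 1 with hx1 | hx1
    · rw [hlog _ ((exp_neg_mem hx).1 hx1), Real.log_exp, neg_neg, gammaFun]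
      push_cast
      rw [mul_comm (Complex.exp 1), mul_assoc, mul_assoc, ← Complex.exp_add, ← Complex.exp_add]
      ring_nf
      simp
    · have h1 := hone _ ((exp_neg_mem hx).2 hx1)
      rw [gammaFun, max_eq_right (by linarith), max_eq_right (by linarith),
        Real.zero_rpow hα0.ne']
      simp

end Multipliers

end

/-! ### The theorem. -/

theorem corollary3p2 {X : Type*} [MetricSpace X] [TopologicalSpace.SeparableSpace X]
    [MeasurableSpace X] [BorelSpace X] (μ : Measure X) (n : ℝ) (hn : 0 < n)
    (hμ : IsHomogeneousType μ n)
    (p : ℝ) (hp1 : 1 ≤ p) (hp2 : p < 2) (a : ℝ) (ha : (⌊n / 2⌋ : ℝ) + 1 < a) (K : ℝ≥0) :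
    (∀ s : ℝ, n * (1 / p - 1 / 2) + 1 / 2 < s → ∃ C : ℝ≥0,
      ∀ L : Lp ℂ 2 μ →ₗ.[ℂ] Lp ℂ 2 μ, IsSelfAdjoint L →
        (∀ f : L.domain, 0 ≤ (inner ℂ (f : Lp ℂ 2 μ) (L f)).re) →
        (∀ τ : ℝ, 0 < τ → PVE n a p τ K (heatSemigroup L τ) →
          ∀ F : ℝ → ℂ, Continuous F → tsupport F ⊆ Icc (-1) 1 → sobolevNorm s F < ∞ →
            lebesgueOpNorm (ENNReal.ofReal p) (ENNReal.ofReal p)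
                (fun f : Lp ℂ 2 μ => spectralFunction L (fun l => F (τ * l)) f)
              ≤ C * sobolevNorm s F) ∧
        ((∀ τ : ℝ, 0 < τ → PVE n a p τ K (heatSemigroup L τ)) →
          ∀ F : ℝ → ℂ, Continuous F → tsupport F ⊆ Icc (-1) 1 → sobolevNorm s F < ∞ →
            ⨆ (τ : ℝ) (_ : 0 < τ), lebesgueOpNorm (ENNReal.ofReal p) (ENNReal.ofReal p)
                (fun f : Lp ℂ 2 μ => spectralFunction L (fun l => F (τ * l)) f)
              ≤ C * sobolevNorm s F)) ∧
    (∀ α : ℝ, n * (1 / p - 1 / 2) < α → ∃ C : ℝ≥0,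
      ∀ L : Lp ℂ 2 μ →ₗ.[ℂ] Lp ℂ 2 μ, IsSelfAdjoint L →
        (∀ f : L.domain, 0 ≤ (inner ℂ (f : Lp ℂ 2 μ) (L f)).re) →
        (∀ τ : ℝ, 0 < τ → PVE n a p τ K (heatSemigroup L τ)) →
          ⨆ (R : ℝ) (_ : 0 < R), lebesgueOpNorm (ENNReal.ofReal p) (ENNReal.ofReal p)
              (fun f : Lp ℂ 2 μ => bochnerRiesz L α R f)
            ≤ C) := by
  refine ⟨fun s hs => ?_, fun α hα => ?_⟩
  · obtain ⟨C, hC⟩ := exists_multiplier_le hμ hn hp1 hp2 ha K hs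
    exact ⟨C, fun L _ hL => ⟨fun τ hτ hA F hF hFs hFn => hC L hL τ hτ hA F hF hFs hFn,
      fun hA F hF hFs hFn => iSup₂_le fun τ hτ => hC L hL τ hτ (hA τ hτ) F hF hFs hFn⟩⟩
  · obtain ⟨C, hC⟩ := exists_bochnerRiesz_le hμ hn hp1 hp2 ha K hα
    exact ⟨C, fun L _ hL hA => iSup₂_le fun R hR => hC L hL R hR (hA R⁻¹ (inv_pos.2 hR))⟩
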